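/- Let $V:\mathbb R\to\mathbb R$ be piecewise Lipschitz with finitely many pieces: there is a finite set $S\subset\mathbb R$ (containing all discontinuities of $V$) such that $V$ is Lipschitz on every interval not meeting $S$. Assume that $V(x)\to\ell_{\pm\infty}\in\mathbb R$ as $x\to\pm\infty$, that $\ell_{+\infty}\le\ell_{-\infty}$, and that $\sqrt{(\ell_{+\infty}-V)_+}\in L^1(\mathbb R)$, where $a_+=\max\{a,0\}$. For $h\in(0,1)$ let $\mathfrak h_h=-h^2\partial_x^2+V$ be the self-adjoint operator on $L^2(\mathbb R)$ with domain $H^2(\mathbb R)$, and let $\mathcal N(\mathfrak h_h,a)$ be the number of points of the spectrum of $\mathfrak h_h$ in $(-\infty,a]$, counted with multiplicity. Let $E:(0,1)\to(-\infty,\ell_{+\infty})$ be a function such that 1. for every $h\in(0,1)$ one has $\{x\in\mathbb R: V(x)\le E(h)\}=[x_{\min}(h),x_{\max}(h)]$ for some real numbers $x_{\min}(h),x_{\max}(h)$; 2. $h^{1/3}\,(x_{\max}(h)-x_{\min}(h))\to0$ as $h\to0$; 3. $E(h)\to E_0\le\ell_{+\infty}$ as $h\to0$. Then $\mathcal N(\mathfrak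 h_h,E(h))<\infty$ for every $h\in(0,1)$, and $$h\,\mathcal N(\mathfrak h_h,E(h))\xrightarrow[h\to0]{}\frac1\pi\int_{\mathbb R}\sqrt{(E_0-V)_+}\,dx .$$ In particular, if the integral is positive, then $$\mathcal N(\mathfrak h_h,E(h))\underset{h\to0}{\sim}\frac1{\pi h}\int_{\mathbb R}\sqrt{(E_0-V)_+}\,dx .$$ -/

import Mathlib

open MeasureTheory Filter Topology Asymptotics

/-! ### Spectral counting function of an unbounded operator -/

section Spectral

variable {H : Type*} [NormedAddCommGroup H] [NormedSpace ℂ H]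

/-- The resolvent set of an unbounded operator `T`: all `z` for which `T - z`, as a map from the
domain of `T` to the whole space, has a bounded everywhere defined two-sided inverse `R`. -/
def unboundedResolventSet (T : H →ₗ.[ℂ] H) : Set ℂ :=
  {z | ∃ R : H →L[ℂ] H,
      (∀ y : H, ∃ hy : R y ∈ T.domain, T ⟨R y, hy⟩ - z • R y = y) ∧
      (∀ x : T.domain, R (T x - z • (x : H)) = x)}

/-- The spectrum of an unbounded operator. -/
def unboundedSpectrum (T : H →ₗ.[ℂ] H) : Set ℂ := (unboundedResolventSet T)ᶜ

/-- The eigenspace `{x ∈ Dom T | T x = z x}` of an unbounded operator. -/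
def unboundedEigenspace (T : H →ₗ.[ℂ] H) (z : ℂ) : Submodule ℂ H :=
  (LinearMap.ker (T.toFun - z • T.domain.subtype)).map T.domain.subtype

/-- The multiplicity of `z` as an eigenvalue: the dimension of the eigenspace, possibly `⊤`. -/
noncomputable def eigenvalueMultiplicity (T : H →ₗ.[ℂ] H) (z : ℂ) : ℕ∞ :=
  Cardinal.toENat (Module.rank ℂ (unboundedEigenspace T z))

/-- The part of the (real) spectrum of `T` in `(-∞, a]`. -/
def spectrumBelow (T : H →ₗ.[ℂ] H) (a : ℝ) : Set ℝ :=
  {t : ℝ | (t : ℂ) ∈ unboundedSpectrum T ∧ t ≤ a}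

open Classical in
/-- The counting function: the number of points of the spectrum of the self-adjoint operator `T`
in `(-∞, a]`, counted with multiplicity. It is `⊤` if there are infinitely many such points. If
there are finitely many, each of them is an isolated point of the spectrum, hence an eigenvalue,
and it is counted with the dimension of its eigenspace. In particular, for a self-adjoint operator
that is bounded below, the value differs from `⊤` if and only if `a` lies strictly below the
essential spectrum. -/
noncomputable def countingFunction (T : H →ₗ.[ℂ] H) (a : ℝ) : ℕ∞ :=
  if hfin : (spectrumBelow T a).Finite then
    ∑ t ∈ hfin.toFinset, eigenvalueMultiplicity T (t : ℂ)
  else ⊤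

end Spectral

/-! ### The one-dimensional Schrödinger operator -/

/-- The Hilbert space `L²(ℝ; ℂ)`. -/
abbrev L2Line : Type := Lp ℂ 2 (volume : Measure ℝ)

/-- `ψ ∈ H²(ℝ)` with second derivative `g ∈ L²(ℝ)`: the class `ψ` has a representative `u` that is
differentiable with derivative `v`, and `v` is locally absolutely continuous with `v' = g`
almost everywhere. -/
def IsSecondDeriv (ψ g : L2Line) : Prop :=
  ∃ u v : ℝ → ℂ, (ψ : ℝ → ℂ) =ᵐ[volume] u ∧ (∀ x, HasDerivAt u (v x) x) ∧
    ∀ a b : ℝ, v b - v a = ∫ t in a..b, (g : ℝ → ℂ) t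

theorem L2Line.intervalIntegrable (g : L2Line) (a b : ℝ) :
    IntervalIntegrable (g : ℝ → ℂ) volume a b :=
  (((Lp.memLp g).locallyIntegrable (by norm_num)).integrableOn_isCompact
    isCompact_uIcc).intervalIntegrable

theorem IsSecondDeriv.zero : IsSecondDeriv 0 0 := by
  refine ⟨0, 0, Lp.coeFn_zero _ _ _, fun x => hasDerivAt_const x 0, fun a b => ?_⟩
  have hz : ∫ t in a..b, ((0 : L2Line) : ℝ → ℂ) t = ∫ t in a..b, (0 : ℂ) := by
    apply intervalIntegral.integral_congr_ae
    filter_upwards with t _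
    simp
  rw [hz]; simp

theorem IsSecondDeriv.add {ψ₁ ψ₂ g₁ g₂ : L2Line} (h₁ : IsSecondDeriv ψ₁ g₁)
    (h₂ : IsSecondDeriv ψ₂ g₂) : IsSecondDeriv (ψ₁ + ψ₂) (g₁ + g₂) := by
  obtain ⟨u₁, v₁, e₁, d₁, i₁⟩ := h₁
  obtain ⟨u₂, v₂, e₂, d₂, i₂⟩ := h₂
  refine ⟨u₁ + u₂, v₁ + v₂, (Lp.coeFn_add _ _).trans (e₁.add e₂),
    fun x => (d₁ x).add (d₂ x), fun a b => ?_⟩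
  have hz : ∫ t in a..b, ((g₁ + g₂ : L2Line) : ℝ → ℂ) t =
      ∫ t in a..b, ((g₁ : ℝ → ℂ) t + (g₂ : ℝ → ℂ) t) := by
    apply intervalIntegral.integral_congr_ae
    filter_upwards [Lp.coeFn_add g₁ g₂] with t ht _
    simpa using ht
  rw [hz, intervalIntegral.integral_add (L2Line.intervalIntegrable _ _ _)
    (L2Line.intervalIntegrable _ _ _), ← i₁, ← i₂]
  simp only [Pi.add_apply]; ring

theorem IsSecondDeriv.smul (c : ℂ) {ψ g : L2Line} (h₁ : IsSecondDeriv ψ g) :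
    IsSecondDeriv (c • ψ) (c • g) := by
  obtain ⟨u, v, e, d, i⟩ := h₁
  refine ⟨c • u, c • v, (Lp.coeFn_smul _ _).trans (e.const_smul c),
    fun x => (d x).const_smul c, fun a b => ?_⟩
  have hz : ∫ t in a..b, ((c • g : L2Line) : ℝ → ℂ) t =
      ∫ t in a..b, c • (g : ℝ → ℂ) t := by
    apply intervalIntegral.integral_congr_ae
    filter_upwards [Lp.coeFn_smul c g] with t ht _
    simpa using ht
  rw [hz, intervalIntegral.integral_smul, ← i]
  simp only [Pi.smul_apply, smul_sub]

/-- The second derivative of the zero function is zero (so second derivatives are unique). -/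
theorem IsSecondDeriv.eq_zero {g : L2Line} (h₁ : IsSecondDeriv 0 g) : g = 0 := by
  obtain ⟨u, v, e, d, i⟩ := h₁
  have hu : u = 0 := by
    have hc : Continuous u := continuous_iff_continuousAt.2 fun x => (d x).continuousAt
    exact (hc.ae_eq_iff_eq volume continuous_const).1
      (e.symm.trans (Lp.coeFn_zero _ _ _))
  have hv : v = 0 := by
    funext x
    have := d x
    rw [hu] at this
    exact this.unique (hasDerivAt_const x 0)
  have hloc : LocallyIntegrable (g : ℝ → ℂ) volume :=
    (Lp.memLp g).locallyIntegrable (by norm_num)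
  have hint : ∀ x, ∫ t in (0 : ℝ)..x, (g : ℝ → ℂ) t = 0 := fun x => by
    rw [← i 0 x, hv]; simp
  rw [Lp.eq_zero_iff_ae_eq_zero]
  filter_upwards [_root_.LocallyIntegrable.ae_hasDerivAt_integral hloc] with x hx
  have := hx 0
  simp only [hint] at this
  exact this.unique (hasDerivAt_const x 0)

/-- The graph of `-h² ∂ₓ² + V` with its natural domain: the pairs `(ψ, f)` of elements of `L²(ℝ)`
with `ψ ∈ H²(ℝ)` and `f = -h² ψ'' + V ψ`. For bounded `V` the domain is `H²(ℝ)`. -/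
def schrodingerGraph (h : ℝ) (V : ℝ → ℝ) : Submodule ℂ (L2Line × L2Line) where
  carrier := {p | ∃ g : L2Line, IsSecondDeriv p.1 g ∧
    (p.2 : ℝ → ℂ) =ᵐ[volume] fun x => -(h : ℂ) ^ 2 * (g : ℝ → ℂ) x + (V x : ℂ) * (p.1 : ℝ → ℂ) x}
  zero_mem' := by
    refine ⟨0, IsSecondDeriv.zero, ?_⟩
    filter_upwards [Lp.coeFn_zero ℂ 2 (volume : Measure ℝ)] with t ht
    simp only [Prod.fst_zero, Prod.snd_zero, ht]
    simp
  add_mem' := by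
    rintro p q ⟨g, hg, eg⟩ ⟨k, hk, ek⟩
    refine ⟨g + k, hg.add hk, ?_⟩
    filter_upwards [eg, ek, Lp.coeFn_add g k, Lp.coeFn_add p.1 q.1, Lp.coeFn_add p.2 q.2]
      with t h1 h2 h3 h4 h5
    simp only [Prod.fst_add, Prod.snd_add, h3, h4, h5, Pi.add_apply, h1, h2]
    ring
  smul_mem' := by
    rintro c p ⟨g, hg, eg⟩
    refine ⟨c • g, hg.smul c, ?_⟩
    filter_upwards [eg, Lp.coeFn_smul c g, Lp.coeFn_smul c p.1, Lp.coeFn_smul c p.2]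
      with t h1 h3 h4 h5
    simp only [Prod.smul_fst, Prod.smul_snd, h3, h4, h5, Pi.smul_apply, h1, smul_eq_mul]
    ring

theorem schrodingerGraph_single_valued (h : ℝ) (V : ℝ → ℝ) (p : L2Line × L2Line)
    (hp : p ∈ schrodingerGraph h V) (h0 : p.1 = 0) : p.2 = 0 := by
  obtain ⟨g, hg, eg⟩ := hp
  rw [h0] at hg
  have hg0 := hg.eq_zero
  rw [Lp.eq_zero_iff_ae_eq_zero]
  rw [h0, hg0] at eg
  filter_upwards [eg, Lp.coeFn_zero ℂ 2 (volume : Measure ℝ)] with t h1 h2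
  rw [h1, h2]
  simp

/-- The Schrödinger operator `-h² ∂ₓ² + V` as an unbounded operator on `L²(ℝ; ℂ)`. -/
noncomputable def schrodinger (h : ℝ) (V : ℝ → ℝ) : L2Line →ₗ.[ℂ] L2Line :=
  (schrodingerGraph h V).toLinearPMap

/-- The operator `schrodinger h V` has the graph it is meant to have. -/
theorem schrodinger_graph (h : ℝ) (V : ℝ → ℝ) :
    (schrodinger h V).graph = schrodingerGraph h V :=
  Submodule.toLinearPMap_graph_eq _ (schrodingerGraph_single_valued h V)

/-! ### Piecewise Lipschitz functions -/

/-- `V` is piecewise Lipschitz with finitely many pieces: off a finite set `S` of points, which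
contains all discontinuities, `V` is Lipschitz on every interval that does not meet `S` (with one
constant, as there are only finitely many pieces). The values of `V` on `S` are arbitrary. -/
def PiecewiseLipschitz (V : ℝ → ℝ) : Prop :=
  ∃ (S : Finset ℝ) (K : NNReal), ∀ I : Set ℝ, I.OrdConnected → Disjoint I (S : Set ℝ) →
    LipschitzOnWith K V I

/-! The counting function is bracketed by Dirichlet conditions, with explicit sine functions on
short cells. A cell of length `s` on which `V ≥ m` and `s²(a - m) < h²π²` carries no Dirichlet
energy up to `a`; one on which `V ≤ m` and `s²(a - m) > h²π²` carries at least one. Nearly constant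
`V` thus gives about `s √(a - V)₊ / (πh)` states, and summing over cells produces the phase space
integral.

Upper bound: cut the well into `k` subcells and require functions to vanish at the `k + 1` cut
points. On this space of codimension at most `k + 1` the form of `-h²∂² + V - a` is positive, by
Wirtinger's inequality inside the well (`IsControlled`) and by `V > a` outside
(`IsControlled.exists_formGT`). Lower bound: half period sines on `l` disjoint intervals span an
`l`-dimensional space on which the form is negative (`IsPacked`, `card_le_of_isTrial`).

Both bounds are turned into statements on the spectrum through the resolvent `R = (T + c)⁻¹`, which
is bounded, self-adjoint and positive. With `ψ = R f` the form of `T + c` at `ψ` is `⟪f, R f⟫`, so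
form inequalities become inequalities between `⟪f, R f⟫` and `‖R f‖²`. The min-max principle is
replaced by `toNat_countingFunction_le` and `card_le_toNat_countingFunction`. A second energy `b >
a`, with `V > b` off a compact interval, keeps `a` below the essential spectrum and gives
finiteness.

The error analysis takes cells of length at most `h^(2/3)` on a well of length `L`. The Lipschitz
bound changes the momentum by `O(h^(1/3))` on a cell, a total of `O(L h^(1/3))`. Rounding costs `πh`
on each of at most `L h^(-2/3) + 1` cells, again `O(L h^(1/3) + h)`. Cells that meet `S` contribute
`O(h^(2/3))` in all. These errors vanish exactly because `h^(1/3) L → 0` is assumed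
(`hasCounts_interval`). Dominated convergence then replaces `E h` by `E₀` in the integral. -/

/-! ### Counting eigenvalues through the resolvent -/

section AbstractCounting

open scoped InnerProductSpace
open Module

variable {H : Type*} [NormedAddCommGroup H] [InnerProductSpace ℂ H] [CompleteSpace H]

/-- An injective self-adjoint operator that is bounded below on a subspace of finite codimension
is invertible. -/
theorem IsSelfAdjoint.isUnit_of_le_norm_on_ker {F : Type*} [AddCommGroup F] [Module ℂ F]
    [FiniteDimensional ℂ F] {A : H →L[ℂ] H} (hA : IsSelfAdjoint A) (hinj : ∀ f, A f = 0 → f = 0)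
    (L : H →ₗ[ℂ] F) {ε : ℝ} (hε : 0 < ε) (hb : ∀ f, L f = 0 → ε * ‖f‖ ≤ ‖A f‖) : IsUnit A := by
  -- `L` need not be continuous, so its kernel need not be closed. The bound passes to the closure,
  -- which still has finite codimension. Hence `A` maps it onto a closed subspace, the range of `A`
  -- is closed too, and self-adjointness with injectivity makes the range dense.
  set N : Submodule ℂ H := (LinearMap.ker L).topologicalClosure with hN
  have hbN : ∀ f ∈ N, ε * ‖f‖ ≤ ‖A f‖ := by
    intro f hf
    have hcl : IsClosed {f : H | ε * ‖f‖ ≤ ‖A f‖} :=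
      isClosed_le (by fun_prop) (by fun_prop)
    exact closure_minimal (fun f hf => hb f hf) hcl hf
  have : (LinearMap.ker L).CoFG := by
    have : FiniteDimensional ℂ (H ⧸ LinearMap.ker L) :=
      (LinearMap.quotKerEquivRange L).symm.finiteDimensional
    exact ‹FiniteDimensional ℂ (H ⧸ LinearMap.ker L)›
  have : N.CoFG := Submodule.CoFG.of_le (Submodule.le_topologicalClosure _) inferInstance
  have hNclosed : IsClosed (N : Set H) := Submodule.isClosed_topologicalClosure _
  have hmap : IsClosed ((N.map (A : H →ₗ[ℂ] H) : Submodule ℂ H) : Set H) := by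
    have : CompleteSpace N := hNclosed.completeSpace_coe
    have hanti : AntilipschitzWith (⟨ε⁻¹, by positivity⟩ : NNReal) (A.comp N.subtypeL) := by
      refine (A.comp N.subtypeL).antilipschitz_of_bound fun f => ?_
      have := hbN f f.2
      have h2 : ‖(f : H)‖ = ε⁻¹ * (ε * ‖(f : H)‖) := by field_simp
      change ‖(f : H)‖ ≤ ε⁻¹ * ‖A f‖
      rw [h2]; gcongr
    have := hanti.isClosed_range (A.comp N.subtypeL).uniformContinuous
    convert this using 1
    ext y; simp
  have hrange : IsClosed ((LinearMap.range (A : H →ₗ[ℂ] H) : Submodule ℂ H) : Set H) :=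
    LinearMap.isClosed_range_of_isClosed_map_of_finiteDimensional_quotient hmap
  rw [ContinuousLinearMap.isUnit_iff_bijective]
  refine ⟨(injective_iff_map_eq_zero A).2 hinj, ?_⟩
  have horth : (LinearMap.range (A : H →ₗ[ℂ] H))ᗮ = ⊥ := by
    rw [Submodule.eq_bot_iff]
    intro x hx
    apply hinj
    have h1 := hx (A (A x)) ⟨A x, rfl⟩
    have h2 : ⟪A (A x), x⟫_ℂ = ⟪A x, A x⟫_ℂ := by
      exact hA.isSymmetric (A x) x
    rw [h2] at h1
    simpa using h1
  have hcomp : IsComplete ((LinearMap.range (A : H →ₗ[ℂ] H) : Submodule ℂ H) : Set H) :=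
    hrange.isComplete
  have : CompleteSpace (LinearMap.range (A : H →ₗ[ℂ] H)) := hcomp.completeSpace_coe
  have htop := Submodule.orthogonal_eq_bot_iff.1 horth
  exact LinearMap.range_eq_top.1 htop

/-- `R` is the inverse of `T + c`, and it is symmetric and positive. -/
structure IsShiftedInverse (T : H →ₗ.[ℂ] H) (c : ℝ) (R : H →L[ℂ] H) : Prop where
  right_inv : ∀ y : H, ∃ hy : R y ∈ T.domain, T ⟨R y, hy⟩ + (c : ℂ) • R y = y
  left_inv : ∀ x : T.domain, R (T x + (c : ℂ) • (x : H)) = x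
  selfAdjoint : IsSelfAdjoint R
  nonneg : ∀ f, 0 ≤ (⟪f, R f⟫_ℂ).re

namespace IsShiftedInverse

variable {T : H →ₗ.[ℂ] H} {c : ℝ} {R : H →L[ℂ] H}

theorem symm (h : IsShiftedInverse T c R) (f g : H) : ⟪R f, g⟫_ℂ = ⟪f, R g⟫_ℂ :=
  h.selfAdjoint.isSymmetric f g

theorem eq_zero (h : IsShiftedInverse T c R) {f : H} (hf : R f = 0) : f = 0 := by
  obtain ⟨hy, e⟩ := h.right_inv f
  have : (⟨R f, hy⟩ : T.domain) = 0 := Subtype.ext hf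
  rw [this, hf] at e
  simpa using e.symm

/-- Spectral mapping under `t ↦ (t + c)⁻¹`; it makes the theory of bounded symmetric operators
available for the eigenspaces of `T`. -/
theorem eigenspace_eq (h : IsShiftedInverse T c R) {t : ℝ} (ht : t + c ≠ 0) :
    unboundedEigenspace T t = End.eigenspace (R : H →ₗ[ℂ] H) (((t + c)⁻¹ : ℝ) : ℂ) := by
  have htc : ((t : ℂ) + c) ≠ 0 := by exact_mod_cast ht
  ext x
  simp only [unboundedEigenspace, Submodule.mem_map, LinearMap.mem_ker, End.mem_eigenspace_iff]
  constructor
  · rintro ⟨y, hy, rfl⟩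
    have h1 : T y = (t : ℂ) • (y : H) := by
      have : T y - (t : ℂ) • (y : H) = 0 := hy
      exact sub_eq_zero.1 this
    have h2 := h.left_inv y
    rw [h1, ← add_smul, map_smul] at h2
    change R (y : H) = _ • (y : H)
    conv_rhs => rw [← h2]
    rw [smul_smul]
    push_cast
    rw [inv_mul_cancel₀ htc, one_smul]
  · intro hx
    change R x = _ at hx
    obtain ⟨hy, e⟩ := h.right_inv x
    have hx' : x = ((t : ℂ) + c) • R x := by
      rw [hx, smul_smul]; push_cast; rw [mul_inv_cancel₀ htc, one_smul]
    have hmem : x ∈ T.domain := by rw [hx']; exact T.domain.smul_mem _ hy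
    refine ⟨⟨x, hmem⟩, ?_, rfl⟩
    have h3 : (⟨x, hmem⟩ : T.domain) = ((t : ℂ) + c) • (⟨R x, hy⟩ : T.domain) :=
      Subtype.ext hx'
    change T ⟨x, hmem⟩ - (t : ℂ) • x = 0
    have h4 : T ⟨R x, hy⟩ = x - (c : ℂ) • R x := eq_sub_of_add_eq e
    rw [h3, T.map_smul, h4, smul_sub, smul_smul, mul_comm _ (c : ℂ), ← smul_smul, ← hx',
      add_smul]
    abel

theorem mem_eigenspace (h : IsShiftedInverse T c R) {t : ℝ} (ht : t + c ≠ 0) (x : H) :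
    x ∈ unboundedEigenspace T t ↔ R x = (((t + c)⁻¹ : ℝ) : ℂ) • x := by
  rw [h.eigenspace_eq ht, End.mem_eigenspace_iff]; rfl

/-- On the domain, `T - t = (1 - (t + c) R)(T + c)`, so the resolvent at `t` is `R (1 - (t + c)
R)⁻¹`. -/
theorem mem_resolventSet (h : IsShiftedInverse T c R) {t : ℝ}
    (hu : IsUnit (1 - ((t + c : ℝ) : ℂ) • R)) : (t : ℂ) ∈ unboundedResolventSet T := by
  obtain ⟨U, hU⟩ := hu
  have e1 : ∀ y, (↑U⁻¹ : H →L[ℂ] H) y - ((t + c : ℝ) : ℂ) • R ((↑U⁻¹ : H →L[ℂ] H) y) = y := by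
    intro y
    have := congrArg (fun B : H →L[ℂ] H => B y) U.mul_inv
    rw [hU] at this
    simpa using this
  have e2 : ∀ y, (↑U⁻¹ : H →L[ℂ] H) (y - ((t + c : ℝ) : ℂ) • R y) = y := by
    intro y
    have := congrArg (fun B : H →L[ℂ] H => B y) U.inv_mul
    rw [hU] at this
    simpa using this
  refine ⟨R ∘L (↑U⁻¹ : H →L[ℂ] H), fun y => ?_, fun x => ?_⟩
  · obtain ⟨hy, e⟩ := h.right_inv ((↑U⁻¹ : H →L[ℂ] H) y)
    refine ⟨hy, ?_⟩
    change T ⟨R ((↑U⁻¹ : H →L[ℂ] H) y), hy⟩ - _ • R ((↑U⁻¹ : H →L[ℂ] H) y) = y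
    conv_rhs => rw [← e1 y]
    rw [eq_sub_of_add_eq e]
    push_cast
    rw [add_smul]; abel
  · have e3 := h.left_inv x
    have e4 : T x - (t : ℂ) • (x : H) = (T x + (c : ℂ) • (x : H)) -
        ((t + c : ℝ) : ℂ) • R (T x + (c : ℂ) • (x : H)) := by
      rw [e3]; push_cast; rw [add_smul]; abel
    change R ((↑U⁻¹ : H →L[ℂ] H) _) = _
    rw [e4, e2, e3]

omit [CompleteSpace H] in
theorem mem_spectrum_of_eigenspace (t : ℝ) (hE : unboundedEigenspace T t ≠ ⊥) :
    (t : ℂ) ∈ unboundedSpectrum T := by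
  rintro ⟨S, -, hS⟩
  apply hE
  rw [Submodule.eq_bot_iff]
  rintro x ⟨y, hy, rfl⟩
  have := hS y
  have h1 : T y - (t : ℂ) • (y : H) = 0 := hy
  rw [h1, map_zero] at this
  exact this.symm

theorem isSelfAdjoint_one_sub (h : IsShiftedInverse T c R) (s : ℝ) :
    IsSelfAdjoint (1 - (s : ℂ) • R) := by
  refine IsSelfAdjoint.sub (IsSelfAdjoint.one _) (IsSelfAdjoint.smul ?_ h.selfAdjoint)
  rw [isSelfAdjoint_iff]; exact Complex.conj_ofReal s

omit [CompleteSpace H] in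
theorem norm_le_of_mul_sq_le {f : H} {s : ℝ} (hs : 0 < s)
    (hf : s * ‖R f‖ ^ 2 ≤ (⟪f, R f⟫_ℂ).re) : ‖R f‖ ≤ s⁻¹ * ‖f‖ := by
  have h1 : (⟪f, R f⟫_ℂ).re ≤ ‖f‖ * ‖R f‖ :=
    (Complex.re_le_norm _).trans (norm_inner_le_norm _ _)
  rcases (norm_nonneg (R f)).eq_or_lt with h0 | h0
  · rw [← h0]; positivity
  · have h2 : s * ‖R f‖ ≤ ‖f‖ := by nlinarith
    rw [le_inv_mul_iff₀ hs]; exact h2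

/-- Above the essential norm, spectrum consists of eigenvalues. -/
theorem lt_and_eigenspace_ne_bot (h : IsShiftedInverse T c R) {F : Type*} [AddCommGroup F]
    [Module ℂ F] [FiniteDimensional ℂ F] (L : H →ₗ[ℂ] F) {b t : ℝ} (hb : 0 < b + c) (htb : t < b)
    (hL : ∀ f, L f = 0 → (b + c) * ‖R f‖ ^ 2 ≤ (⟪f, R f⟫_ℂ).re)
    (ht : (t : ℂ) ∈ unboundedSpectrum T) : 0 < t + c ∧ unboundedEigenspace T t ≠ ⊥ := by
  -- For `t + c ≤ 0` positivity of `R` gives `1 - (t + c) R ≥ 1`, which is coercive and hence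
  -- invertible.
  have hpos : 0 < t + c := by
    by_contra hneg
    push Not at hneg
    refine ht (h.mem_resolventSet ?_)
    refine ContinuousLinearMap.isUnit_of_forall_le_norm_inner_map _ (c := 1) one_pos fun x => ?_
    have h1 : (⟪(1 - ((t + c : ℝ) : ℂ) • R) x, x⟫_ℂ).re
        = ‖x‖ ^ 2 - (t + c) * (⟪x, R x⟫_ℂ).re := by
      rw [sub_apply, smul_apply, inner_sub_left,
        inner_smul_left, h.symm, Complex.sub_re, Complex.conj_ofReal, Complex.re_ofReal_mul]
      congr 1
      rw [one_apply_eq_self]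
      exact inner_self_eq_norm_sq (𝕜 := ℂ) x
    have h2 := h.nonneg x
    have h3 := Complex.re_le_norm (⟪(1 - ((t + c : ℝ) : ℂ) • R) x, x⟫_ℂ)
    rw [NNReal.coe_one, mul_one]
    nlinarith
  refine ⟨hpos, fun hE => ht (h.mem_resolventSet ?_)⟩
  have hinj : ∀ f, (1 - ((t + c : ℝ) : ℂ) • R) f = 0 → f = 0 := by
    intro f hf
    have hf' : f = ((t + c : ℝ) : ℂ) • R f := by
      simpa [sub_eq_zero] using hf
    have : f ∈ End.eigenspace (R : H →ₗ[ℂ] H) (((t + c)⁻¹ : ℝ) : ℂ) := by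
      rw [End.mem_eigenspace_iff]
      change R f = _ • f
      conv_rhs => rw [hf']
      rw [smul_smul, ← Complex.ofReal_mul, inv_mul_cancel₀ hpos.ne', Complex.ofReal_one, one_smul]
    rw [← h.eigenspace_eq hpos.ne', hE] at this
    simpa using this
  -- On the kernel of `L` one has `‖R f‖ ≤ ‖f‖ / (b + c)`, so `1 - (t + c) R` is bounded below there
  -- by this margin. Its positivity is where `t < b` must be strict.
  have hε : 0 < 1 - (t + c) * (b + c)⁻¹ := by
    rw [sub_pos, mul_inv_lt_iff₀ hb]; linarith
  refine (h.isSelfAdjoint_one_sub (t + c)).isUnit_of_le_norm_on_ker hinj L hε fun f hf => ?_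
  have h1 := norm_le_of_mul_sq_le hb (hL f hf)
  have h2 : ‖f‖ - ‖((t + c : ℝ) : ℂ) • R f‖ ≤ ‖(1 - ((t + c : ℝ) : ℂ) • R) f‖ := by
    simpa using norm_sub_norm_le f (((t + c : ℝ) : ℂ) • R f)
  rw [norm_smul, Complex.norm_real, Real.norm_of_nonneg hpos.le] at h2
  have h3 : (t + c) * ‖R f‖ ≤ (t + c) * ((b + c)⁻¹ * ‖f‖) := by gcongr
  linarith

variable (R c) in
/-- The strict form inequality on the kernel of `L` at energy `a`. -/
def FormGT {F : Type*} [AddCommGroup F] [Module ℂ F] (L : H →ₗ[ℂ] F) (a : ℝ) : Prop :=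
  ∀ f, L f = 0 → f ≠ 0 → (a + c) * ‖R f‖ ^ 2 < (⟪f, R f⟫_ℂ).re

/-- Eigenvectors of energy at most `a` span a space on which the form of `T - a` is nonpositive: if
`f` is the sum of the `x t`, orthogonality gives `⟪f, R f⟫ = ∑ (t + c) ‖R (x t)‖² ≤ (a + c) ‖R f‖²`.
Such a space meets the kernel of `L` only in zero. -/
theorem injective_sum_eigenspaces (h : IsShiftedInverse T c R) {F : Type*} [AddCommGroup F]
    [Module ℂ F] (L : H →ₗ[ℂ] F) {a : ℝ} (hL : FormGT c R L a) (Q : Finset ℝ)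
    (hQ : ∀ t ∈ Q, 0 < t + c ∧ t ≤ a) :
    Function.Injective (L ∘ₗ LinearMap.lsum ℂ (fun t : Q => unboundedEigenspace T (t : ℝ)) ℕ
      (fun t => (unboundedEigenspace T (t : ℝ)).subtype)) := by
  have hfam : OrthogonalFamily ℂ (fun t : Q => unboundedEigenspace T (t : ℝ))
      (fun t => (unboundedEigenspace T (t : ℝ)).subtypeₗᵢ) := by
    intro s t hst x y
    have hx := x.2
    have hy := y.2
    rw [h.mem_eigenspace (hQ s s.2).1.ne'] at hx
    rw [h.mem_eigenspace (hQ t t.2).1.ne'] at hy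
    have hne : ((((s : ℝ) + c)⁻¹ : ℝ) : ℂ) ≠ ((((t : ℝ) + c)⁻¹ : ℝ) : ℂ) := by
      intro he
      apply hst
      have := inv_injective (Complex.ofReal_injective he)
      exact Subtype.ext (by linarith)
    exact h.selfAdjoint.isSymmetric.orthogonalFamily_eigenspaces hne
      ⟨x, End.mem_eigenspace_iff.2 hx⟩ ⟨y, End.mem_eigenspace_iff.2 hy⟩
  rw [injective_iff_map_eq_zero]
  intro x hx
  set f : H := ∑ t : Q, (x t : H) with hf
  have hLf : L f = 0 := by
    simpa [LinearMap.lsum_apply, hf] using hx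
  have hRx : ∀ t : Q, R (x t : H) = ((((t : ℝ) + c)⁻¹ : ℝ) : ℂ) • (x t : H) := by
    intro t
    exact (h.mem_eigenspace (hQ t t.2).1.ne' _).1 (x t).2
  let y : ∀ t : Q, unboundedEigenspace T ((t : ℝ) : ℂ) :=
    fun t => ((((t : ℝ) + c)⁻¹ : ℝ) : ℂ) • x t
  have hRf : R f = ∑ t : Q, (y t : H) := by
    rw [hf, map_sum]
    exact Finset.sum_congr rfl fun t _ => hRx t
  have h1 : ⟪f, R f⟫_ℂ = ∑ t : Q, ⟪x t, y t⟫_ℂ := by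
    rw [hRf]; exact hfam.inner_sum x y Finset.univ
  have h2 : ‖R f‖ ^ 2 = ∑ t : Q, ‖y t‖ ^ 2 := by
    rw [hRf]; exact hfam.norm_sum y Finset.univ
  have h3 : ‖f‖ ^ 2 = ∑ t : Q, ‖x t‖ ^ 2 := hfam.norm_sum x Finset.univ
  have h4 : (⟪f, R f⟫_ℂ).re ≤ (a + c) * ‖R f‖ ^ 2 := by
    rw [h1, h2, Complex.re_sum, Finset.mul_sum]
    refine Finset.sum_le_sum fun t _ => ?_
    obtain ⟨p1, p2⟩ := hQ t t.2
    have e1 : (⟪x t, y t⟫_ℂ).re = ((t : ℝ) + c)⁻¹ * ‖x t‖ ^ 2 := by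
      simp only [y]
      rw [inner_smul_right, Complex.re_ofReal_mul]
      congr 1
      exact inner_self_eq_norm_sq (𝕜 := ℂ) (x t)
    have e2 : ‖y t‖ = ((t : ℝ) + c)⁻¹ * ‖x t‖ := by
      simp only [y]
      rw [norm_smul, Complex.norm_real, Real.norm_of_nonneg (by positivity)]
    rw [e1, e2]
    have e3 : ((t : ℝ) + c)⁻¹ * ‖x t‖ ^ 2
        = ((t : ℝ) + c) * (((t : ℝ) + c)⁻¹ * ‖x t‖) ^ 2 := by
      field_simp
    rw [e3]; gcongr
  have hf0 : f = 0 := by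
    by_contra h0
    exact absurd (hL f hLf h0) (not_lt.2 h4)
  rw [hf0, norm_zero] at h3
  funext t
  have : ∀ t ∈ Finset.univ, ‖x t‖ ^ 2 = 0 :=
    (Finset.sum_eq_zero_iff_of_nonneg fun t _ => by positivity).1 (by simpa using h3.symm)
  simpa using this t (Finset.mem_univ t)

theorem finiteDimensional_eigenspace (h : IsShiftedInverse T c R) {F : Type*} [AddCommGroup F]
    [Module ℂ F] [FiniteDimensional ℂ F] (L : H →ₗ[ℂ] F) {a t : ℝ} (hL : FormGT c R L a)
    (ht : 0 < t + c) (hta : t ≤ a) : FiniteDimensional ℂ (unboundedEigenspace T (t : ℂ)) := by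
  refine FiniteDimensional.of_injective (L ∘ₗ (unboundedEigenspace T (t : ℂ)).subtype) ?_
  rw [injective_iff_map_eq_zero]
  intro x hx
  by_contra h0
  have h1 := hL x hx (by simpa using h0)
  have h2 := (h.mem_eigenspace ht.ne' _).1 x.2
  rw [h2, inner_smul_right, Complex.re_ofReal_mul, norm_smul, Complex.norm_real,
    Real.norm_of_nonneg (by positivity),
    show (⟪(x : H), (x : H)⟫_ℂ).re = ‖(x : H)‖ ^ 2 from inner_self_eq_norm_sq (𝕜 := ℂ) _] at h1
  have e3 : (t + c)⁻¹ * ‖(x : H)‖ ^ 2 = (t + c) * ((t + c)⁻¹ * ‖(x : H)‖) ^ 2 := by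
    field_simp
  rw [e3] at h1
  have : (t + c) * ((t + c)⁻¹ * ‖(x : H)‖) ^ 2 ≤ (a + c) * ((t + c)⁻¹ * ‖(x : H)‖) ^ 2 := by
    gcongr
  linarith

theorem sum_finrank_le (h : IsShiftedInverse T c R) {F : Type*} [AddCommGroup F]
    [Module ℂ F] [FiniteDimensional ℂ F] (L : H →ₗ[ℂ] F) {a : ℝ} (hL : FormGT c R L a)
    (Q : Finset ℝ) (hQ : ∀ t ∈ Q, 0 < t + c ∧ t ≤ a) :
    ∑ t ∈ Q, finrank ℂ (unboundedEigenspace T (t : ℂ)) ≤ finrank ℂ F := by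
  have hinj := h.injective_sum_eigenspaces L hL Q hQ
  have : ∀ t : Q, FiniteDimensional ℂ (unboundedEigenspace T ((t : ℝ) : ℂ)) := fun t =>
    h.finiteDimensional_eigenspace L hL (hQ t t.2).1 (hQ t t.2).2
  have := LinearMap.finrank_le_finrank_of_injective hinj
  rw [finrank_pi_fintype] at this
  rwa [← Finset.sum_coe_sort]

section Counting

variable {F : Type*} [AddCommGroup F] [Module ℂ F] [FiniteDimensional ℂ F] {L : H →ₗ[ℂ] F}
  {a b : ℝ}

/-- The form inequality at some `b > a` says that `a` lies below the essential spectrum; this is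
what excludes spectrum other than eigenvalues. -/
theorem mem_spectrumBelow (h : IsShiftedInverse T c R) (hb : 0 < b + c) (hab : a < b)
    (hL : FormGT c R L b) {t : ℝ} :
    t ∈ spectrumBelow T a ↔ 0 < t + c ∧ t ≤ a ∧ unboundedEigenspace T t ≠ ⊥ := by
  constructor
  · rintro ⟨h1, h2⟩
    have := h.lt_and_eigenspace_ne_bot L hb (h2.trans_lt hab) (fun f hf => by
      by_cases h0 : f = 0
      · simp [h0]
      · exact (hL f hf h0).le) h1
    exact ⟨this.1, h2, this.2⟩
  · rintro ⟨-, h2, h3⟩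
    exact ⟨mem_spectrum_of_eigenspace t h3, h2⟩

theorem spectrumBelow_finite (h : IsShiftedInverse T c R) (hb : 0 < b + c) (hab : a < b)
    (hL : FormGT c R L b) : (spectrumBelow T a).Finite := by
  by_contra hinf
  obtain ⟨Q, hQ, hcard⟩ := Set.Infinite.exists_subset_card_eq hinf (finrank ℂ F + 1)
  have hQ' : ∀ t ∈ Q, 0 < t + c ∧ t ≤ b := fun t ht => by
    have := (h.mem_spectrumBelow hb hab hL).1 (hQ ht)
    exact ⟨this.1, this.2.1.trans hab.le⟩
  have h1 := h.sum_finrank_le L hL Q hQ'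
  have h2 : ∑ t ∈ Q, 1 ≤ ∑ t ∈ Q, finrank ℂ (unboundedEigenspace T (t : ℂ)) := by
    refine Finset.sum_le_sum fun t ht => ?_
    have := h.finiteDimensional_eigenspace L hL (hQ' t ht).1 (hQ' t ht).2
    exact Submodule.one_le_finrank_iff.2 ((h.mem_spectrumBelow hb hab hL).1 (hQ ht)).2.2
  simp only [Finset.sum_const, smul_eq_mul, mul_one] at h2
  omega

theorem countingFunction_eq (h : IsShiftedInverse T c R) (hb : 0 < b + c) (hab : a < b)
    (hL : FormGT c R L b) :
    countingFunction T a = ((∑ t ∈ (h.spectrumBelow_finite hb hab hL).toFinset,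
      finrank ℂ (unboundedEigenspace T (t : ℂ)) : ℕ) : ℕ∞) := by
  rw [countingFunction, dif_pos (h.spectrumBelow_finite hb hab hL)]
  push_cast
  refine Finset.sum_congr rfl fun t ht => ?_
  rw [Set.Finite.mem_toFinset] at ht
  have h1 := (h.mem_spectrumBelow hb hab hL).1 ht
  have := h.finiteDimensional_eigenspace L hL h1.1 (h1.2.1.trans hab.le)
  rw [eigenvalueMultiplicity, ← finrank_eq_rank]
  simp

theorem countingFunction_ne_top (h : IsShiftedInverse T c R) (hb : 0 < b + c) (hab : a < b)
    (hL : FormGT c R L b) : countingFunction T a ≠ ⊤ := by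
  rw [h.countingFunction_eq hb hab hL]; exact ENat.natCast_ne_top _

/-- The upper half of min-max. `L` at energy `b` only provides finiteness; the count itself comes
from `L'` at energy `a`, whose target may be much smaller. -/
theorem toNat_countingFunction_le (h : IsShiftedInverse T c R) (hb : 0 < b + c) (hab : a < b)
    (hL : FormGT c R L b) {G : Type*} [AddCommGroup G] [Module ℂ G] [FiniteDimensional ℂ G]
    (L' : H →ₗ[ℂ] G) (hL' : FormGT c R L' a) :
    (countingFunction T a).toNat ≤ finrank ℂ G := by
  rw [h.countingFunction_eq hb hab hL, ENat.toNat_natCast]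
  refine h.sum_finrank_le L' hL' _ fun t ht => ?_
  rw [Set.Finite.mem_toFinset] at ht
  have h1 := (h.mem_spectrumBelow hb hab hL).1 ht
  exact ⟨h1.1, h1.2.1⟩

/-- On the orthogonal complement of the eigenvectors of energy at most `a`, the norm of the
resolvent is at most `1 / (a + c)`. -/
theorem norm_apply_le_of_orthogonal (h : IsShiftedInverse T c R) (ha : 0 < a + c) (hab : a < b)
    (hL : FormGT c R L b) {f : H}
    (hf : ∀ t ∈ spectrumBelow T a, ∀ x ∈ unboundedEigenspace T (t : ℂ), ⟪x, f⟫_ℂ = 0) :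
    ‖R f‖ ≤ (a + c)⁻¹ * ‖f‖ := by
  have hb : 0 < b + c := by linarith
  set Q := (h.spectrumBelow_finite hb hab hL).toFinset with hQ
  have hQmem : ∀ t : Q, 0 < (t : ℝ) + c ∧ (t : ℝ) ≤ a ∧ unboundedEigenspace T (t : ℝ) ≠ ⊥ := by
    rintro ⟨t, ht⟩
    rw [hQ, Set.Finite.mem_toFinset] at ht
    exact (h.mem_spectrumBelow hb hab hL).1 ht
  have : ∀ t : Q, FiniteDimensional ℂ (unboundedEigenspace T ((t : ℝ) : ℂ)) := fun t =>
    h.finiteDimensional_eigenspace L hL (hQmem t).1 ((hQmem t).2.1.trans hab.le)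
  set W : Submodule ℂ H := ⨆ t : Q, unboundedEigenspace T ((t : ℝ) : ℂ) with hW
  have : FiniteDimensional ℂ W := Submodule.finiteDimensional_iSup _
  have hmemK : ∀ g, g ∈ Wᗮ ↔
      ∀ t : Q, ∀ x ∈ unboundedEigenspace T ((t : ℝ) : ℂ), ⟪x, g⟫_ℂ = 0 := by
    intro g
    rw [hW, ← Submodule.iInf_orthogonal]
    simp only [Submodule.mem_iInf, Submodule.mem_orthogonal]
  have hRK : ∀ g ∈ Wᗮ, R g ∈ Wᗮ := by
    intro g hg
    rw [hmemK] at hg ⊢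
    intro t x hx
    have hx' := hx
    rw [h.eigenspace_eq (hQmem t).1.ne', End.mem_eigenspace_iff] at hx'
    rw [← h.symm, show R x = _ from hx', inner_smul_left, hg t x hx, mul_zero]
  have hfK : f ∈ Wᗮ := by
    rw [hmemK]
    intro t x hx
    exact hf t ((Set.Finite.mem_toFinset _).1 t.2) x hx
  -- `P R P` is the part of `R` on `Wᗮ`, extended by zero. It remains self-adjoint, so it suffices
  -- to bound its norm through its spectrum.
  set P : H →L[ℂ] H := Wᗮ.starProjection with hP
  have hPsa : IsSelfAdjoint P := isSelfAdjoint_starProjection _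
  set A : H →L[ℂ] H := P * R * P with hA
  have hAsa : IsSelfAdjoint A := by
    have := h.selfAdjoint.conjugate P
    rwa [hPsa.star_eq] at this
  have hPmem : ∀ g, P g ∈ Wᗮ := fun g => Submodule.starProjection_apply_mem _ g
  have hPid : ∀ g ∈ Wᗮ, P g = g := fun g hg => Submodule.starProjection_eq_self_iff.2 hg
  have hAK : ∀ g ∈ Wᗮ, A g = R g := by
    intro g hg
    change P (R (P g)) = R g
    rw [hPid g hg, hPid _ (hRK g hg)]
  have hnorm : ‖A‖ ≤ (a + c)⁻¹ := by
    by_contra hlt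
    push Not at hlt
    have : Nontrivial (H →L[ℂ] H) := ⟨A, 0, fun h0 => by
      rw [h0, norm_zero] at hlt
      have : 0 < (a + c)⁻¹ := by positivity
      linarith⟩
    -- The norm of a self-adjoint operator is attained by a real spectral value `μ`. The
    -- contradiction will be that `μ - A` is invertible when `|μ| > (a + c)⁻¹`.
    obtain ⟨z, hz, hznorm⟩ := spectrum.exists_nnnorm_eq_spectralRadius A
    rw [hAsa.spectralRadius_eq_nnnorm] at hznorm
    have hzre : z = (z.re : ℂ) := hAsa.mem_spectrum_eq_re hz
    set μ := z.re with hμ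
    have hμnorm : |μ| = ‖A‖ := by
      have h1 : ‖z‖₊ = ‖A‖₊ := by exact_mod_cast hznorm
      have h2 : ‖z‖ = ‖A‖ := congrArg NNReal.toReal h1
      rw [hzre, Complex.norm_real] at h2
      exact h2
    have hμpos : (a + c)⁻¹ < |μ| := by rw [hμnorm]; exact hlt
    have hacpos : 0 < (a + c)⁻¹ := by positivity
    have hμ0 : μ ≠ 0 := by
      intro h0; rw [h0, abs_zero] at hμpos; linarith
    rw [spectrum.mem_iff, hzre] at hz
    apply hz
    have halg : algebraMap ℂ (H →L[ℂ] H) (μ : ℂ) = (μ : ℂ) • 1 := Algebra.algebraMap_eq_smul_one _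
    have happ : ∀ g, (algebraMap ℂ (H →L[ℂ] H) (μ : ℂ) - A) g = (μ : ℂ) • g - A g := by
      intro g; rw [halg]; simp
    have hsa : IsSelfAdjoint (algebraMap ℂ (H →L[ℂ] H) (μ : ℂ) - A) := by
      refine IsSelfAdjoint.sub ?_ hAsa
      rw [halg]
      exact IsSelfAdjoint.smul (by rw [isSelfAdjoint_iff]; exact Complex.conj_ofReal μ)
        (IsSelfAdjoint.one _)
    have hμc : (μ : ℂ) ≠ 0 := by exact_mod_cast hμ0
    have hρ : 0 < |μ| - (b + c)⁻¹ := by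
      have : (b + c)⁻¹ ≤ (a + c)⁻¹ := by gcongr
      linarith
    -- On the joint kernel `A` equals `R` and is bounded by `(b + c)⁻¹ < |μ|`. A null vector of `μ -
    -- A` would be an eigenvector of `T` of energy `μ⁻¹ - c ≤ a`, hence lie in both `W` and `Wᗮ`.
    refine hsa.isUnit_of_le_norm_on_ker ?_ (L.prod W.orthogonalProjectionOnto.toLinearMap) hρ ?_
    · intro g hg
      rw [happ, sub_eq_zero] at hg
      have hgK : g ∈ Wᗮ := by
        have : g = (μ : ℂ)⁻¹ • A g := by rw [← hg, smul_smul, inv_mul_cancel₀ hμc, one_smul]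
        rw [this]
        exact Submodule.smul_mem _ _ (hPmem _)
      rw [hAK g hgK] at hg
      by_contra hg0
      have hgn : 0 < ‖g‖ := norm_pos_iff.2 hg0
      have hμ1 : 0 ≤ μ := by
        have h1 := h.nonneg g
        rw [← hg, inner_smul_right, Complex.re_ofReal_mul] at h1
        have h2 : (⟪g, g⟫_ℂ).re = ‖g‖ ^ 2 := inner_self_eq_norm_sq (𝕜 := ℂ) g
        rw [h2] at h1
        by_contra hneg
        push Not at hneg
        nlinarith [sq_pos_of_pos hgn]
      rw [abs_of_nonneg hμ1] at hμpos
      have hμp : 0 < μ := lt_of_le_of_ne hμ1 (Ne.symm hμ0)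
      have htc : (μ⁻¹ - c) + c = μ⁻¹ := by ring
      have hta : μ⁻¹ - c ≤ a := by
        have : μ⁻¹ ≤ a + c := by
          rw [inv_le_comm₀ hμp ha]; exact hμpos.le
        linarith
      have hgE : g ∈ unboundedEigenspace T ((μ⁻¹ - c : ℝ) : ℂ) := by
        rw [h.eigenspace_eq (by rw [htc]; positivity), End.mem_eigenspace_iff, htc, inv_inv]
        exact hg.symm
      have hmem : (μ⁻¹ - c) ∈ spectrumBelow T a := by
        rw [h.mem_spectrumBelow hb hab hL, htc]
        refine ⟨by positivity, hta, fun hbot => ?_⟩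
        rw [hbot] at hgE
        exact hg0 (by simpa using hgE)
      have := (hmemK g).1 hgK ⟨μ⁻¹ - c, by rw [hQ, Set.Finite.mem_toFinset]; exact hmem⟩ g hgE
      exact hg0 (inner_self_eq_zero.1 this)
    · intro g hg
      obtain ⟨hg1, hg2⟩ : L g = 0 ∧ W.orthogonalProjectionOnto g = 0 := by
        simpa [Prod.ext_iff] using hg
      have hgK : g ∈ Wᗮ := by
        rwa [Submodule.orthogonalProjectionOnto_eq_zero_iff] at hg2
      rw [happ, hAK g hgK]
      have h1 : ‖R g‖ ≤ (b + c)⁻¹ * ‖g‖ := by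
        refine norm_le_of_mul_sq_le hb ?_
        by_cases h0 : g = 0
        · simp [h0]
        · exact (hL g hg1 h0).le
      have h2 := norm_sub_norm_le ((μ : ℂ) • g) (R g)
      rw [norm_smul, Complex.norm_real, Real.norm_eq_abs] at h2
      linarith
  calc ‖R f‖ = ‖A f‖ := by rw [hAK f hfK]
    _ ≤ ‖A‖ * ‖f‖ := A.le_opNorm f
    _ ≤ _ := by gcongr

/-- The lower half of min-max, by counting dimensions: with too few eigenvectors, some nonzero trial
vector would be orthogonal to all of them, and `norm_apply_le_of_orthogonal` contradicts the strict
inequality there. -/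
theorem card_le_toNat_countingFunction (h : IsShiftedInverse T c R) (ha : 0 < a + c) (hab : a < b)
    (hL : FormGT c R L b) {ι : Type*} [Fintype ι] (Φ : (ι → ℂ) →ₗ[ℂ] H)
    (hΦ : ∀ x, x ≠ 0 → ‖Φ x‖ ^ 2 < (a + c) * (⟪Φ x, R (Φ x)⟫_ℂ).re) :
    Fintype.card ι ≤ (countingFunction T a).toNat := by
  have hb : 0 < b + c := by linarith
  rw [h.countingFunction_eq hb hab hL, ENat.toNat_natCast]
  by_contra hlt
  push Not at hlt
  set Q := (h.spectrumBelow_finite hb hab hL).toFinset with hQ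
  have hQmem : ∀ t : Q, 0 < (t : ℝ) + c ∧ (t : ℝ) ≤ a ∧ unboundedEigenspace T (t : ℝ) ≠ ⊥ := by
    rintro ⟨t, ht⟩
    rw [hQ, Set.Finite.mem_toFinset] at ht
    exact (h.mem_spectrumBelow hb hab hL).1 ht
  have : ∀ t : Q, FiniteDimensional ℂ (unboundedEigenspace T ((t : ℝ) : ℂ)) := fun t =>
    h.finiteDimensional_eigenspace L hL (hQmem t).1 ((hQmem t).2.1.trans hab.le)
  let Ψ : (ι → ℂ) →ₗ[ℂ] (∀ t : Q, unboundedEigenspace T ((t : ℝ) : ℂ)) :=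
    LinearMap.pi fun t =>
      (unboundedEigenspace T ((t : ℝ) : ℂ)).orthogonalProjectionOnto.toLinearMap ∘ₗ Φ
  have hker : LinearMap.ker Ψ ≠ ⊥ := by
    apply LinearMap.ker_ne_bot_of_finrank_lt
    rw [finrank_pi_fintype, finrank_fintype_fun_eq_card]
    rwa [← Finset.sum_coe_sort] at hlt
  obtain ⟨x, hx, hx0⟩ := Submodule.exists_mem_ne_zero_of_ne_bot hker
  have horth : ∀ t ∈ spectrumBelow T a, ∀ y ∈ unboundedEigenspace T (t : ℂ),
      ⟪y, Φ x⟫_ℂ = 0 := by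
    intro t ht y hy
    have ht' : t ∈ Q := by rwa [hQ, Set.Finite.mem_toFinset]
    have : FiniteDimensional ℂ (unboundedEigenspace T (t : ℂ)) := this ⟨t, ht'⟩
    have h1 : (unboundedEigenspace T (t : ℂ)).orthogonalProjectionOnto (Φ x) = 0 :=
      congrFun hx (⟨t, ht'⟩ : Q)
    rw [Submodule.orthogonalProjectionOnto_eq_zero_iff] at h1
    exact h1 y hy
  have h1 := h.norm_apply_le_of_orthogonal ha hab hL horth
  have h2 : (⟪Φ x, R (Φ x)⟫_ℂ).re ≤ ‖Φ x‖ * ‖R (Φ x)‖ :=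
    (Complex.re_le_norm _).trans (norm_inner_le_norm _ _)
  have h3 : (a + c) * (⟪Φ x, R (Φ x)⟫_ℂ).re ≤ (a + c) * (‖Φ x‖ * ((a + c)⁻¹ * ‖Φ x‖)) := by
    gcongr
    exact h2.trans (by gcongr)
  have h4 : (a + c) * (‖Φ x‖ * ((a + c)⁻¹ * ‖Φ x‖)) = ‖Φ x‖ ^ 2 := by field_simp
  have h5 := hΦ x hx0
  linarith

end Counting

end IsShiftedInverse

end AbstractCounting

/-! ### Absolutely continuous functions and convolutions on the line -/

section LineCalculus

open scoped InnerProductSpace ComplexConjugate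
open Set

/-- Primitives of locally integrable functions are absolutely continuous. -/
theorem absolutelyContinuousOnInterval_primitive {φ : ℝ → ℂ} (hφ : LocallyIntegrable φ volume)
    {u : ℝ → ℂ} (hu : ∀ x y, u y - u x = ∫ t in x..y, φ t) (a b : ℝ) :
    AbsolutelyContinuousOnInterval u a b := by
  have hint : ∀ x y, IntervalIntegrable φ volume x y := fun x y =>
    (hφ.integrableOn_isCompact isCompact_uIcc).intervalIntegrable
  have hconst : ∀ z : ℂ, AbsolutelyContinuousOnInterval (fun _ : ℝ => z) a b := fun z =>
    (LipschitzWith.const z (α := ℝ)).lipschitzOnWith.absolutelyContinuousOnInterval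
  have hre : AbsolutelyContinuousOnInterval (fun x => ∫ t in a..x, (φ t).re) a b :=
    IntervalIntegrable.absolutelyContinuousOnInterval_intervalIntegral
      ⟨(hint a b).1.re, (hint a b).2.re⟩ (by simp)
  have him : AbsolutelyContinuousOnInterval (fun x => ∫ t in a..x, (φ t).im) a b :=
    IntervalIntegrable.absolutelyContinuousOnInterval_intervalIntegral
      ⟨(hint a b).1.im, (hint a b).2.im⟩ (by simp)
  have h1 := ((hconst (u a)).add (hre.smul (hconst 1))).add (him.smul (hconst Complex.I))
  refine Eq.mp (congrArg (fun v : ℝ → ℂ => AbsolutelyContinuousOnInterval v a b) ?_) h1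
  funext x
  have h2 : u x = u a + ∫ t in a..x, φ t := by rw [← hu]; ring
  have h3 : ∫ t in a..x, φ t = ((∫ t in a..x, (φ t).re : ℝ) : ℂ) +
      ((∫ t in a..x, (φ t).im : ℝ) : ℂ) * Complex.I := by
    rw [← intervalIntegral.integral_ofReal, ← intervalIntegral.integral_ofReal,
      ← intervalIntegral.integral_mul_const, ← intervalIntegral.integral_add]
    · simp only [Complex.re_add_im]
    · exact ⟨(hint a x).1.re.ofReal, (hint a x).2.re.ofReal⟩
    · exact IntervalIntegrable.mul_const
        (show IntervalIntegrable (fun t => ((φ t).im : ℂ)) volume a x from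
          ⟨(hint a x).1.im.ofReal, (hint a x).2.im.ofReal⟩) _
  rw [h2, h3]
  simp [add_assoc]

theorem continuous_of_primitive {φ : ℝ → ℂ} (hφ : LocallyIntegrable φ volume)
    {u : ℝ → ℂ} (hu : ∀ x y, u y - u x = ∫ t in x..y, φ t) : Continuous u := by
  have h1 : u = fun x => u 0 + ∫ t in (0 : ℝ)..x, φ t := by
    funext x; rw [← hu]; ring
  rw [h1]
  exact continuous_const.add (intervalIntegral.continuous_primitive (fun x y =>
    (hφ.integrableOn_isCompact isCompact_uIcc).intervalIntegrable) 0)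

/-- The product rule for primitives. -/
theorem primitive_mul {φ γ u w : ℝ → ℂ} (hφ : LocallyIntegrable φ volume)
    (hγ : LocallyIntegrable γ volume) (hu : ∀ x y, u y - u x = ∫ t in x..y, φ t)
    (hw : ∀ x y, w y - w x = ∫ t in x..y, γ t) (a b : ℝ) :
    u b * w b - u a * w a = ∫ t in a..b, (φ t * w t + u t * γ t) := by
  have hcu := continuous_of_primitive hφ hu
  have hcw := continuous_of_primitive hγ hw
  have hloc : LocallyIntegrable (fun t => φ t * w t + u t * γ t) volume := by
    refine LocallyIntegrable.add ?_ ?_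
    · have := hφ.smul_continuous (g := w) hcw
      simpa [smul_eq_mul] using this
    · exact hγ.continuous_mul hcu
  set G : ℝ → ℂ := fun x => ∫ t in a..x, (φ t * w t + u t * γ t) with hG
  have hGp : ∀ x y, G y - G x = ∫ t in x..y, (φ t * w t + u t * γ t) := fun x y =>
    intervalIntegral.integral_interval_sub_left
      (hloc.integrableOn_isCompact isCompact_uIcc).intervalIntegrable
      (hloc.integrableOn_isCompact isCompact_uIcc).intervalIntegrable
  -- `u w` minus the candidate primitive is absolutely continuous with derivative zero almost
  -- everywhere, hence constant.
  have hac : AbsolutelyContinuousOnInterval (u • w - G) a b :=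
    ((absolutelyContinuousOnInterval_primitive hφ hu a b).smul
      (absolutelyContinuousOnInterval_primitive hγ hw a b)).sub
      (absolutelyContinuousOnInterval_primitive hloc hGp a b)
  have hder : ∀ᵐ x, x ∈ uIcc a b → HasDerivAt (u • w - G) 0 x := by
    filter_upwards [_root_.LocallyIntegrable.ae_hasDerivAt_integral hφ, _root_.LocallyIntegrable.ae_hasDerivAt_integral hγ,
      _root_.LocallyIntegrable.ae_hasDerivAt_integral hloc] with x h1 h2 h3 _
    have e1 : HasDerivAt u (φ x) x := by
      have : u = fun x => u a + ∫ t in a..x, φ t := by funext x; rw [← hu]; ring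
      rw [this]; exact (h1 a).const_add _
    have e2 : HasDerivAt w (γ x) x := by
      have : w = fun x => w a + ∫ t in a..x, γ t := by funext x; rw [← hw]; ring
      rw [this]; exact (h2 a).const_add _
    have e3 := (e1.mul e2).sub (h3 a)
    rw [sub_self] at e3
    exact e3
  obtain ⟨C, hC⟩ := hac.const_of_ae_hasDerivAt_zero hder
  have ha := hC a left_mem_uIcc
  have hb := hC b right_mem_uIcc
  simp only [Pi.sub_apply, smul_eq_mul, Pi.mul_apply, hG, intervalIntegral.integral_same] at ha hb
  rw [sub_zero] at ha
  rw [ha, ← hb]; ring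

/-- An integrable function with an integrable derivative has derivative of integral zero. -/
theorem integral_eq_zero_of_primitive {p q : ℝ → ℂ} (hp : Integrable p volume)
    (hq : Integrable q volume) (hpq : ∀ a b, p b - p a = ∫ t in a..b, q t) :
    ∫ t, q t = 0 := by
  have htop : Tendsto (fun x => ∫ t in (0 : ℝ)..x, q t) atTop (𝓝 (∫ t in Ioi (0 : ℝ), q t)) :=
    intervalIntegral_tendsto_integral_Ioi 0 hq.integrableOn tendsto_id
  have hbot : Tendsto (fun x => ∫ t in x..(0 : ℝ), q t) atBot (𝓝 (∫ t in Iic (0 : ℝ), q t)) :=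
    intervalIntegral_tendsto_integral_Iic 0 hq.integrableOn tendsto_id
  -- Integrability of `q` makes `p` converge at both ends, and integrability of `p` forces both
  -- limits to vanish.
  have h1 : Tendsto p atTop (𝓝 (p 0 + ∫ t in Ioi (0 : ℝ), q t)) := by
    refine (htop.const_add (p 0)).congr fun x => ?_
    rw [← hpq]; ring
  have h2 : Tendsto p atBot (𝓝 (p 0 - ∫ t in Iic (0 : ℝ), q t)) := by
    refine (hbot.const_sub (p 0)).congr fun x => ?_
    rw [← hpq]; ring
  have z1 := IntegrableAtFilter.eq_zero_of_tendsto (hp.integrableAtFilter atTop) (fun s hs => by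
    obtain ⟨b, hb⟩ := mem_atTop_sets.1 hs
    exact top_unique (by rw [← Real.volume_Ici (a := b)]; exact measure_mono hb)) h1
  have z2 := IntegrableAtFilter.eq_zero_of_tendsto (hp.integrableAtFilter atBot) (fun s hs => by
    obtain ⟨b, hb⟩ := mem_atBot_sets.1 hs
    exact top_unique (by rw [← Real.volume_Iic (a := b)]; exact measure_mono hb)) h2
  have h3 := intervalIntegral.integral_Iic_add_Ioi (b := (0 : ℝ)) hq.integrableOn hq.integrableOn
  rw [← h3]
  linear_combination z1 - z2

theorem L2Line.locallyIntegrable (g : L2Line) : LocallyIntegrable (g : ℝ → ℂ) volume :=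
  (Lp.memLp g).locallyIntegrable (by norm_num)

/-- `ψ ∈ H¹(ℝ)` with derivative `η ∈ L²(ℝ)`. -/
def IsWeakDeriv (ψ η : L2Line) : Prop :=
  ∃ u : ℝ → ℂ, (ψ : ℝ → ℂ) =ᵐ[volume] u ∧ ∀ a b : ℝ, u b - u a = ∫ t in a..b, (η : ℝ → ℂ) t

theorem L2Line.integrable_mul {p q : ℝ → ℂ} (hp : MemLp p 2 volume) (hq : MemLp q 2 volume) :
    Integrable (fun t => p t * q t) volume := by
  have := MemLp.integrable_mul hp hq
  exact this

/-- Integration by parts on the line. -/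
theorem IsWeakDeriv.inner_add_inner {ψ η φ θ : L2Line} (h₁ : IsWeakDeriv ψ η)
    (h₂ : IsWeakDeriv φ θ) : ⟪ψ, θ⟫_ℂ + ⟪η, φ⟫_ℂ = 0 := by
  obtain ⟨u, eu, iu⟩ := h₁
  obtain ⟨w, ew, iw⟩ := h₂
  have hcl : LocallyIntegrable (fun t => conj ((η : ℝ → ℂ) t)) volume :=
    ((Lp.memLp η).star).locallyIntegrable (by norm_num)
  have hcu : ∀ x y, conj (u y) - conj (u x) = ∫ t in x..y, conj ((η : ℝ → ℂ) t) := by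
    intro x y
    rw [← map_sub, iu, intervalIntegral.intervalIntegral_eq_integral_uIoc,
      intervalIntegral.intervalIntegral_eq_integral_uIoc, integral_conj]
    split_ifs <;> simp
  have hprod := primitive_mul hcl (L2Line.locallyIntegrable θ) hcu iw
  have mψ : MemLp (fun t => conj (u t)) 2 volume := ((memLp_congr_ae eu).1 (Lp.memLp ψ)).star
  have mφ : MemLp w 2 volume := (memLp_congr_ae ew).1 (Lp.memLp φ)
  have mη : MemLp (fun t => conj ((η : ℝ → ℂ) t)) 2 volume := (Lp.memLp η).star
  have i1 := L2Line.integrable_mul mη mφ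
  have i2 := L2Line.integrable_mul mψ (Lp.memLp θ)
  have hz := integral_eq_zero_of_primitive (L2Line.integrable_mul mψ mφ) (i1.add i2) hprod
  have e1 : ⟪ψ, θ⟫_ℂ = ∫ t, conj (u t) * (θ : ℝ → ℂ) t := by
    rw [L2.inner_def]
    refine integral_congr_ae ?_
    filter_upwards [eu] with t ht
    rw [ht, RCLike.inner_apply, mul_comm]
  have e2 : ⟪η, φ⟫_ℂ = ∫ t, conj ((η : ℝ → ℂ) t) * w t := by
    rw [L2.inner_def]
    refine integral_congr_ae ?_
    filter_upwards [ew] with t ht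
    rw [ht, RCLike.inner_apply, mul_comm]
  rw [e1, e2, add_comm, ← integral_add i1 i2]
  exact hz

/-- Convolution of a square integrable function with an integrable kernel is square integrable. -/
theorem memLp_two_integral_kernel {k : ℝ → ℝ} (hk : Integrable k volume) (hk2 : MemLp k 2 volume)
    (hk0 : ∀ s, 0 ≤ k s) {f : ℝ → ℂ} (hf : MemLp f 2 volume) :
    MemLp (fun x => ∫ y, (k (x - y) : ℂ) * f y) 2 volume := by
  have hmeas : AEStronglyMeasurable (fun x => ∫ y, (k (x - y) : ℂ) * f y) volume := by
    have h1 := AEStronglyMeasurable.convolution_integrand (μ := (volume : Measure ℝ))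
      (ν := (volume : Measure ℝ)) (ContinuousLinearMap.lsmul ℝ ℝ (E := ℂ)).flip
      hf.aestronglyMeasurable hk.aestronglyMeasurable
    have h2 := h1.integral_prod_right'
    simpa using h2
  rw [memLp_two_iff_integrable_sq_norm hmeas]
  have hsq : Integrable (fun x => ‖f x‖ ^ 2) volume :=
    (memLp_two_iff_integrable_sq_norm hf.aestronglyMeasurable).1 hf
  have hconv := hsq.ae_convolution_exists (μ := volume) (ContinuousLinearMap.mul ℝ ℝ) hk
  have hconvI := hsq.integrable_convolution (μ := volume) (ContinuousLinearMap.mul ℝ ℝ) hk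
  set K := ∫ s, k s with hK
  refine (hconvI.const_mul K).mono' (by fun_prop) ?_
  filter_upwards [hconv] with x hx
  have hJ : Integrable (fun y => ‖f y‖ ^ 2 * k (x - y)) volume := hx
  have hkx : Integrable (fun y => k (x - y)) volume := hk.comp_sub_left x
  have hkx2 : MemLp (fun y => k (x - y)) 2 volume :=
    hk2.comp_measurePreserving (Measure.measurePreserving_sub_left volume x)
  have hI : Integrable (fun y => k (x - y) * ‖f y‖) volume :=
    MemLp.integrable_mul hkx2 hf.norm
  have hKx : ∫ y, k (x - y) = K := integral_sub_left_eq_self k volume x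
  rw [convolution_def]
  simp only [ContinuousLinearMap.mul_apply']
  set J := ∫ y, ‖f y‖ ^ 2 * k (x - y) with hJdef
  set I := ∫ y, k (x - y) * ‖f y‖ with hIdef
  have hbound : ‖∫ y, (k (x - y) : ℂ) * f y‖ ≤ I := by
    refine (norm_integral_le_integral_norm _).trans (le_of_eq ?_)
    refine integral_congr_ae (Eventually.of_forall fun y => ?_)
    simp [abs_of_nonneg (hk0 _)]
  have hI0 : 0 ≤ I := integral_nonneg fun y => mul_nonneg (hk0 _) (norm_nonneg _)
  -- Cauchy–Schwarz for the weight `k (x - y)`, in discriminant form; `I² ≤ K J` is the pointwise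
  -- bound that gives the `L²` estimate.
  have hquad : ∀ l : ℝ, 0 ≤ J - 2 * l * I + l ^ 2 * K := by
    intro l
    have h1 : 0 ≤ ∫ y, k (x - y) * (‖f y‖ - l) ^ 2 :=
      integral_nonneg fun y => mul_nonneg (hk0 _) (sq_nonneg _)
    have h2 : ∫ y, k (x - y) * (‖f y‖ - l) ^ 2 = J - 2 * l * I + l ^ 2 * K := by
      rw [← hKx, hJdef, hIdef, ← integral_const_mul, ← integral_const_mul,
        ← integral_sub hJ (hI.const_mul _), ← integral_add
          (f := fun y => ‖f y‖ ^ 2 * k (x - y) - 2 * l * (k (x - y) * ‖f y‖))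
          (hJ.sub (hI.const_mul _)) (hkx.const_mul _)]
      refine integral_congr_ae (Eventually.of_forall fun y => ?_)
      simp only
      ring
    rwa [h2] at h1
  have hCS : I ^ 2 ≤ K * J := by
    have hK0 : 0 ≤ K := integral_nonneg hk0
    rcases hK0.eq_or_lt with h0 | h0
    · have hJ0 : 0 ≤ J := integral_nonneg fun y => mul_nonneg (sq_nonneg _) (hk0 _)
      have h3 := hquad (J + 1)
      rw [← h0] at h3 ⊢
      -- For `K = 0` the quadratic is affine in `l`, and this `l` gives it the value `-1` unless `I
      -- = 0`.
      have h4 := hquad ((J + 1) / (2 * I))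
      rw [← h0] at h4
      rcases hI0.eq_or_lt with h5 | h5
      · rw [← h5]; simp
      · have : 2 * ((J + 1) / (2 * I)) * I = J + 1 := by field_simp
        linarith
    · have h3 := hquad (I / K)
      have : J - 2 * (I / K) * I + (I / K) ^ 2 * K = J - I ^ 2 / K := by field_simp; ring
      rw [this, sub_nonneg, div_le_iff₀ h0] at h3
      linarith
  rw [Real.norm_of_nonneg (by positivity)]
  calc _ ≤ I ^ 2 := by gcongr
    _ ≤ K * J := hCS

end LineCalculus

/-! ### Solving `-ψ'' + κ² ψ = f` and regularity of the solution -/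

section Resolvent

open scoped InnerProductSpace ComplexConjugate
open Set

/-- The square integrable solution of `p' + κ p = f`. -/
theorem exists_memLp_deriv_add {κ : ℝ} (hκ : 0 < κ) {f : ℝ → ℂ} (hf : MemLp f 2 volume) :
    ∃ p : ℝ → ℂ, MemLp p 2 volume ∧ ∀ a b, p b - p a = ∫ t in a..b, (f t - κ * p t) := by
  -- The causal Green function of `∂ + κ`; the solution is its convolution with `f`.
  set k : ℝ → ℝ := (Ici (0 : ℝ)).indicator fun s => Real.exp (-κ * s) with hk
  have hexp : ∀ κ' : ℝ, 0 < κ' →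
      Integrable ((Ici (0 : ℝ)).indicator fun s => Real.exp (-κ' * s)) volume := by
    intro κ' hκ'
    rw [integrable_indicator_iff measurableSet_Ici, integrableOn_Ici_iff_integrableOn_Ioi]
    exact exp_neg_integrableOn_Ioi 0 hκ'
  have hk1 : Integrable k volume := hexp κ hκ
  have hk0 : ∀ s, 0 ≤ k s := fun s => indicator_nonneg (fun _ _ => (Real.exp_pos _).le) s
  have hk2 : MemLp k 2 volume := by
    rw [memLp_two_iff_integrable_sq hk1.aestronglyMeasurable]
    refine (hexp (2 * κ) (by positivity)).congr (Eventually.of_forall fun s => ?_)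
    simp only [hk, indicator_apply]
    split_ifs
    · rw [sq, ← Real.exp_add]; ring_nf
    · simp
  set p : ℝ → ℂ := fun x => ∫ y, (k (x - y) : ℂ) * f y with hp
  have hpint : ∀ x, Integrable (fun y => (k (x - y) : ℂ) * f y) volume := fun x =>
    L2Line.integrable_mul
      ((hk2.comp_measurePreserving (Measure.measurePreserving_sub_left volume x)).ofReal) hf
  have hkey : ∀ x, (fun y => (k (x - y) : ℂ) * f y) =
      (Iic x).indicator fun y => Complex.exp (-κ * x) * (Complex.exp (κ * y) * f y) := by
    intro x
    funext y
    simp only [hk, indicator_apply, mem_Ici, sub_nonneg, mem_Iic]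
    split_ifs
    · rw [← mul_assoc, ← Complex.exp_add, Complex.ofReal_exp]
      congr 2; push_cast; ring
    · simp
  have hG : ∀ x, IntegrableOn (fun y : ℝ => Complex.exp (κ * y) * f y) (Iic x) volume := by
    intro x
    have h1 := hpint x
    rw [hkey, integrable_indicator_iff measurableSet_Iic] at h1
    refine (h1.const_mul (Complex.exp (κ * x))).congr (Eventually.of_forall fun y => ?_)
    simp only
    rw [← mul_assoc, ← Complex.exp_add]; simp
  set G : ℝ → ℂ := fun x => ∫ y in Iic x, Complex.exp (κ * y) * f y with hGdef
  have hpG : p = fun x : ℝ => Complex.exp (-κ * x) * G x := by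
    funext x
    simp only [hp, hGdef]
    rw [hkey, integral_indicator measurableSet_Iic, integral_const_mul]
  have hfloc : LocallyIntegrable f volume := hf.locallyIntegrable (by norm_num)
  have hloc : LocallyIntegrable (fun y : ℝ => Complex.exp (κ * y) * f y) volume :=
    hfloc.continuous_mul (by fun_prop)
  have hGp : ∀ a b, G b - G a = ∫ t in a..b, Complex.exp (κ * t) * f t := fun a b =>
    intervalIntegral.integral_Iic_sub_Iic (hG a) (hG b)
  have hE : ∀ a b : ℝ, Complex.exp (-κ * b) - Complex.exp (-κ * a) =
      ∫ t in a..b, -κ * Complex.exp (-κ * t) := by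
    intro a b
    symm
    refine intervalIntegral.integral_eq_sub_of_hasDerivAt
      (f := fun t : ℝ => Complex.exp (-κ * t)) (fun t _ => ?_)
      (Continuous.intervalIntegrable (by fun_prop) _ _)
    have h1 : HasDerivAt (fun t : ℝ => (-κ : ℂ) * t) (-κ * 1) t :=
      (Complex.ofRealCLM.hasDerivAt (x := t)).const_mul (-κ : ℂ)
    have h2 := h1.cexp
    rw [mul_one, mul_comm] at h2
    exact h2
  refine ⟨p, memLp_two_integral_kernel hk1 hk2 hk0 hf, fun a b => ?_⟩
  have hEloc : LocallyIntegrable (fun t : ℝ => -κ * Complex.exp (-κ * t)) volume :=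
    Continuous.locallyIntegrable (by fun_prop)
  have := primitive_mul (u := fun t : ℝ => Complex.exp (-κ * t)) hEloc hloc hE hGp a b
  rw [hpG]
  simp only
  rw [this]
  congr 1
  funext t
  have : Complex.exp (-κ * t) * (Complex.exp (κ * t) * f t) = f t := by
    rw [← mul_assoc, ← Complex.exp_add]; simp
  linear_combination this

/-- The square integrable solution of `-q' + κ q = f`. -/
theorem exists_memLp_deriv_sub {κ : ℝ} (hκ : 0 < κ) {f : ℝ → ℂ} (hf : MemLp f 2 volume) :
    ∃ q : ℝ → ℂ, MemLp q 2 volume ∧ ∀ a b, q b - q a = ∫ t in a..b, (κ * q t - f t) := by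
  obtain ⟨p, hp, hpi⟩ := exists_memLp_deriv_add hκ
    (hf.comp_measurePreserving (Measure.measurePreserving_neg (volume : Measure ℝ)))
  refine ⟨fun x => p (-x), hp.comp_measurePreserving (Measure.measurePreserving_neg _),
    fun a b => ?_⟩
  simp only
  have h1 := intervalIntegral.integral_comp_neg (a := a) (b := b)
    (fun t => f (-t) - κ * p t)
  rw [hpi, intervalIntegral.integral_symm]
  simp only [Function.comp_apply]
  rw [← h1, ← intervalIntegral.integral_neg]
  congr 1
  funext t
  rw [neg_neg]; ring

/-- Solvability of `-ψ'' + κ² ψ = f` in `H²(ℝ)`. -/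
theorem exists_isSecondDeriv {κ : ℝ} (hκ : 0 < κ) (f : L2Line) :
    ∃ ψ g : L2Line, IsSecondDeriv ψ g ∧ f = -g + ((κ ^ 2 : ℝ) : ℂ) • ψ := by
  obtain ⟨p, hp, hpi⟩ := exists_memLp_deriv_add hκ (Lp.memLp f)
  obtain ⟨q, hq, hqi⟩ := exists_memLp_deriv_sub hκ (Lp.memLp f)
  have hκc : (κ : ℂ) ≠ 0 := by exact_mod_cast hκ.ne'
  have hfl := L2Line.locallyIntegrable f
  have hpl : LocallyIntegrable p volume := hp.locallyIntegrable (by norm_num)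
  have hql : LocallyIntegrable q volume := hq.locallyIntegrable (by norm_num)
  have hp1 : LocallyIntegrable (fun t => (f : ℝ → ℂ) t - κ * p t) volume :=
    hfl.sub (hpl.smul (κ : ℂ))
  have hq1 : LocallyIntegrable (fun t => κ * q t - (f : ℝ → ℂ) t) volume :=
    (hql.smul (κ : ℂ)).sub hfl
  have hpc : Continuous p := continuous_of_primitive hp1 hpi
  have hqc : Continuous q := continuous_of_primitive hq1 hqi
  have hII : ∀ {w : ℝ → ℂ}, LocallyIntegrable w volume → ∀ a b, IntervalIntegrable w volume a b :=
    fun hw a b => (hw.integrableOn_isCompact isCompact_uIcc).intervalIntegrable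
  -- Partial fractions: `(κ² - ∂²)⁻¹ = (2κ)⁻¹ ((κ + ∂)⁻¹ + (κ - ∂)⁻¹)`. The equations for `p` and
  -- `q` give `u' = (q - p) / 2`, in which `f` cancels.
  set u : ℝ → ℂ := fun x => (2 * κ : ℂ)⁻¹ * (p x + q x) with hu
  set v : ℝ → ℂ := fun x => (2 : ℂ)⁻¹ * (q x - p x) with hv
  have hum : MemLp u 2 volume := (hp.add hq).const_mul _
  have hvc : Continuous v := by fun_prop
  have huv : ∀ a b, u b - u a = ∫ t in a..b, v t := by
    intro a b
    have : u b - u a = (2 * κ : ℂ)⁻¹ * ((p b - p a) + (q b - q a)) := by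
      simp only [hu]; ring
    rw [this, hpi, hqi, ← intervalIntegral.integral_add (hII hp1 a b) (hII hq1 a b),
      ← intervalIntegral.integral_const_mul]
    congr 1
    funext t
    simp only [hv]
    field_simp
    ring
  have hvi : ∀ a b, v b - v a = ∫ t in a..b, ((κ : ℂ) ^ 2 * u t - (f : ℝ → ℂ) t) := by
    intro a b
    have : v b - v a = (2 : ℂ)⁻¹ * ((q b - q a) - (p b - p a)) := by
      simp only [hv]; ring
    rw [this, hpi, hqi, ← intervalIntegral.integral_sub (hII hq1 a b) (hII hp1 a b),
      ← intervalIntegral.integral_const_mul]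
    congr 1
    funext t
    simp only [hu]
    field_simp
    ring
  set ψ : L2Line := hum.toLp u with hψ
  have hψu : (ψ : ℝ → ℂ) =ᵐ[volume] u := hum.coeFn_toLp
  refine ⟨ψ, ((κ ^ 2 : ℝ) : ℂ) • ψ - f, ⟨u, v, hψu, fun x => ?_, fun a b => ?_⟩, by abel⟩
  · have h1 : u = fun x => u 0 + ∫ t in (0 : ℝ)..x, v t := by
      funext x; rw [← huv]; ring
    rw [h1]
    exact (intervalIntegral.integral_hasDerivAt_right (hvc.intervalIntegrable _ _)
      (hvc.stronglyMeasurableAtFilter _ _) hvc.continuousAt).const_add _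
  · rw [hvi]
    apply intervalIntegral.integral_congr_ae
    filter_upwards [Lp.coeFn_sub (((κ ^ 2 : ℝ) : ℂ) • ψ) f,
      Lp.coeFn_smul ((κ ^ 2 : ℝ) : ℂ) ψ, hψu] with t h1 h2 h3 _
    rw [h1, Pi.sub_apply, h2, Pi.smul_apply, h3, smul_eq_mul]
    push_cast; rfl

/-- The first derivative of an `H²` function is square integrable. -/
theorem IsSecondDeriv.memLp_deriv {ψ g : L2Line} {u v : ℝ → ℂ} (hψ : (ψ : ℝ → ℂ) =ᵐ[volume] u)
    (hu : ∀ x, HasDerivAt u (v x) x) (hv : ∀ a b, v b - v a = ∫ t in a..b, (g : ℝ → ℂ) t) :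
    MemLp v 2 volume := by
  have hvc : Continuous v := continuous_of_primitive (L2Line.locallyIntegrable g) hv
  -- The kernel of the Taylor remainder in `u (x + 1) - u x = v x + ∫ (x + 1 - t) g t` over `[x, x +
  -- 1]`. It writes `v` as a difference of square integrable functions.
  set k : ℝ → ℝ := (Icc (-1 : ℝ) 0).indicator fun s => 1 + s with hk
  have hkI : Integrable k volume := by
    rw [hk, integrable_indicator_iff measurableSet_Icc]
    exact (Continuous.integrableOn_Icc (by fun_prop))
  have hk2 : MemLp k 2 volume := by
    rw [memLp_two_iff_integrable_sq hkI.aestronglyMeasurable]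
    have : (fun x => k x ^ 2) = (Icc (-1 : ℝ) 0).indicator fun s => (1 + s) ^ 2 := by
      funext s
      simp only [hk, indicator_apply]
      split_ifs <;> simp
    rw [this, integrable_indicator_iff measurableSet_Icc]
    exact (Continuous.integrableOn_Icc (by fun_prop))
  have hk0 : ∀ s, 0 ≤ k s := fun s => indicator_nonneg (fun s hs => by linarith [hs.1]) s
  have hJ := memLp_two_integral_kernel hkI hk2 hk0 (Lp.memLp g)
  have hum : MemLp u 2 volume := (memLp_congr_ae hψ).1 (Lp.memLp ψ)
  have hum1 : MemLp (fun x => u (x + 1)) 2 volume :=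
    hum.comp_measurePreserving (measurePreserving_add_right volume 1)
  refine ((hum1.sub hum).sub hJ).ae_eq (Eventually.of_forall fun x => ?_)
  simp only [Pi.sub_apply]
  have h1 : u (x + 1) - u x = ∫ t in x..(x + 1), v t :=
    (intervalIntegral.integral_eq_sub_of_hasDerivAt (fun t _ => hu t)
      (hvc.intervalIntegrable _ _)).symm
  have h2 := primitive_mul (u := fun t : ℝ => ((t - (x + 1) : ℝ) : ℂ)) (φ := fun _ => 1)
    (continuous_const.locallyIntegrable) (L2Line.locallyIntegrable g)
    (fun a b => by simp) hv x (x + 1)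
  have h3 : ∫ y, (k (x - y) : ℂ) * (g : ℝ → ℂ) y
      = ∫ t in x..(x + 1), ((x + 1 - t : ℝ) : ℂ) * (g : ℝ → ℂ) t := by
    rw [intervalIntegral.integral_of_le (by linarith), ← integral_Icc_eq_integral_Ioc,
      ← integral_indicator measurableSet_Icc]
    congr 1
    funext t
    simp only [hk, indicator_apply, mem_Icc]
    have : (-1 ≤ x - t ∧ x - t ≤ 0) ↔ (x ≤ t ∧ t ≤ x + 1) := by
      constructor <;> rintro ⟨h1, h2⟩ <;> constructor <;> linarith
    rw [if_congr this rfl rfl]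
    split_ifs
    · congr 2; ring
    · simp
  have h4 : ∫ t in x..(x + 1), (1 * v t + ((t - (x + 1) : ℝ) : ℂ) * (g : ℝ → ℂ) t)
      = (∫ t in x..(x + 1), v t)
        - ∫ t in x..(x + 1), ((x + 1 - t : ℝ) : ℂ) * (g : ℝ → ℂ) t := by
    rw [← intervalIntegral.integral_sub (hvc.intervalIntegrable _ _)]
    · congr 1; funext t; push_cast; ring
    · exact (L2Line.intervalIntegrable g _ _).continuousOn_mul (by fun_prop)
  rw [h1, h3, ← h4, ← h2]
  push_cast; ring

theorem IsSecondDeriv.exists_weakDeriv {ψ g : L2Line} (h : IsSecondDeriv ψ g) :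
    ∃ (η : L2Line) (u v : ℝ → ℂ), (ψ : ℝ → ℂ) =ᵐ[volume] u ∧ (∀ x, HasDerivAt u (v x) x) ∧ Continuous v ∧
      (η : ℝ → ℂ) =ᵐ[volume] v ∧ IsWeakDeriv ψ η ∧ IsWeakDeriv η g := by
  obtain ⟨u, v, hψ, hu, hv⟩ := h
  have hvm := IsSecondDeriv.memLp_deriv hψ hu hv
  have hvc : Continuous v := continuous_of_primitive (L2Line.locallyIntegrable g) hv
  have hη : ((hvm.toLp v : L2Line) : ℝ → ℂ) =ᵐ[volume] v := hvm.coeFn_toLp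
  refine ⟨hvm.toLp v, u, v, hψ, hu, hvc, hη, ⟨u, hψ, fun a b => ?_⟩, v, hη, hv⟩
  rw [← intervalIntegral.integral_eq_sub_of_hasDerivAt (fun t _ => hu t)
      (hvc.intervalIntegrable a b)]
  apply intervalIntegral.integral_congr_ae
  filter_upwards [hη] with t ht _
  exact ht.symm

end Resolvent

/-! ### The resolvent of the Schrödinger operator and its weak formulation -/

section SchrodingerResolvent

open scoped InnerProductSpace ComplexConjugate ENNReal
open Set

theorem L2Line.norm_sq_eq (ψ : L2Line) : ‖ψ‖ ^ 2 = ∫ x, ‖(ψ : ℝ → ℂ) x‖ ^ 2 := by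
  have h1 : (⟪ψ, ψ⟫_ℂ).re = ‖ψ‖ ^ 2 := inner_self_eq_norm_sq (𝕜 := ℂ) ψ
  rw [← h1, L2.inner_def, ← Complex.ofReal_re (∫ x, ‖(ψ : ℝ → ℂ) x‖ ^ 2),
    ← integral_complex_ofReal]
  congr 2
  funext x
  rw [RCLike.inner_apply, mul_comm, Complex.conj_mul']; push_cast; rfl

/-- `M` is the operator of multiplication by `U` on `L²(ℝ)`. -/
def IsMulOp (U : ℝ → ℝ) (M : L2Line →L[ℂ] L2Line) : Prop :=
  ∀ f : L2Line, (M f : ℝ → ℂ) =ᵐ[volume] fun x => (U x : ℂ) * (f : ℝ → ℂ) x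

theorem exists_isMulOp {U : ℝ → ℝ} (hU : Measurable U) {C : ℝ} (hC : ∀ x, |U x| ≤ C) :
    ∃ M : L2Line →L[ℂ] L2Line, IsMulOp U M := by
  have hm : MemLp (fun x => (U x : ℂ)) ∞ (volume : Measure ℝ) :=
    memLp_top_of_bound (by fun_prop) C (Eventually.of_forall fun x => by simpa using hC x)
  refine ⟨(ContinuousLinearMap.mul ℂ ℂ).holderL volume ∞ 2 2 (hm.toLp _), fun f => ?_⟩
  filter_upwards [ContinuousLinearMap.coeFn_holder (r := 2) (ContinuousLinearMap.mul ℂ ℂ)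
    (hm.toLp _) f, hm.coeFn_toLp] with x h1 h2
  rw [ContinuousLinearMap.holderL_apply_apply, h1, h2]
  rfl

namespace IsMulOp

variable {U : ℝ → ℝ} {M : L2Line →L[ℂ] L2Line}

theorem inner_eq (hM : IsMulOp U M) (φ ψ : L2Line) :
    ⟪φ, M ψ⟫_ℂ = ∫ x, (U x : ℂ) * (conj ((φ : ℝ → ℂ) x) * (ψ : ℝ → ℂ) x) := by
  rw [L2.inner_def]
  refine integral_congr_ae ?_
  filter_upwards [hM ψ] with x hx
  rw [hx, RCLike.inner_apply]; ring

theorem symm (hM : IsMulOp U M) (φ ψ : L2Line) : ⟪M φ, ψ⟫_ℂ = ⟪φ, M ψ⟫_ℂ := by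
  rw [← inner_conj_symm, hM.inner_eq, hM.inner_eq, ← integral_conj]
  congr 1
  funext x
  simp only [map_mul, Complex.conj_ofReal, Complex.conj_conj]
  ring

theorem re_inner_ge (hM : IsMulOp U M) {δ : ℝ} (hδ : ∀ x, δ ≤ U x) (ψ : L2Line) :
    δ * ‖ψ‖ ^ 2 ≤ (⟪ψ, M ψ⟫_ℂ).re := by
  have h1 : (⟪ψ, M ψ⟫_ℂ).re = ∫ x, U x * ‖(ψ : ℝ → ℂ) x‖ ^ 2 := by
    rw [hM.inner_eq, ← Complex.ofReal_re (∫ x, U x * ‖(ψ : ℝ → ℂ) x‖ ^ 2), ← integral_complex_ofReal]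
    congr 2
    funext x
    rw [Complex.conj_mul']; push_cast; rfl
  have h2 := L2Line.norm_sq_eq ψ
  have hsq : Integrable (fun x => ‖(ψ : ℝ → ℂ) x‖ ^ 2) volume :=
    (memLp_two_iff_integrable_sq_norm (Lp.memLp ψ).aestronglyMeasurable).1 (Lp.memLp ψ)
  rw [h1, h2, ← integral_const_mul]
  refine integral_mono (hsq.const_mul δ) ?_ fun x => by
    have := hδ x; gcongr
  have h3 : Integrable (fun x => conj ((ψ : ℝ → ℂ) x) * (M ψ : ℝ → ℂ) x) volume :=
    L2Line.integrable_mul (Lp.memLp ψ).star (Lp.memLp (M ψ))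
  refine h3.re.congr ?_
  filter_upwards [hM ψ] with x hx
  rw [hx]
  have : conj ((ψ : ℝ → ℂ) x) * ((U x : ℂ) * (ψ : ℝ → ℂ) x)
      = ((U x * ‖(ψ : ℝ → ℂ) x‖ ^ 2 : ℝ) : ℂ) := by
    push_cast; rw [← Complex.conj_mul']; ring
  rw [this]; exact Complex.ofReal_re _

end IsMulOp

theorem mem_schrodingerGraph_iff {U : ℝ → ℝ} {M : L2Line →L[ℂ] L2Line} (hM : IsMulOp U M)
    (h : ℝ) (ψ f : L2Line) : (ψ, f) ∈ schrodingerGraph h U ↔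
      ∃ g, IsSecondDeriv ψ g ∧ f = -(((h ^ 2 : ℝ) : ℂ) • g) + M ψ := by
  refine exists_congr fun g => and_congr_right fun _ => ?_
  rw [Lp.ext_iff]
  have key : ((-(((h ^ 2 : ℝ) : ℂ) • g) + M ψ : L2Line) : ℝ → ℂ) =ᵐ[volume]
      fun x => -(h : ℂ) ^ 2 * (g : ℝ → ℂ) x + (U x : ℂ) * (ψ : ℝ → ℂ) x := by
    filter_upwards [Lp.coeFn_add (-(((h ^ 2 : ℝ) : ℂ) • g)) (M ψ), hM ψ,
      Lp.coeFn_neg (((h ^ 2 : ℝ) : ℂ) • g), Lp.coeFn_smul ((h ^ 2 : ℝ) : ℂ) g] with x h1 h2 h3 h4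
    rw [h1, Pi.add_apply, h2, h3, Pi.neg_apply, h4, Pi.smul_apply, smul_eq_mul]
    push_cast; ring
  exact ⟨fun h1 => h1.trans key.symm, fun h1 => h1.trans key⟩

/-- `ψ` has the regularity of `H²` functions and satisfies `-h² ψ'' + U ψ = f` weakly; the
function `u` with derivative `v` represents `ψ`, and `η` is the class of `v`. -/
structure IsWeakSolution (h : ℝ) (M : L2Line →L[ℂ] L2Line) (f ψ η : L2Line) (u v : ℝ → ℂ) :
    Prop where
  ae_eq : (ψ : ℝ → ℂ) =ᵐ[volume] u
  hasDerivAt : ∀ x, HasDerivAt u (v x) x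
  continuous : Continuous v
  ae_eq_deriv : (η : ℝ → ℂ) =ᵐ[volume] v
  weakDeriv : IsWeakDeriv ψ η
  inner_eq : ∀ φ θ, IsWeakDeriv φ θ → ⟪φ, f⟫_ℂ = ((h ^ 2 : ℝ) : ℂ) * ⟪θ, η⟫_ℂ + ⟪φ, M ψ⟫_ℂ

theorem exists_isWeakSolution {U : ℝ → ℝ} {M : L2Line →L[ℂ] L2Line} (hM : IsMulOp U M)
    {h : ℝ} {ψ f : L2Line} (hψ : (ψ, f) ∈ schrodingerGraph h U) :
    ∃ η u v, IsWeakSolution h M f ψ η u v := by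
  obtain ⟨g, hg, hf⟩ := (mem_schrodingerGraph_iff hM h ψ f).1 hψ
  obtain ⟨η, u, v, h1, h2, h3, h4, h5, h6⟩ := hg.exists_weakDeriv
  refine ⟨η, u, v, h1, h2, h3, h4, h5, fun φ θ hφ => ?_⟩
  have := hφ.inner_add_inner h6
  rw [hf, inner_add_right, inner_neg_right, inner_smul_right, eq_neg_of_add_eq_zero_left this]
  ring

/-- The kinetic energy is nonnegative, so the form is at least that of the potential; Cauchy–Schwarz
gives the second bound. For `δ > 0` this is the uniqueness and boundedness needed to invert the
operator. -/
theorem norm_le_of_mem_graph {U : ℝ → ℝ} {M : L2Line →L[ℂ] L2Line} (hM : IsMulOp U M)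
    {δ : ℝ} (hδ : ∀ x, δ ≤ U x) {h : ℝ} {ψ f : L2Line} (hψ : (ψ, f) ∈ schrodingerGraph h U) :
    δ * ‖ψ‖ ^ 2 ≤ (⟪ψ, f⟫_ℂ).re ∧ δ * ‖ψ‖ ≤ ‖f‖ := by
  obtain ⟨η, u, v, hw⟩ := exists_isWeakSolution hM hψ
  have h1 := hw.inner_eq ψ η hw.weakDeriv
  have h2 : δ * ‖ψ‖ ^ 2 ≤ (⟪ψ, f⟫_ℂ).re := by
    rw [h1, Complex.add_re, Complex.re_ofReal_mul]
    have h3 := hM.re_inner_ge hδ ψ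
    have h4 : (⟪η, η⟫_ℂ).re = ‖η‖ ^ 2 := inner_self_eq_norm_sq (𝕜 := ℂ) η
    rw [h4]
    have : 0 ≤ h ^ 2 * ‖η‖ ^ 2 := by positivity
    linarith
  refine ⟨h2, ?_⟩
  have h5 : (⟪ψ, f⟫_ℂ).re ≤ ‖ψ‖ * ‖f‖ := (Complex.re_le_norm _).trans (norm_inner_le_norm _ _)
  rcases (norm_nonneg ψ).eq_or_lt with h0 | h0
  · rw [← h0]; simp
  · nlinarith

/-- A bounded below and surjective linear relation is the inverse of a bounded operator. -/
theorem exists_inverse_of_graph {H : Type*} [NormedAddCommGroup H] [NormedSpace ℂ H]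
    (S : Submodule ℂ (H × H)) {δ : ℝ} (hδ : 0 < δ) (hS : ∀ p ∈ S, δ * ‖p.1‖ ≤ ‖p.2‖)
    (hsurj : ∀ f, ∃ ψ, (ψ, f) ∈ S) :
    ∃ R : H →L[ℂ] H, (∀ f, (R f, f) ∈ S) ∧ ‖R‖ ≤ δ⁻¹ := by
  choose r hr using hsurj
  have huniq : ∀ {ψ φ f : H}, (ψ, f) ∈ S → (φ, f) ∈ S → ψ = φ := by
    intro ψ φ f h1 h2
    have h3 := hS _ (S.sub_mem h1 h2)
    simp only [Prod.mk_sub_mk, sub_self, norm_zero] at h3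
    have : ‖ψ - φ‖ = 0 := le_antisymm (by nlinarith [norm_nonneg (ψ - φ)]) (norm_nonneg _)
    exact sub_eq_zero.1 (norm_eq_zero.1 this)
  let R₀ : H →ₗ[ℂ] H :=
    { toFun := r
      map_add' := fun f g => huniq (hr _) (S.add_mem (hr f) (hr g))
      map_smul' := fun z f => huniq (hr _) (S.smul_mem z (hr f)) }
  have hb : ∀ f, ‖R₀ f‖ ≤ δ⁻¹ * ‖f‖ := by
    intro f
    rw [le_inv_mul_iff₀ hδ]
    exact hS _ (hr f)
  exact ⟨R₀.mkContinuous δ⁻¹ hb, hr, R₀.mkContinuous_norm_le (by positivity) hb⟩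

theorem exists_mem_schrodingerGraph_const {h c : ℝ} (hh : 0 < h) (hc : 0 < c) (f : L2Line) :
    ∃ ψ, (ψ, f) ∈ schrodingerGraph h fun _ => c := by
  have hM : IsMulOp (fun _ => c) ((c : ℂ) • ContinuousLinearMap.id ℂ L2Line) := fun f =>
    (Lp.coeFn_smul (c : ℂ) f)
  have hκ : 0 < Real.sqrt c / h := by positivity
  obtain ⟨ψ, g, hg, hf⟩ := exists_isSecondDeriv hκ ((((h ^ 2)⁻¹ : ℝ) : ℂ) • f)
  have hκ2 : (Real.sqrt c / h) ^ 2 = (h ^ 2)⁻¹ * c := by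
    rw [div_pow, Real.sq_sqrt hc.le]; field_simp
  refine ⟨ψ, (mem_schrodingerGraph_iff hM h ψ f).2 ⟨g, hg, ?_⟩⟩
  have h1 : f = ((h ^ 2 : ℝ) : ℂ) • ((((h ^ 2)⁻¹ : ℝ) : ℂ) • f) := by
    rw [smul_smul, ← Complex.ofReal_mul, mul_inv_cancel₀ (by positivity)]
    simp
  rw [h1, hf, hκ2, smul_add, smul_neg, smul_smul, ← Complex.ofReal_mul,
    mul_inv_cancel_left₀ (by positivity)]
  rfl

theorem norm_mulOp_le {V : ℝ → ℝ} {M : L2Line →L[ℂ] L2Line} (hM : IsMulOp V M) {C : ℝ}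
    (hC0 : 0 ≤ C) (hC : ∀ x, |V x| ≤ C) : ‖M‖ ≤ C := by
  refine M.opNorm_le_bound hC0 fun f => ?_
  refine Lp.norm_le_mul_norm_of_ae_le_mul ?_
  filter_upwards [hM f] with x hx
  rw [hx, norm_mul, Complex.norm_real]
  gcongr
  exact hC x

/-- `V` is a bounded perturbation of `-h²∂² + c`, whose inverse `G` has norm at most `c⁻¹`. As `‖M
G‖ ≤ C / c < 1`, a solution is `G (1 + M G)⁻¹ f`. -/
theorem exists_mem_schrodingerGraph {V : ℝ → ℝ} (hV : Measurable V) {C c h : ℝ}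
    (hC : ∀ x, |V x| ≤ C) (hCc : C < c) (hh : 0 < h) (f : L2Line) :
    ∃ ψ, (ψ, f) ∈ schrodingerGraph h fun x => V x + c := by
  have hC0 : 0 ≤ C := (abs_nonneg _).trans (hC 0)
  have hc : 0 < c := hC0.trans_lt hCc
  obtain ⟨M, hM⟩ := exists_isMulOp hV hC
  have hMc : IsMulOp (fun _ => c) ((c : ℂ) • ContinuousLinearMap.id ℂ L2Line) := fun f =>
    (Lp.coeFn_smul (c : ℂ) f)
  have hMVc : IsMulOp (fun x => V x + c) (M + (c : ℂ) • ContinuousLinearMap.id ℂ L2Line) := by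
    intro f
    filter_upwards [Lp.coeFn_add (M f) ((c : ℂ) • f), hM f, Lp.coeFn_smul (c : ℂ) f]
      with x h1 h2 h3
    rw [show (M + (c : ℂ) • ContinuousLinearMap.id ℂ L2Line) f = M f + (c : ℂ) • f from rfl, h1,
      Pi.add_apply, h2, h3, Pi.smul_apply, smul_eq_mul]
    push_cast; ring
  obtain ⟨G, hG, hGn⟩ := exists_inverse_of_graph (schrodingerGraph h fun _ => c) hc
    (fun p hp => (norm_le_of_mem_graph hMc (fun _ => le_rfl) hp).2)
    (exists_mem_schrodingerGraph_const hh hc)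
  have hlt : ‖-(M * G)‖ < 1 := by
    rw [norm_neg]
    calc ‖M * G‖ ≤ ‖M‖ * ‖G‖ := norm_mul_le _ _
      _ ≤ C * c⁻¹ := by
        gcongr
        exact norm_mulOp_le hM hC0 hC
      _ < 1 := by rw [mul_inv_lt_iff₀ hc]; linarith
  obtain ⟨W, hW⟩ := isUnit_one_sub_of_norm_lt_one hlt
  set w := (↑W⁻¹ : L2Line →L[ℂ] L2Line) f with hw
  have hwf : w + M (G w) = f := by
    have := congrArg (fun B : L2Line →L[ℂ] L2Line => B f) W.mul_inv
    rw [hW, sub_neg_eq_add] at this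
    exact this
  obtain ⟨g, hg, e⟩ := (mem_schrodingerGraph_iff hMc h _ _).1 (hG w)
  refine ⟨G w, (mem_schrodingerGraph_iff hMVc h _ _).2 ⟨g, hg, ?_⟩⟩
  change f = _ + (M (G w) + (c : ℂ) • G w)
  rw [← hwf]
  nth_rewrite 1 [e]
  change _ + (c : ℂ) • G w + M (G w) = _
  abel

/-- The resolvent of the Schrödinger operator at `-c`, for `c` above the bound of `|V|`. -/
theorem exists_isShiftedInverse {V : ℝ → ℝ} (hV : Measurable V) {C c h : ℝ}
    (hC : ∀ x, |V x| ≤ C) (hCc : C < c) (hh : 0 < h) :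
    ∃ R M : L2Line →L[ℂ] L2Line, IsShiftedInverse (schrodinger h V) c R ∧
      IsMulOp (fun x => V x + c) M ∧ ∀ f, ∃ η u v, IsWeakSolution h M f (R f) η u v := by
  obtain ⟨M, hM⟩ : ∃ M, IsMulOp (fun x => V x + c) M :=
    exists_isMulOp (U := fun x => V x + c) (by fun_prop) (C := C + |c|) fun x =>
      (abs_add_le _ _).trans (by gcongr; exact hC x)
  have hpos : ∀ x, c - C ≤ V x + c := fun x => by
    have := (abs_le.1 (hC x)).1; linarith
  obtain ⟨R, hR, -⟩ := exists_inverse_of_graph (schrodingerGraph h fun x => V x + c)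
    (sub_pos.2 hCc) (fun p hp => (norm_le_of_mem_graph hM hpos hp).2)
    (exists_mem_schrodingerGraph hV hC hCc hh)
  have hshift : ∀ ψ f : L2Line, (ψ, f) ∈ schrodingerGraph h V ↔
      (ψ, f + (c : ℂ) • ψ) ∈ schrodingerGraph h fun x => V x + c := by
    intro ψ f
    refine exists_congr fun g => and_congr_right fun _ => ?_
    have h1 := Lp.coeFn_add f ((c : ℂ) • ψ)
    have h2 := Lp.coeFn_smul (c : ℂ) ψ
    constructor
    · intro h3
      filter_upwards [h1, h2, h3] with x e1 e2 e3
      simp only [e1, Pi.add_apply, e2, Pi.smul_apply, smul_eq_mul, e3]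
      push_cast; ring
    · intro h3
      filter_upwards [h1, h2, h3] with x e1 e2 e3
      simp only [e1, Pi.add_apply, e2, Pi.smul_apply, smul_eq_mul] at e3
      have := eq_sub_of_add_eq e3
      simp only [this]
      push_cast; ring
  have hmemT : ∀ (ψ f : L2Line), (ψ, f) ∈ schrodingerGraph h V →
      ∃ hy : ψ ∈ (schrodinger h V).domain, schrodinger h V ⟨ψ, hy⟩ = f := by
    intro ψ f hm
    rw [← schrodinger_graph, LinearPMap.mem_graph_iff] at hm
    obtain ⟨y, hy1, hy2⟩ := hm
    obtain rfl : (y : L2Line) = ψ := hy1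
    exact ⟨y.2, hy2⟩
  have hweak := fun f => exists_isWeakSolution hM (hR f)
  refine ⟨R, M, ⟨fun y => ?_, fun x => ?_, ?_, fun f => ?_⟩, hM, hweak⟩
  · have h1 : (R y, y - (c : ℂ) • R y) ∈ schrodingerGraph h V := by
      rw [hshift, sub_add_cancel]; exact hR y
    obtain ⟨hy, e⟩ := hmemT _ _ h1
    exact ⟨hy, by rw [e]; abel⟩
  · have h1 : ((x : L2Line), schrodinger h V x) ∈ schrodingerGraph h V := by
      rw [← schrodinger_graph]; exact LinearPMap.mem_graph _ x
    rw [hshift] at h1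
    have h2 := Submodule.sub_mem _ (hR (schrodinger h V x + (c : ℂ) • (x : L2Line))) h1
    rw [Prod.mk_sub_mk, sub_self] at h2
    have h3 := (norm_le_of_mem_graph hM hpos h2).2
    rw [norm_zero] at h3
    have h4 : ‖R (schrodinger h V x + (c : ℂ) • (x : L2Line)) - x‖ = 0 :=
      le_antisymm (by nlinarith [norm_nonneg (R (schrodinger h V x + (c : ℂ) • (x : L2Line)) - x)])
        (norm_nonneg _)
    exact sub_eq_zero.1 (norm_eq_zero.1 h4)
  · rw [ContinuousLinearMap.isSelfAdjoint_iff_isSymmetric]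
    intro f g
    obtain ⟨η₁, u₁, v₁, w₁⟩ := hweak f
    obtain ⟨η₂, u₂, v₂, w₂⟩ := hweak g
    have e1 := w₂.inner_eq _ _ w₁.weakDeriv
    have e2 := w₁.inner_eq _ _ w₂.weakDeriv
    change ⟪R f, g⟫_ℂ = ⟪f, R g⟫_ℂ
    rw [← inner_conj_symm f, e1, e2, map_add, map_mul, Complex.conj_ofReal, inner_conj_symm,
      inner_conj_symm, hM.symm]
  · have h1 := (norm_le_of_mem_graph hM hpos (hR f)).1
    have h2 : (⟪f, R f⟫_ℂ).re = (⟪R f, f⟫_ℂ).re := by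
      rw [← inner_conj_symm, Complex.conj_re]
    rw [h2]
    have : 0 < c - C := sub_pos.2 hCc
    exact le_trans (by positivity) h1

end SchrodingerResolvent

/-! ### Upper bound: positivity of the form under point conditions -/

section UpperBound

open scoped InnerProductSpace ComplexConjugate
open Set

/-- Wirtinger's inequality on an interval of length less than `π / ω`, for functions vanishing at
the end points. -/
theorem integral_wirtinger_nonneg {α β ω : ℝ} (hαβ : α ≤ β) (hω : 0 ≤ ω)
    (hωπ : (β - α) * ω < Real.pi) {u v : ℝ → ℂ} (hu : ∀ x, HasDerivAt u (v x) x)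
    (hv : Continuous v) (h0 : u α = 0) (h1 : u β = 0) :
    0 ≤ ∫ x in α..β, (‖v x‖ ^ 2 - ω ^ 2 * ‖u x‖ ^ 2) := by
  have huc : Continuous u := continuous_iff_continuousAt.2 fun x => (hu x).continuousAt
  -- A solution of the Riccati equation `τ' = ω² + τ²`, regular on `[α, β]` because the argument
  -- stays within `π / 2` of zero. Then `|v|² - ω² |u|² = |v + τ u|² - (τ |u|²)'`, and the boundary
  -- term vanishes.
  set τ : ℝ → ℝ := fun x => ω * Real.tan (ω * (x - (α + β) / 2)) with hτ
  have hcos : ∀ x ∈ uIcc α β, Real.cos (ω * (x - (α + β) / 2)) ≠ 0 := by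
    intro x hx
    rw [uIcc_of_le hαβ] at hx
    refine (Real.cos_pos_of_mem_Ioo ⟨?_, ?_⟩).ne'
    · nlinarith [hx.1, hx.2]
    · nlinarith [hx.1, hx.2]
  have hτd : ∀ x ∈ uIcc α β, HasDerivAt τ (ω ^ 2 + τ x ^ 2) x := by
    intro x hx
    have e1 : HasDerivAt (fun x : ℝ => ω * (x - (α + β) / 2)) (ω * 1) x :=
      ((hasDerivAt_id x).sub_const _).const_mul ω
    have e2 := ((Real.hasDerivAt_tan (hcos x hx)).comp x e1).const_mul ω
    refine e2.congr_deriv ?_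
    simp only [hτ]
    rw [one_div, ← Real.inv_one_add_tan_sq (hcos x hx), inv_inv]
    ring
  have hτc : ContinuousOn τ (uIcc α β) := fun x hx => (hτd x hx).continuousAt.continuousWithinAt
  have hF : ∀ x ∈ uIcc α β, HasDerivAt (fun x => τ x * ‖u x‖ ^ 2)
      ((ω ^ 2 + τ x ^ 2) * ‖u x‖ ^ 2 + τ x * (2 * ⟪u x, v x⟫_ℝ)) x :=
    fun x hx => (hτd x hx).mul (hu x).norm_sq
  have hF' : IntervalIntegrable (fun x => (ω ^ 2 + τ x ^ 2) * ‖u x‖ ^ 2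
      + τ x * (2 * ⟪u x, v x⟫_ℝ)) volume α β :=
    ContinuousOn.intervalIntegrable (by fun_prop)
  have hFTC := intervalIntegral.integral_eq_sub_of_hasDerivAt hF hF'
  rw [h0, h1] at hFTC
  simp only [norm_zero, ne_eq, OfNat.ofNat_ne_zero, not_false_eq_true, zero_pow, mul_zero,
    sub_self] at hFTC
  have hid : ∀ x, ‖v x‖ ^ 2 - ω ^ 2 * ‖u x‖ ^ 2 = ‖v x + τ x • u x‖ ^ 2 -
      ((ω ^ 2 + τ x ^ 2) * ‖u x‖ ^ 2 + τ x * (2 * ⟪u x, v x⟫_ℝ)) := by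
    intro x
    rw [norm_add_sq_real, inner_smul_right, norm_smul, real_inner_comm, mul_pow, Real.norm_eq_abs,
      sq_abs]
    ring
  simp_rw [hid]
  rw [intervalIntegral.integral_sub (ContinuousOn.intervalIntegrable (by fun_prop)) hF', hFTC,
    sub_zero]
  exact intervalIntegral.integral_nonneg hαβ fun x _ => by positivity

/-- The form of `-h² ∂² + V - a` on `[α, β]` is positive on functions vanishing at suitable `k + 1`
points, among them the end points. -/
def IsControlled (h : ℝ) (V : ℝ → ℝ) (a α β : ℝ) (k : ℕ) : Prop :=
  α ≤ β ∧ ∃ P : Finset ℝ, P.card ≤ k + 1 ∧ α ∈ P ∧ β ∈ P ∧ ∃ ε > 0, ∀ u v : ℝ → ℂ,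
    (∀ x, HasDerivAt u (v x) x) → Continuous v → (∀ p ∈ P, u p = 0) →
      ε * ∫ x in α..β, ‖u x‖ ^ 2 ≤ ∫ x in α..β, (h ^ 2 * ‖v x‖ ^ 2 + (V x - a) * ‖u x‖ ^ 2)

theorem IsControlled.refl (h : ℝ) (V : ℝ → ℝ) (a α : ℝ) : IsControlled h V a α α 0 :=
  ⟨le_rfl, {α}, by simp, by simp, by simp, 1, one_pos, fun u v _ _ _ => by simp⟩

theorem intervalIntegrable_mul_bounded {V : ℝ → ℝ} (hV : Measurable V) {C : ℝ}
    (hC : ∀ x, |V x| ≤ C) {w : ℝ → ℝ} (hw : Continuous w) (α β : ℝ) :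
    IntervalIntegrable (fun x => V x * w x) volume α β := by
  have h1 : IntervalIntegrable V volume α β := by
    refine IntervalIntegrable.mono_fun (g := V) (f := fun _ => C) (by simp)
      hV.aestronglyMeasurable (Eventually.of_forall fun x => ?_)
    exact (hC x).trans (le_abs_self C)
  exact h1.mul_continuousOn hw.continuousOn

theorem IsControlled.trans {h : ℝ} {V : ℝ → ℝ} (hV : Measurable V) {C : ℝ} (hC : ∀ x, |V x| ≤ C)
    {a α β γ : ℝ} {k l : ℕ} (h₁ : IsControlled h V a α β k) (h₂ : IsControlled h V a β γ l) :
    IsControlled h V a α γ (k + l) := by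
  obtain ⟨hαβ, P, hP, hα, hβ, ε, hε, hf⟩ := h₁
  obtain ⟨hβγ, Q, hQ, hβ', hγ, ε', hε', hf'⟩ := h₂
  refine ⟨hαβ.trans hβγ, P ∪ Q, ?_, by simp [hα], by simp [hγ], min ε ε', lt_min hε hε',
    fun u v hu hv h0 => ?_⟩
  -- The common end point `β` is counted once, so the numbers of points `k + 1` and `l + 1` combine
  -- to `k + l + 1`.
  · have h1 := Finset.card_union_add_card_inter P Q
    have h2 : 0 < (P ∩ Q).card := Finset.card_pos.2 ⟨β, by simp [hβ, hβ']⟩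
    omega
  · have huc : Continuous u := continuous_iff_continuousAt.2 fun x => (hu x).continuousAt
    have i1 : ∀ x y, IntervalIntegrable (fun x => ‖u x‖ ^ 2) volume x y := fun x y =>
      Continuous.intervalIntegrable (by fun_prop) _ _
    have i2 : ∀ x y, IntervalIntegrable (fun x => h ^ 2 * ‖v x‖ ^ 2 + (V x - a) * ‖u x‖ ^ 2)
        volume x y := fun x y =>
      IntervalIntegrable.add (Continuous.intervalIntegrable (by fun_prop) _ _)
        (intervalIntegrable_mul_bounded (V := fun x => V x - a) (by fun_prop) (C := C + |a|)
          (fun x => (abs_sub _ _).trans (by gcongr; exact hC x)) (by fun_prop) _ _)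
    rw [← intervalIntegral.integral_add_adjacent_intervals (i1 α β) (i1 β γ),
      ← intervalIntegral.integral_add_adjacent_intervals (i2 α β) (i2 β γ), mul_add]
    have n1 : 0 ≤ ∫ x in α..β, ‖u x‖ ^ 2 :=
      intervalIntegral.integral_nonneg hαβ fun x _ => by positivity
    have n2 : 0 ≤ ∫ x in β..γ, ‖u x‖ ^ 2 :=
      intervalIntegral.integral_nonneg hβγ fun x _ => by positivity
    have e1 := hf u v hu hv fun p hp => h0 p (by simp [hp])
    have e2 := hf' u v hu hv fun p hp => h0 p (by simp [hp])
    have m1 : min ε ε' * ∫ x in α..β, ‖u x‖ ^ 2 ≤ ε * ∫ x in α..β, ‖u x‖ ^ 2 := by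
      gcongr; exact min_le_left _ _
    have m2 : min ε ε' * ∫ x in β..γ, ‖u x‖ ^ 2 ≤ ε' * ∫ x in β..γ, ‖u x‖ ^ 2 := by
      gcongr; exact min_le_right _ _
    linarith

theorem IsControlled.single {h : ℝ} (hh : 0 < h) {V : ℝ → ℝ} (hV : Measurable V) {C : ℝ}
    (hC : ∀ x, |V x| ≤ C) {a α β m : ℝ} (hαβ : α ≤ β) (hm : ∀ x ∈ Ioo α β, m ≤ V x)
    (hs : (β - α) ^ 2 * (a - m) < h ^ 2 * Real.pi ^ 2) : IsControlled h V a α β 1 := by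
  set s := β - α with hsdef
  have hs0 : 0 ≤ s := sub_nonneg.2 hαβ
  set b := max (a - m) 0 with hb
  have hb0 : 0 ≤ b := le_max_right _ _
  have hsb : s ^ 2 * b < h ^ 2 * Real.pi ^ 2 := by
    rcases max_cases (a - m) 0 with ⟨e, -⟩ | ⟨e, -⟩
    · rw [hb, e]; exact hs
    · rw [hb, e, mul_zero]; have := Real.pi_pos; positivity
  set ω₀ := Real.sqrt b / h with hω₀
  have hω₀0 : 0 ≤ ω₀ := by positivity
  have hω₀b : h ^ 2 * ω₀ ^ 2 = b := by
    rw [hω₀, div_pow, Real.sq_sqrt hb0]; field_simp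
  have hsω₀ : s * ω₀ < Real.pi := by
    refine lt_of_pow_lt_pow_left₀ 2 Real.pi_pos.le ?_
    have : h ^ 2 * (s * ω₀) ^ 2 < h ^ 2 * Real.pi ^ 2 := by
      calc _ = s ^ 2 * (h ^ 2 * ω₀ ^ 2) := by ring
        _ < _ := by rw [hω₀b]; exact hsb
    exact lt_of_mul_lt_mul_left this (by positivity)
  -- The strict inequality leaves room to raise the frequency above the critical `ω₀`; the surplus
  -- `h² ω² - (a - m)` becomes the positive constant `ε`.
  obtain ⟨ω, hω1, hω2⟩ : ∃ ω, ω₀ < ω ∧ s * ω < Real.pi := by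
    refine ⟨ω₀ + (Real.pi - s * ω₀) / (s + 1), ?_, ?_⟩
    · have : 0 < (Real.pi - s * ω₀) / (s + 1) := div_pos (sub_pos.2 hsω₀) (by linarith)
      linarith
    · have : s * ((Real.pi - s * ω₀) / (s + 1)) < Real.pi - s * ω₀ := by
        rw [mul_div_assoc', div_lt_iff₀ (by linarith)]
        nlinarith
      rw [mul_add]; linarith
  have hε : 0 < h ^ 2 * ω ^ 2 - (a - m) := by
    have h1 : h ^ 2 * ω₀ ^ 2 < h ^ 2 * ω ^ 2 := by gcongr
    have h2 : a - m ≤ b := le_max_left _ _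
    linarith
  refine ⟨hαβ, {α, β}, (Finset.card_insert_le _ _).trans (by simp), by simp, by simp, _, hε,
    fun u v hu hv h0 => ?_⟩
  have huc : Continuous u := continuous_iff_continuousAt.2 fun x => (hu x).continuousAt
  have hW := integral_wirtinger_nonneg hαβ (hω₀0.trans hω1.le) hω2 hu hv
    (h0 α (by simp)) (h0 β (by simp))
  have hVi : IntervalIntegrable (fun x => (V x - a) * ‖u x‖ ^ 2) volume α β :=
    intervalIntegrable_mul_bounded (V := fun x => V x - a) (by fun_prop) (C := C + |a|)
      (fun x => (abs_sub _ _).trans (by gcongr; exact hC x)) (by fun_prop) _ _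
  calc (h ^ 2 * ω ^ 2 - (a - m)) * ∫ x in α..β, ‖u x‖ ^ 2
      ≤ h ^ 2 * (∫ x in α..β, (‖v x‖ ^ 2 - ω ^ 2 * ‖u x‖ ^ 2)) +
        (h ^ 2 * ω ^ 2 - (a - m)) * ∫ x in α..β, ‖u x‖ ^ 2 := by
        have : 0 ≤ h ^ 2 * (∫ x in α..β, (‖v x‖ ^ 2 - ω ^ 2 * ‖u x‖ ^ 2)) := by positivity
        linarith
    _ = ∫ x in α..β, (h ^ 2 * ‖v x‖ ^ 2 + (m - a) * ‖u x‖ ^ 2) := by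
        rw [← intervalIntegral.integral_const_mul, ← intervalIntegral.integral_const_mul,
          ← intervalIntegral.integral_add (Continuous.intervalIntegrable (by fun_prop) _ _)
            (Continuous.intervalIntegrable (by fun_prop) _ _)]
        congr 1; funext x; ring
    _ ≤ _ := by
        refine intervalIntegral.integral_mono_on_of_le_Ioo hαβ
          (Continuous.intervalIntegrable (by fun_prop) _ _)
          (IntervalIntegrable.add (Continuous.intervalIntegrable (by fun_prop) _ _) hVi)
          fun x hx => ?_
        have := hm x hx
        gcongr

/-- Evaluation of the continuous representative at finitely many points. -/
theorem exists_linearMap_eval {R : L2Line →L[ℂ] L2Line}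
    (hR : ∀ f, ∃ u : ℝ → ℂ, Continuous u ∧ (R f : ℝ → ℂ) =ᵐ[volume] u) (P : Finset ℝ) :
    ∃ L : L2Line →ₗ[ℂ] (P → ℂ), ∀ f (u : ℝ → ℂ), Continuous u → (R f : ℝ → ℂ) =ᵐ[volume] u →
      ∀ p : P, L f p = u p := by
  choose r hrc hr using hR
  have huniq : ∀ f (u : ℝ → ℂ), Continuous u → (R f : ℝ → ℂ) =ᵐ[volume] u → r f = u :=
    fun f u hu he => ((hrc f).ae_eq_iff_eq volume hu).1 ((hr f).symm.trans he)
  refine ⟨{ toFun := fun f p => r f p, map_add' := fun f g => ?_, map_smul' := fun z f => ?_ },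
    fun f u hu he p => by rw [← huniq f u hu he]; rfl⟩
  · rw [huniq (f + g) (r f + r g) ((hrc f).add (hrc g)) (by
      rw [map_add]; exact (Lp.coeFn_add _ _).trans ((hr f).add (hr g)))]
    rfl
  · rw [huniq (z • f) (z • r f) ((hrc f).const_smul z) (by
      rw [map_smul]; exact (Lp.coeFn_smul _ _).trans ((hr f).const_smul z))]
    rfl

/-- Testing the weak equation against `ψ` itself. It identifies `FormGT` at energy `a` with
positivity of the last integral, which is a statement about functions on the line. -/
theorem IsWeakSolution.re_inner_eq {h c : ℝ} {V : ℝ → ℝ} {M : L2Line →L[ℂ] L2Line}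
    (hM : IsMulOp (fun x => V x + c) M) {f ψ η : L2Line} {u v : ℝ → ℂ}
    (hw : IsWeakSolution h M f ψ η u v) (a : ℝ) :
    Integrable (fun x => ‖u x‖ ^ 2) volume ∧
    Integrable (fun x => h ^ 2 * ‖v x‖ ^ 2 + (V x - a) * ‖u x‖ ^ 2) volume ∧
    (⟪f, ψ⟫_ℂ).re = (a + c) * ‖ψ‖ ^ 2 +
      ∫ x, (h ^ 2 * ‖v x‖ ^ 2 + (V x - a) * ‖u x‖ ^ 2) := by
  have mu : MemLp u 2 volume := (memLp_congr_ae hw.ae_eq).1 (Lp.memLp ψ)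
  have mv : MemLp v 2 volume := (memLp_congr_ae hw.ae_eq_deriv).1 (Lp.memLp η)
  have iu : Integrable (fun x => ‖u x‖ ^ 2) volume :=
    (memLp_two_iff_integrable_sq_norm mu.aestronglyMeasurable).1 mu
  have iv : Integrable (fun x => ‖v x‖ ^ 2) volume :=
    (memLp_two_iff_integrable_sq_norm mv.aestronglyMeasurable).1 mv
  have nψ : ‖ψ‖ ^ 2 = ∫ x, ‖u x‖ ^ 2 := by
    rw [L2Line.norm_sq_eq]
    refine integral_congr_ae ?_
    filter_upwards [hw.ae_eq] with x hx
    rw [hx]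
  have nη : ‖η‖ ^ 2 = ∫ x, ‖v x‖ ^ 2 := by
    rw [L2Line.norm_sq_eq]
    refine integral_congr_ae ?_
    filter_upwards [hw.ae_eq_deriv] with x hx
    rw [hx]
  have hpt : ∀ᵐ x, conj ((ψ : ℝ → ℂ) x) * (M ψ : ℝ → ℂ) x
      = (((V x + c) * ‖u x‖ ^ 2 : ℝ) : ℂ) := by
    filter_upwards [hM ψ, hw.ae_eq] with x h1 h2
    rw [h1, h2]
    push_cast
    rw [← Complex.conj_mul']; ring
  have iM : Integrable (fun x => (V x + c) * ‖u x‖ ^ 2) volume := by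
    have h3 : Integrable (fun x => conj ((ψ : ℝ → ℂ) x) * (M ψ : ℝ → ℂ) x) volume :=
      L2Line.integrable_mul (Lp.memLp ψ).star (Lp.memLp (M ψ))
    refine h3.re.congr ?_
    filter_upwards [hpt] with x hx
    rw [hx]; exact Complex.ofReal_re _
  have eM : (⟪ψ, M ψ⟫_ℂ).re = ∫ x, (V x + c) * ‖u x‖ ^ 2 := by
    rw [L2.inner_def, ← Complex.ofReal_re (∫ x, (V x + c) * ‖u x‖ ^ 2), ← integral_complex_ofReal]
    congr 1
    refine integral_congr_ae ?_
    filter_upwards [hpt] with x hx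
    rw [RCLike.inner_apply, mul_comm, hx]
  have iVa : Integrable (fun x => (V x - a) * ‖u x‖ ^ 2) volume :=
    (iM.sub (iu.const_mul (a + c))).congr (Eventually.of_forall fun x => by
      simp only [Pi.sub_apply]; ring)
  refine ⟨iu, (iv.const_mul _).add iVa, ?_⟩
  have e1 : (⟪f, ψ⟫_ℂ).re = h ^ 2 * ‖η‖ ^ 2 + (⟪ψ, M ψ⟫_ℂ).re := by
    rw [← inner_conj_symm, Complex.conj_re, hw.inner_eq _ _ hw.weakDeriv, Complex.add_re,
      Complex.re_ofReal_mul]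
    congr 2
    exact inner_self_eq_norm_sq (𝕜 := ℂ) η
  rw [e1, eM, nη, nψ, ← integral_const_mul, ← integral_const_mul, ← integral_add (iv.const_mul _) iM,
    ← integral_add (g := fun x => h ^ 2 * ‖v x‖ ^ 2 + (V x - a) * ‖u x‖ ^ 2)
      (iu.const_mul _) ((iv.const_mul _).add iVa)]
  congr 1; funext x; ring

theorem IsControlled.exists_formGT {h c : ℝ} {V : ℝ → ℝ} {R M : L2Line →L[ℂ] L2Line}
    {T : L2Line →ₗ.[ℂ] L2Line} (hT : IsShiftedInverse T c R)
    (hM : IsMulOp (fun x => V x + c) M) (hR : ∀ f, ∃ η u v, IsWeakSolution h M f (R f) η u v)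
    {a α β : ℝ} {k : ℕ} (hk : IsControlled h V a α β k) (hout : ∀ x ∉ Icc α β, a < V x) :
    ∃ P : Finset ℝ, P.card ≤ k + 1 ∧ ∃ L : L2Line →ₗ[ℂ] (P → ℂ),
      IsShiftedInverse.FormGT c R L a := by
  obtain ⟨hαβ, P, hP, -, -, ε, hε, hctrl⟩ := hk
  obtain ⟨L, hL⟩ := exists_linearMap_eval (R := R) (fun f => by
    obtain ⟨η, u, v, hw⟩ := hR f
    exact ⟨u, continuous_iff_continuousAt.2 fun x => (hw.hasDerivAt x).continuousAt, hw.ae_eq⟩) P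
  refine ⟨P, hP, L, fun f hf hf0 => ?_⟩
  obtain ⟨η, u, v, hw⟩ := hR f
  have huc : Continuous u := continuous_iff_continuousAt.2 fun x => (hw.hasDerivAt x).continuousAt
  obtain ⟨iu, ie, he⟩ := hw.re_inner_eq hM a
  rw [he]
  have hzero : ∀ p ∈ P, u p = 0 := fun p hp => by
    rw [← hL f u huc hw.ae_eq ⟨p, hp⟩, hf]; rfl
  have hin := hctrl u v hw.hasDerivAt hw.continuous hzero
  rw [intervalIntegral.integral_of_le hαβ, intervalIntegral.integral_of_le hαβ,
    ← integral_Icc_eq_integral_Ioc, ← integral_Icc_eq_integral_Ioc, ← integral_const_mul] at hin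
  have hsplit := integral_add_compl (measurableSet_Icc (a := α) (b := β)) ie
  have hnn : ∀ x ∈ (Icc α β)ᶜ, 0 ≤ h ^ 2 * ‖v x‖ ^ 2 + (V x - a) * ‖u x‖ ^ 2 := by
    intro x hx
    have := hout x hx
    have h1 : 0 ≤ V x - a := by linarith
    positivity
  have p1 : 0 ≤ ∫ x in Icc α β, ε * ‖u x‖ ^ 2 :=
    setIntegral_nonneg measurableSet_Icc fun x _ => by positivity
  have p2 : 0 ≤ ∫ x in (Icc α β)ᶜ, (h ^ 2 * ‖v x‖ ^ 2 + (V x - a) * ‖u x‖ ^ 2) :=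
    setIntegral_nonneg measurableSet_Icc.compl hnn
  -- Equality would force `u = 0` inside `[α, β]` because `ε > 0`, and outside because `V > a`; then
  -- `R f = 0` and so `f = 0`.
  suffices hne : ∫ x, (h ^ 2 * ‖v x‖ ^ 2 + (V x - a) * ‖u x‖ ^ 2) ≠ 0 by
    have : 0 < ∫ x, (h ^ 2 * ‖v x‖ ^ 2 + (V x - a) * ‖u x‖ ^ 2) :=
      lt_of_le_of_ne (by linarith) hne.symm
    linarith
  intro hz
  have z1 : ∫ x in Icc α β, ε * ‖u x‖ ^ 2 = 0 := by linarith
  have z2 : ∫ x in (Icc α β)ᶜ, (h ^ 2 * ‖v x‖ ^ 2 + (V x - a) * ‖u x‖ ^ 2) = 0 := by linarith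
  rw [setIntegral_eq_zero_iff_of_nonneg_ae (Eventually.of_forall fun x => by
    simp only [Pi.zero_apply]; positivity) (iu.const_mul ε).integrableOn] at z1
  rw [setIntegral_eq_zero_iff_of_nonneg_ae ((ae_restrict_iff' measurableSet_Icc.compl).2
    (Eventually.of_forall hnn)) ie.integrableOn] at z2
  have hu0 : u =ᵐ[volume] 0 := by
    filter_upwards [(ae_restrict_iff' measurableSet_Icc).1 z1,
      (ae_restrict_iff' measurableSet_Icc.compl).1 z2] with x h1 h2
    by_cases hx : x ∈ Icc α β
    · have := h1 hx
      simpa [hε.ne'] using this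
    · have h3 := h2 hx
      have h4 := hout x hx
      have h5 : 0 < V x - a := by linarith
      simp only [Pi.zero_apply] at h3
      have h6 : 0 ≤ h ^ 2 * ‖v x‖ ^ 2 := by positivity
      have h7 : 0 ≤ (V x - a) * ‖u x‖ ^ 2 := by positivity
      have h8 : (V x - a) * ‖u x‖ ^ 2 = 0 := by linarith
      simpa [h5.ne'] using h8
  exact hf0 (hT.eq_zero (Lp.eq_zero_iff_ae_eq_zero.2 (hw.ae_eq.trans hu0)))

end UpperBound

/-! ### Lower bound: trial functions -/

section LowerBound

open scoped InnerProductSpace ComplexConjugate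
open Set

theorem IsWeakDeriv.zero : IsWeakDeriv 0 0 := by
  refine ⟨0, Lp.coeFn_zero _ _ _, fun a b => ?_⟩
  rw [intervalIntegral.integral_congr_ae (g := fun _ => (0 : ℂ))]
  · simp
  · filter_upwards [Lp.coeFn_zero ℂ 2 (volume : Measure ℝ)] with t ht _
    rw [ht]; rfl

theorem IsWeakDeriv.add {ψ₁ ψ₂ η₁ η₂ : L2Line} (h₁ : IsWeakDeriv ψ₁ η₁)
    (h₂ : IsWeakDeriv ψ₂ η₂) : IsWeakDeriv (ψ₁ + ψ₂) (η₁ + η₂) := by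
  obtain ⟨u₁, e₁, i₁⟩ := h₁
  obtain ⟨u₂, e₂, i₂⟩ := h₂
  refine ⟨u₁ + u₂, (Lp.coeFn_add _ _).trans (e₁.add e₂), fun a b => ?_⟩
  rw [intervalIntegral.integral_congr_ae (g := fun t => (η₁ : ℝ → ℂ) t + (η₂ : ℝ → ℂ) t),
    intervalIntegral.integral_add (L2Line.intervalIntegrable _ _ _)
    (L2Line.intervalIntegrable _ _ _), ← i₁, ← i₂]
  · simp only [Pi.add_apply]; ring
  · filter_upwards [Lp.coeFn_add η₁ η₂] with t ht _
    simpa using ht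

theorem IsWeakDeriv.smul (z : ℂ) {ψ η : L2Line} (h₁ : IsWeakDeriv ψ η) :
    IsWeakDeriv (z • ψ) (z • η) := by
  obtain ⟨u, e, i⟩ := h₁
  refine ⟨z • u, (Lp.coeFn_smul _ _).trans (e.const_smul z), fun a b => ?_⟩
  rw [intervalIntegral.integral_congr_ae (g := fun t => z • (η : ℝ → ℂ) t),
    intervalIntegral.integral_smul, ← i]
  · simp only [Pi.smul_apply, smul_sub]
  · filter_upwards [Lp.coeFn_smul z η] with t ht _
    simpa using ht

theorem IsWeakDeriv.sum {ι : Type*} (s : Finset ι) {ψ η : ι → L2Line}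
    (h : ∀ i, IsWeakDeriv (ψ i) (η i)) : IsWeakDeriv (∑ i ∈ s, ψ i) (∑ i ∈ s, η i) := by
  classical
  induction s using Finset.induction_on with
  | empty => simpa using IsWeakDeriv.zero
  | insert i s hi ih => rw [Finset.sum_insert hi, Finset.sum_insert hi]; exact (h i).add ih

/-- A trial function of energy less than `t` forces the quadratic form of the resolvent to exceed
`1 / t` on it. -/
theorem IsWeakSolution.norm_sq_lt {h t : ℝ} {U : ℝ → ℝ} {M : L2Line →L[ℂ] L2Line}
    (hM : IsMulOp U M) (hU : ∀ x, 0 ≤ U x) {f θ ψ η : L2Line} {u v : ℝ → ℂ}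
    (hw : IsWeakSolution h M f ψ η u v) (hθ : IsWeakDeriv f θ) (ht : 0 < t)
    (hlt : h ^ 2 * ‖θ‖ ^ 2 + (⟪f, M f⟫_ℂ).re < t * ‖f‖ ^ 2) :
    ‖f‖ ^ 2 < t * (⟪f, ψ⟫_ℂ).re := by
  have e1 := congrArg Complex.re (hw.inner_eq f θ hθ)
  have e2 := congrArg Complex.re (hw.inner_eq ψ η hw.weakDeriv)
  rw [Complex.add_re, Complex.re_ofReal_mul] at e1 e2
  have n1 : (⟪f, f⟫_ℂ).re = ‖f‖ ^ 2 := inner_self_eq_norm_sq (𝕜 := ℂ) f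
  have n2 : (⟪η, η⟫_ℂ).re = ‖η‖ ^ 2 := inner_self_eq_norm_sq (𝕜 := ℂ) η
  have e3 : (⟪ψ, f⟫_ℂ).re = (⟪f, ψ⟫_ℂ).re := by rw [← inner_conj_symm, Complex.conj_re]
  have e4 : (⟪ψ, M f⟫_ℂ).re = (⟪f, M ψ⟫_ℂ).re := by
    rw [← hM.symm, ← inner_conj_symm, Complex.conj_re]
  -- With `q` the form and `ψ` the solution for `f`, expanding `q(f - t ψ) ≥ 0` gives `q(f) - 2t
  -- ‖f‖² + t² ⟪f, ψ⟫ ≥ 0`. Only `H¹` regularity of `f` enters, which the truncated sines have.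
  have p1 := hM.re_inner_ge hU (f - (t : ℂ) • ψ)
  have p2 : 0 ≤ h ^ 2 * ‖θ - (t : ℂ) • η‖ ^ 2 := by positivity
  have x1 : ‖θ - (t : ℂ) • η‖ ^ 2 = ‖θ‖ ^ 2 - 2 * t * (⟪θ, η⟫_ℂ).re + t ^ 2 * ‖η‖ ^ 2 := by
    rw [norm_sub_sq (𝕜 := ℂ), inner_smul_right, norm_smul, Complex.norm_real, mul_pow,
      Real.norm_eq_abs, sq_abs]
    have : RCLike.re ((t : ℂ) * ⟪θ, η⟫_ℂ) = t * (⟪θ, η⟫_ℂ).re := Complex.re_ofReal_mul _ _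
    rw [this]; ring
  have x2 : (⟪f - (t : ℂ) • ψ, M (f - (t : ℂ) • ψ)⟫_ℂ).re
      = (⟪f, M f⟫_ℂ).re - 2 * t * (⟪f, M ψ⟫_ℂ).re + t ^ 2 * (⟪ψ, M ψ⟫_ℂ).re := by
    rw [map_sub, map_smul, inner_sub_left, inner_sub_right, inner_sub_right, inner_smul_left,
      inner_smul_left, inner_smul_right, inner_smul_right, Complex.conj_ofReal]
    simp only [Complex.sub_re, Complex.re_ofReal_mul]
    rw [e4]; ring
  rw [x1] at p2
  rw [x2, zero_mul] at p1
  rw [n1] at e1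
  rw [n2, e3] at e2
  have key : 0 ≤ (h ^ 2 * ‖θ‖ ^ 2 + (⟪f, M f⟫_ℂ).re) - 2 * t * ‖f‖ ^ 2
      + t ^ 2 * (⟪f, ψ⟫_ℂ).re := by
    rw [e1, e2]; linarith
  have : 0 < t * (t * (⟪f, ψ⟫_ℂ).re - ‖f‖ ^ 2) := by nlinarith
  have := (pos_iff_pos_of_mul_pos this).1 ht
  linarith

/-- The half period sine on `(α, β)`, extended by zero, is a function of `H¹(ℝ)`. -/
theorem exists_isWeakDeriv_sin {α β : ℝ} (hαβ : α < β) :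
    ∃ φ θ : L2Line, IsWeakDeriv φ θ ∧
      (φ : ℝ → ℂ) =ᵐ[volume] (Ioo α β).indicator
        (fun x => ((Real.sin (Real.pi / (β - α) * (x - α)) : ℝ) : ℂ)) ∧
      (θ : ℝ → ℂ) =ᵐ[volume] (Ioo α β).indicator (fun x =>
        ((Real.pi / (β - α) * Real.cos (Real.pi / (β - α) * (x - α)) : ℝ) : ℂ)) := by
  set ω := Real.pi / (β - α) with hω
  have hωs : ω * (β - α) = Real.pi := by
    rw [hω]; field_simp [(sub_pos.2 hαβ).ne']
  have hmem : ∀ w : ℝ → ℂ, Continuous w → MemLp ((Ioo α β).indicator w) 2 volume := by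
    intro w hw
    rw [memLp_indicator_iff_restrict measurableSet_Ioo]
    obtain ⟨C, hC⟩ := isCompact_Icc.exists_bound_of_continuousOn (s := Icc α β) hw.continuousOn
    exact MemLp.of_bound hw.aestronglyMeasurable C ((ae_restrict_iff' measurableSet_Ioo).2
      (Eventually.of_forall fun x hx => hC x (Ioo_subset_Icc_self hx)))
  set s : ℝ → ℂ := fun x => ((Real.sin (ω * (x - α)) : ℝ) : ℂ) with hs
  set k : ℝ → ℂ := fun x => ((ω * Real.cos (ω * (x - α)) : ℝ) : ℂ) with hk
  have hsc : Continuous s := by fun_prop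
  have hkc : Continuous k := by fun_prop
  have ms := hmem s hsc
  have mk := hmem k hkc
  refine ⟨ms.toLp _, mk.toLp _, ⟨(Ioo α β).indicator s, ms.coeFn_toLp, fun a b => ?_⟩,
    ms.coeFn_toLp, mk.coeFn_toLp⟩
  rw [intervalIntegral.integral_congr_ae (g := (Ioo α β).indicator k) (by
    filter_upwards [mk.coeFn_toLp] with t ht _
    exact ht)]
  have hcont : Continuous ((Ioo α β).indicator s) := by
    refine continuous_indicator (fun x hx => ?_) hsc.continuousOn
    rw [frontier_Ioo hαβ] at hx
    rcases hx with rfl | rfl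
    · simp [hs]
    · simp only [hs, hωs, Real.sin_pi, Complex.ofReal_zero]
  symm
  refine integral_eq_of_hasDerivAt_off_countable _ _ (s := {α, β}) (by simp) hcont.continuousOn
    (fun x hx => ?_) ?_
  · have hx2 : x ≠ α ∧ x ≠ β := by simpa using hx.2
    by_cases hin : x ∈ Ioo α β
    · have hd : HasDerivAt s (k x) x := by
        have h1 : HasDerivAt (fun x : ℝ => ω * (x - α)) (ω * 1) x :=
          ((hasDerivAt_id x).sub_const _).const_mul ω
        have h2 := h1.sin.ofReal_comp
        refine h2.congr_deriv ?_
        simp only [hk]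
        push_cast; ring
      rw [indicator_of_mem hin]
      refine hd.congr_of_eventuallyEq ?_
      filter_upwards [isOpen_Ioo.mem_nhds hin] with y hy
      rw [indicator_of_mem hy]
    · rw [indicator_of_notMem hin]
      have hout : x ∈ (Icc α β)ᶜ := fun hc => hin
        ⟨lt_of_le_of_ne hc.1 hx2.1.symm, lt_of_le_of_ne hc.2 hx2.2⟩
      refine (hasDerivAt_const x (0 : ℂ)).congr_of_eventuallyEq ?_
      filter_upwards [isClosed_Icc.isOpen_compl.mem_nhds hout] with y hy
      rw [indicator_of_notMem fun hc => hy (Ioo_subset_Icc_self hc)]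
  · exact (mk.locallyIntegrable (by norm_num)).integrableOn_isCompact isCompact_uIcc
      |>.intervalIntegrable

/-- The energy of the half period sine. -/
theorem energy_sin_neg {h a M₀ α β : ℝ} {V : ℝ → ℝ} (hV : Measurable V) {C : ℝ}
    (hC : ∀ x, |V x| ≤ C) (hαβ : α < β) (hM₀ : ∀ x ∈ Ioo α β, V x ≤ M₀)
    (hs : h ^ 2 * Real.pi ^ 2 < (β - α) ^ 2 * (a - M₀)) :
    ∫ x in α..β, (h ^ 2 * (Real.pi / (β - α) * Real.cos (Real.pi / (β - α) * (x - α))) ^ 2 +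
      (V x - a) * Real.sin (Real.pi / (β - α) * (x - α)) ^ 2) < 0 := by
  have hs0 : 0 < β - α := sub_pos.2 hαβ
  set ω := Real.pi / (β - α) with hω
  have hωs : ω * (β - α) = Real.pi := by
    rw [hω]; field_simp
  have hω0 : 0 < ω := by have := Real.pi_pos; positivity
  have hneg : h ^ 2 * ω ^ 2 + (M₀ - a) < 0 := by
    have : (β - α) ^ 2 * (h ^ 2 * ω ^ 2) < (β - α) ^ 2 * (a - M₀) := by
      calc _ = h ^ 2 * (ω * (β - α)) ^ 2 := by ring
        _ < _ := by rw [hωs]; exact hs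
    have := lt_of_mul_lt_mul_left this (by positivity)
    linarith
  have hci : ∀ w : ℝ → ℝ, Continuous w → IntervalIntegrable w volume α β := fun w hw =>
    hw.intervalIntegrable _ _
  -- The integrand is the derivative of `sin · cos`, which vanishes at both ends. So `cos²` and
  -- `sin²` have the same integral, and the energy is a multiple of `h² ω² + M₀ - a`.
  have hdiff : ∫ x in α..β, ω * (Real.cos (ω * (x - α)) ^ 2 - Real.sin (ω * (x - α)) ^ 2) = 0 := by
    have hd : ∀ x ∈ uIcc α β, HasDerivAt (fun x => Real.sin (ω * (x - α)) * Real.cos (ω * (x - α)))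
        (ω * (Real.cos (ω * (x - α)) ^ 2 - Real.sin (ω * (x - α)) ^ 2)) x := by
      intro x _
      have h1 : HasDerivAt (fun x : ℝ => ω * (x - α)) (ω * 1) x :=
        ((hasDerivAt_id x).sub_const _).const_mul ω
      refine (h1.sin.mul h1.cos).congr_deriv ?_
      ring
    rw [intervalIntegral.integral_eq_sub_of_hasDerivAt hd (hci _ (by fun_prop))]
    simp [hωs]
  set S := ∫ x in α..β, Real.sin (ω * (x - α)) ^ 2 with hS
  set K := ∫ x in α..β, Real.cos (ω * (x - α)) ^ 2 with hK
  have hKS : K = S := by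
    rw [intervalIntegral.integral_const_mul, intervalIntegral.integral_sub
      (hci _ (by fun_prop)) (hci _ (by fun_prop))] at hdiff
    rcases mul_eq_zero.1 hdiff with h0 | h0
    · exact absurd h0 hω0.ne'
    · linarith
  have hsum : S + K = β - α := by
    rw [hS, hK, ← intervalIntegral.integral_add (hci _ (by fun_prop)) (hci _ (by fun_prop))]
    simp
  have hSpos : 0 < S := by linarith
  have hVi : IntervalIntegrable (fun x => (V x - a) * Real.sin (ω * (x - α)) ^ 2) volume α β :=
    intervalIntegrable_mul_bounded (V := fun x => V x - a) (by fun_prop) (C := C + |a|)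
      (fun x => (abs_sub _ _).trans (by gcongr; exact hC x)) (by fun_prop) _ _
  calc _ ≤ ∫ x in α..β, (h ^ 2 * ω ^ 2 * Real.cos (ω * (x - α)) ^ 2
        + (M₀ - a) * Real.sin (ω * (x - α)) ^ 2) := by
        refine intervalIntegral.integral_mono_on_of_le_Ioo hαβ.le
          (IntervalIntegrable.add (hci _ (by fun_prop)) hVi) (hci _ (by fun_prop)) fun x hx => ?_
        have := hM₀ x hx
        have h2 : h ^ 2 * (ω * Real.cos (ω * (x - α))) ^ 2
            = h ^ 2 * ω ^ 2 * Real.cos (ω * (x - α)) ^ 2 := by ring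
        rw [h2]
        gcongr
    _ = (h ^ 2 * ω ^ 2 + (M₀ - a)) * S := by
        rw [intervalIntegral.integral_add (hci _ (by fun_prop)) (hci _ (by fun_prop)),
          intervalIntegral.integral_const_mul, intervalIntegral.integral_const_mul, ← hS, ← hK, hKS]
        ring
    _ < 0 := mul_neg_of_neg_of_pos hneg hSpos

/-- The interval `(p.1, p.2)` carries a Dirichlet eigenvalue below `a`. -/
def IsTrial (h : ℝ) (V : ℝ → ℝ) (a : ℝ) (p : ℝ × ℝ) : Prop :=
  p.1 < p.2 ∧ ∃ m, (∀ x ∈ Ioo p.1 p.2, V x ≤ m) ∧ h ^ 2 * Real.pi ^ 2 < (p.2 - p.1) ^ 2 * (a - m)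

theorem IsTrial.exists_energy_neg {h a c : ℝ} {V : ℝ → ℝ} (hV : Measurable V) {C : ℝ}
    (hC : ∀ x, |V x| ≤ C) {M : L2Line →L[ℂ] L2Line} (hM : IsMulOp (fun x => V x + c) M)
    {p : ℝ × ℝ} (hp : IsTrial h V a p) :
    ∃ φ θ : L2Line, IsWeakDeriv φ θ ∧
      (∀ᵐ x, x ∉ Ioo p.1 p.2 → (φ : ℝ → ℂ) x = 0) ∧ (∀ᵐ x, x ∉ Ioo p.1 p.2 → (θ : ℝ → ℂ) x = 0) ∧
      h ^ 2 * ‖θ‖ ^ 2 + (⟪φ, M φ⟫_ℂ).re < (a + c) * ‖φ‖ ^ 2 := by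
  obtain ⟨hlt, m, hm, hs⟩ := hp
  obtain ⟨φ, θ, hw, hφ, hθ⟩ := exists_isWeakDeriv_sin hlt
  refine ⟨φ, θ, hw, ?_, ?_, ?_⟩
  · filter_upwards [hφ] with x hx hn
    rw [hx, indicator_of_notMem hn]
  · filter_upwards [hθ] with x hx hn
    rw [hx, indicator_of_notMem hn]
  have hE := energy_sin_neg hV hC hlt hm hs
  set ω := Real.pi / (p.2 - p.1) with hω
  have hset : ∀ (w : ℝ → ℝ), ∫ x in p.1..p.2, w x = ∫ x, (Ioo p.1 p.2).indicator w x := by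
    intro w
    rw [intervalIntegral.integral_of_le hlt.le, integral_Ioc_eq_integral_Ioo,
      integral_indicator measurableSet_Ioo]
  have hci : ∀ w : ℝ → ℝ, Continuous w → IntervalIntegrable w volume p.1 p.2 := fun w hw =>
    hw.intervalIntegrable _ _
  have e1 : ‖θ‖ ^ 2 = ∫ x in p.1..p.2, (ω * Real.cos (ω * (x - p.1))) ^ 2 := by
    rw [L2Line.norm_sq_eq, hset]
    refine integral_congr_ae ?_
    filter_upwards [hθ] with x hx
    rw [hx]
    simp only [indicator_apply]
    split_ifs
    · rw [Complex.norm_real, Real.norm_eq_abs, sq_abs]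
    · simp
  have e2 : ‖φ‖ ^ 2 = ∫ x in p.1..p.2, Real.sin (ω * (x - p.1)) ^ 2 := by
    rw [L2Line.norm_sq_eq, hset]
    refine integral_congr_ae ?_
    filter_upwards [hφ] with x hx
    rw [hx]
    simp only [indicator_apply]
    split_ifs
    · rw [Complex.norm_real, Real.norm_eq_abs, sq_abs]
    · simp
  have e3 : (⟪φ, M φ⟫_ℂ).re = ∫ x in p.1..p.2, (V x + c) * Real.sin (ω * (x - p.1)) ^ 2 := by
    rw [hM.inner_eq, hset, ← Complex.ofReal_re (∫ x, _), ← integral_complex_ofReal]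
    congr 1
    refine integral_congr_ae ?_
    filter_upwards [hφ] with x hx
    rw [hx]
    simp only [indicator_apply]
    split_ifs
    · rw [Complex.conj_ofReal]; push_cast; ring
    · simp
  have hVi : ∀ b : ℝ, IntervalIntegrable (fun x => (V x + b) * Real.sin (ω * (x - p.1)) ^ 2)
      volume p.1 p.2 := fun b =>
    intervalIntegrable_mul_bounded (V := fun x => V x + b) (by fun_prop) (C := C + |b|)
      (fun x => (abs_add_le _ _).trans (by gcongr; exact hC x)) (by fun_prop) _ _
  rw [e1, e2, e3, ← intervalIntegral.integral_const_mul, ← intervalIntegral.integral_const_mul,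
    ← intervalIntegral.integral_add (hci _ (by fun_prop)) (hVi c), ← sub_neg,
    ← intervalIntegral.integral_sub ((hci _ (by fun_prop)).add (hVi c)) (hci _ (by fun_prop))]
  refine lt_of_eq_of_lt ?_ hE
  congr 1; funext x; ring

theorem L2Line.inner_eq_zero_of_disjoint {φ ψ : L2Line} {A B : Set ℝ} (hAB : Disjoint A B)
    (hφ : ∀ᵐ x, x ∉ A → (φ : ℝ → ℂ) x = 0) (hψ : ∀ᵐ x, x ∉ B → (ψ : ℝ → ℂ) x = 0) :
    ⟪φ, ψ⟫_ℂ = 0 := by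
  rw [L2.inner_def]
  refine integral_eq_zero_of_ae ?_
  filter_upwards [hφ, hψ] with x h1 h2
  by_cases hx : x ∈ A
  · rw [h2 (hAB.notMem_of_mem_left hx)]; simp
  · rw [h1 hx]; simp

/-- Disjoint supports make the trial functions orthogonal in `L²`, in the kinetic and in the
potential term at once. The form is diagonal on their span, so it is below `(a + c) ‖·‖²` on every
nonzero combination. -/
theorem card_le_of_isTrial {h a b c : ℝ} {V : ℝ → ℝ} (hV : Measurable V) {C : ℝ}
    (hC : ∀ x, |V x| ≤ C) (hVc : ∀ x, 0 ≤ V x + c) {R M : L2Line →L[ℂ] L2Line}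
    {T : L2Line →ₗ.[ℂ] L2Line} (hT : IsShiftedInverse T c R)
    (hM : IsMulOp (fun x => V x + c) M) (hR : ∀ f, ∃ η u v, IsWeakSolution h M f (R f) η u v)
    (ha : 0 < a + c) (hab : a < b) {F : Type*} [AddCommGroup F] [Module ℂ F]
    [FiniteDimensional ℂ F] {L : L2Line →ₗ[ℂ] F} (hL : IsShiftedInverse.FormGT c R L b)
    (Q : Finset (ℝ × ℝ)) (hQ : ∀ p ∈ Q, IsTrial h V a p)
    (hdisj : (Q : Set (ℝ × ℝ)).PairwiseDisjoint fun p => Ioo p.1 p.2) :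
    Q.card ≤ (countingFunction T a).toNat := by
  have hex := fun p : Q => (hQ p p.2).exists_energy_neg hV hC hM
  choose φ θ hw hφ hθ hE using hex
  have hdis : ∀ p q : Q, p ≠ q →
      Disjoint (Ioo (p : ℝ × ℝ).1 (p : ℝ × ℝ).2) (Ioo (q : ℝ × ℝ).1 (q : ℝ × ℝ).2) :=
    fun p q hpq => hdisj p.2 q.2 fun e => hpq (Subtype.ext e)
  have hMφ : ∀ p : Q, ∀ᵐ x, x ∉ Ioo (p : ℝ × ℝ).1 (p : ℝ × ℝ).2 → (M (φ p) : ℝ → ℂ) x = 0 := by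
    intro p
    filter_upwards [hφ p, hM (φ p)] with x h1 h2 hx
    rw [h2, h1 hx, mul_zero]
  have expand : ∀ (x : Q → ℂ) (α β : Q → L2Line), (∀ p q, p ≠ q → ⟪α p, β q⟫_ℂ = 0) →
      (⟪∑ p, x p • α p, ∑ p, x p • β p⟫_ℂ).re = ∑ p, ‖x p‖ ^ 2 * (⟪α p, β p⟫_ℂ).re := by
    intro x α β h0
    rw [sum_inner, Complex.re_sum]
    refine Finset.sum_congr rfl fun p _ => ?_
    rw [inner_sum, Finset.sum_eq_single p]
    · rw [inner_smul_left, inner_smul_right, ← mul_assoc, Complex.conj_mul',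
        ← Complex.ofReal_pow, Complex.re_ofReal_mul]
    · intro q _ hq
      rw [inner_smul_left, inner_smul_right, h0 p q hq.symm]; simp
    · simp
  let Φ : (Q → ℂ) →ₗ[ℂ] L2Line := Fintype.linearCombination ℂ φ
  have hΦ : ∀ x, Φ x = ∑ p, x p • φ p := fun x => Fintype.linearCombination_apply ℂ φ x
  rw [← Fintype.card_coe]
  refine hT.card_le_toNat_countingFunction ha hab hL Φ fun x hx => ?_
  obtain ⟨η, u, v, hsol⟩ := hR (Φ x)
  have hwd : IsWeakDeriv (Φ x) (∑ p, x p • θ p) := by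
    rw [hΦ]
    exact IsWeakDeriv.sum _ fun p => (hw p).smul (x p)
  refine hsol.norm_sq_lt hM hVc hwd ha ?_
  have nsq : ∀ f : L2Line, ‖f‖ ^ 2 = (⟪f, f⟫_ℂ).re := fun f =>
    (inner_self_eq_norm_sq (𝕜 := ℂ) f).symm
  have hMΦ : M (Φ x) = ∑ p, x p • M (φ p) := by simp [hΦ, map_sum]
  rw [nsq (Φ x), nsq (∑ p, x p • θ p), hMΦ, hΦ,
    expand x θ θ fun p q hpq => L2Line.inner_eq_zero_of_disjoint (hdis p q hpq) (hθ p) (hθ q),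
    expand x φ φ fun p q hpq => L2Line.inner_eq_zero_of_disjoint (hdis p q hpq) (hφ p) (hφ q),
    expand x φ (fun p => M (φ p)) fun p q hpq =>
      L2Line.inner_eq_zero_of_disjoint (hdis p q hpq) (hφ p) (hMφ q),
    Finset.mul_sum, Finset.mul_sum, ← Finset.sum_add_distrib]
  obtain ⟨p₀, hp₀⟩ := Function.ne_iff.1 hx
  have hterm : ∀ p, h ^ 2 * (⟪θ p, θ p⟫_ℂ).re + (⟪φ p, M (φ p)⟫_ℂ).re
      < (a + c) * (⟪φ p, φ p⟫_ℂ).re := by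
    intro p
    rw [← nsq, ← nsq]; exact hE p
  refine Finset.sum_lt_sum (fun p _ => ?_) ⟨p₀, Finset.mem_univ _, ?_⟩
  · have := hterm p
    have h2 : 0 ≤ ‖x p‖ ^ 2 := by positivity
    nlinarith
  · have := hterm p₀
    have h2 : 0 < ‖x p₀‖ ^ 2 := by
      have := norm_pos_iff.2 hp₀
      positivity
    nlinarith

end LowerBound

/-! ### Cell counts and the phase space integral -/

section Packing

open Set

/-- `(α, β)` contains `k` disjoint intervals that carry a Dirichlet eigenvalue below `a`. -/
def IsPacked (h : ℝ) (V : ℝ → ℝ) (a α β : ℝ) (k : ℕ) : Prop :=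
  ∃ Q : Finset (ℝ × ℝ), Q.card = k ∧ (∀ p ∈ Q, IsTrial h V a p ∧ α ≤ p.1 ∧ p.2 ≤ β) ∧
    (Q : Set (ℝ × ℝ)).PairwiseDisjoint fun p => Ioo p.1 p.2

theorem IsPacked.empty (h : ℝ) (V : ℝ → ℝ) (a α β : ℝ) : IsPacked h V a α β 0 :=
  ⟨∅, rfl, by simp, by simp⟩

theorem IsPacked.trans {h : ℝ} {V : ℝ → ℝ} {a α β γ : ℝ} {k l : ℕ} (hαβ : α ≤ β) (hβγ : β ≤ γ)
    (h₁ : IsPacked h V a α β k) (h₂ : IsPacked h V a β γ l) : IsPacked h V a α γ (k + l) := by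
  classical
  obtain ⟨P, rfl, hP, dP⟩ := h₁
  obtain ⟨Q, rfl, hQ, dQ⟩ := h₂
  have hPQ : ∀ p ∈ P, ∀ q ∈ Q, Disjoint (Ioo p.1 p.2) (Ioo q.1 q.2) := by
    intro p hp q hq
    rw [Set.disjoint_left]
    intro x hx hx'
    have h1 := (hP p hp).2.2
    have h2 := (hQ q hq).2.1
    linarith [hx.2, hx'.1]
  refine ⟨P ∪ Q, Finset.card_union_of_disjoint ?_, ?_, ?_⟩
  · rw [Finset.disjoint_left]
    intro p hp hq
    have h1 := hPQ p hp p hq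
    rw [disjoint_self, bot_eq_empty, Ioo_eq_empty_iff] at h1
    exact h1 (hP p hp).1.1
  · intro p hp
    rcases Finset.mem_union.1 hp with hp | hp
    · obtain ⟨h1, h2, h3⟩ := hP p hp
      exact ⟨h1, h2, h3.trans hβγ⟩
    · obtain ⟨h1, h2, h3⟩ := hQ p hp
      exact ⟨h1, hαβ.trans h2, h3⟩
  · rw [Finset.coe_union]
    exact dP.union dQ fun p hp q hq _ => hPQ p hp q hq

theorem IsControlled.of_le {h : ℝ} (hh : 0 < h) {V : ℝ → ℝ} (hV : Measurable V) {C : ℝ}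
    (hC : ∀ x, |V x| ≤ C) {a α m s : ℝ} (hs : 0 ≤ s)
    (hsa : s ^ 2 * (a - m) < h ^ 2 * Real.pi ^ 2) (k : ℕ)
    (hm : ∀ x ∈ Ioo α (α + k * s), m ≤ V x) : IsControlled h V a α (α + k * s) k := by
  induction k with
  | zero => simpa using IsControlled.refl h V a α
  | succ k ih =>
    push_cast at hm ⊢
    have h1 : α + k * s ≤ α + (k + 1) * s := by nlinarith
    have h2 : α ≤ α + k * s := by have : 0 ≤ k * s := by positivity
                                  linarith
    refine (ih fun x hx => hm x ⟨hx.1, hx.2.trans_le h1⟩).trans hV hC ?_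
    refine IsControlled.single hh hV hC h1 (fun x hx => hm x ⟨h2.trans_lt hx.1, hx.2⟩) ?_
    have : α + (k + 1) * s - (α + k * s) = s := by ring
    rw [this]; exact hsa

theorem IsPacked.of_le {h : ℝ} {V : ℝ → ℝ} {a α m s : ℝ} (hs : 0 < s)
    (hsa : h ^ 2 * Real.pi ^ 2 < s ^ 2 * (a - m)) (k : ℕ)
    (hm : ∀ x ∈ Ioo α (α + k * s), V x ≤ m) : IsPacked h V a α (α + k * s) k := by
  induction k with
  | zero => exact IsPacked.empty h V a _ _
  | succ k ih =>
    push_cast at hm ⊢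
    have h1 : α + k * s < α + (k + 1) * s := by nlinarith
    have h2 : α ≤ α + k * s := by have : 0 ≤ k * s := by positivity
                                  linarith
    refine (ih fun x hx => hm x ⟨hx.1, hx.2.trans h1⟩).trans h2 h1.le
      ⟨{(α + k * s, α + (k + 1) * s)}, by simp, ?_, by simp⟩
    simp only [Finset.mem_singleton, forall_eq, le_refl, and_self, and_true]
    refine ⟨h1, m, fun x hx => hm x ⟨h2.trans_lt hx.1, hx.2⟩, ?_⟩
    have : α + (k + 1) * s - (α + k * s) = s := by ring
    simp only [this]; exact hsa

/-- The classical momentum `√(a - V)₊`. -/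
noncomputable def momentum (V : ℝ → ℝ) (a x : ℝ) : ℝ := Real.sqrt (max (a - V x) 0)

theorem momentum_nonneg (V : ℝ → ℝ) (a x : ℝ) : 0 ≤ momentum V a x := Real.sqrt_nonneg _

theorem measurable_momentum {V : ℝ → ℝ} (hV : Measurable V) (a : ℝ) :
    Measurable (momentum V a) := by
  unfold momentum; fun_prop

theorem momentum_le {V : ℝ → ℝ} {C : ℝ} (hC : ∀ x, |V x| ≤ C) (a x : ℝ) :
    momentum V a x ≤ Real.sqrt (|a| + C) := by
  refine Real.sqrt_le_sqrt (max_le ?_ ?_)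
  · have := (abs_le.1 (hC x)).1
    linarith [le_abs_self a]
  · linarith [abs_nonneg a, (abs_nonneg _).trans (hC x)]

theorem intervalIntegrable_momentum {V : ℝ → ℝ} (hV : Measurable V) {C : ℝ}
    (hC : ∀ x, |V x| ≤ C) (a α β : ℝ) : IntervalIntegrable (momentum V a) volume α β := by
  refine IntervalIntegrable.mono_fun (f := fun _ => Real.sqrt (|a| + C)) (by simp)
    (measurable_momentum hV a).aestronglyMeasurable (Eventually.of_forall fun x => ?_)
  have h1 : ‖momentum V a x‖ = momentum V a x := Real.norm_of_nonneg (momentum_nonneg V a x)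
  change ‖momentum V a x‖ ≤ ‖Real.sqrt (|a| + C)‖
  rw [h1, Real.norm_of_nonneg (Real.sqrt_nonneg _)]
  exact momentum_le hC a x

/-- The upper and lower counts on `[α, β]` agree with the phase space volume up to `e`. -/
def HasCounts (h : ℝ) (V : ℝ → ℝ) (a α β e : ℝ) : Prop :=
  ∃ k l : ℕ, IsControlled h V a α β k ∧ IsPacked h V a α β l ∧
    Real.pi * h * k ≤ (∫ x in α..β, momentum V a x) + e ∧
    ∫ x in α..β, momentum V a x ≤ Real.pi * h * l + e

section

variable {h : ℝ} {V : ℝ → ℝ} {C a α β : ℝ}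

theorem exists_isControlled_of_ge (hh : 0 < h) (hV : Measurable V) (hC : ∀ x, |V x| ≤ C)
    {m : ℝ} (hαβ : α ≤ β) (hm : ∀ x ∈ Ioo α β, m ≤ V x) :
    ∃ k : ℕ, IsControlled h V a α β k ∧
      Real.pi * h * k ≤ (β - α) * Real.sqrt (max (a - m) 0) + Real.pi * h := by
  have hπh : 0 < Real.pi * h := by have := Real.pi_pos; positivity
  set w := Real.sqrt (max (a - m) 0) with hw
  have hw0 : 0 ≤ w := Real.sqrt_nonneg _
  have hδ : 0 ≤ β - α := sub_nonneg.2 hαβ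
  set y := (β - α) * w / (Real.pi * h) with hy
  have hy0 : 0 ≤ y := by positivity
  have hyw : Real.pi * h * y = (β - α) * w := by rw [hy]; field_simp
  -- The least integer strictly above `y`: the Dirichlet condition on cells of length `(β - α) / k`
  -- has to be strict.
  refine ⟨⌊y⌋₊ + 1, ?_, ?_⟩
  · set k := ⌊y⌋₊ + 1 with hk
    have hky : y < k := by rw [hk]; push_cast; exact Nat.lt_floor_add_one y
    have hk0 : (0 : ℝ) < k := hy0.trans_lt hky
    have hks : α + k * ((β - α) / k) = β := by field_simp; ring
    have := IsControlled.of_le (a := a) (α := α) (m := m) hh hV hC (s := (β - α) / k)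
      (by positivity) ?_ k (by rwa [hks])
    · rwa [hks] at this
    · have h1 : (β - α) / k * w < Real.pi * h := by
        rw [div_mul_eq_mul_div, div_lt_iff₀ hk0, ← hyw]
        gcongr
      have h2 : ((β - α) / k * w) ^ 2 < (Real.pi * h) ^ 2 := by gcongr
      have h3 : w ^ 2 = max (a - m) 0 := Real.sq_sqrt (le_max_right _ _)
      calc ((β - α) / k) ^ 2 * (a - m) ≤ ((β - α) / k) ^ 2 * w ^ 2 := by
            rw [h3]; gcongr; exact le_max_left _ _
        _ < (Real.pi * h) ^ 2 := by rw [← mul_pow]; exact h2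
        _ = _ := by ring
  · push_cast
    have := Nat.floor_le hy0
    nlinarith

theorem exists_isPacked_of_le (hh : 0 < h) {m : ℝ} (hαβ : α ≤ β)
    (hm : ∀ x ∈ Ioo α β, V x ≤ m) :
    ∃ k : ℕ, IsPacked h V a α β k ∧
      (β - α) * Real.sqrt (max (a - m) 0) ≤ Real.pi * h * k + Real.pi * h := by
  have hπh : 0 < Real.pi * h := by have := Real.pi_pos; positivity
  set w := Real.sqrt (max (a - m) 0) with hw
  have hw0 : 0 ≤ w := Real.sqrt_nonneg _
  have hδ : 0 ≤ β - α := sub_nonneg.2 hαβ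
  set y := (β - α) * w / (Real.pi * h) with hy
  have hy0 : 0 ≤ y := by positivity
  have hyw : Real.pi * h * y = (β - α) * w := by rw [hy]; field_simp
  -- For `y > 0` the largest natural number strictly below `y`. For `y = 0` truncated subtraction
  -- gives `0`, and no interval has to be found.
  refine ⟨⌈y⌉₊ - 1, ?_, ?_⟩
  · set k := ⌈y⌉₊ - 1 with hk
    rcases Nat.eq_zero_or_pos k with h0 | h0
    · rw [h0]; exact IsPacked.empty h V a α β
    have hky : (k : ℝ) < y := by
      have h1 := Nat.ceil_lt_add_one hy0
      have h2 : k + 1 = ⌈y⌉₊ := by omega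
      rw [← h2] at h1
      push_cast at h1
      linarith
    have hk0 : (0 : ℝ) < k := by exact_mod_cast h0
    have hks : α + k * ((β - α) / k) = β := by field_simp; ring
    have h1 : Real.pi * h < (β - α) / k * w := by
      rw [div_mul_eq_mul_div, lt_div_iff₀ hk0, ← hyw]
      gcongr
    have hδ' : 0 < β - α := by
      refine lt_of_le_of_ne hδ fun h2 => ?_
      rw [← h2] at h1
      simp only [zero_div, zero_mul] at h1
      linarith
    have := IsPacked.of_le (h := h) (V := V) (a := a) (α := α) (m := m) (s := (β - α) / k)
      (by positivity) ?_ k (by rwa [hks])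
    · rwa [hks] at this
    · have h2 : (Real.pi * h) ^ 2 < ((β - α) / k * w) ^ 2 := by gcongr
      have h3 : w ^ 2 = max (a - m) 0 := Real.sq_sqrt (le_max_right _ _)
      have hw' : 0 < w := by
        refine lt_of_le_of_ne hw0 fun h4 => ?_
        rw [← h4, mul_zero] at h1
        linarith
      have h4 : w ^ 2 = a - m := by
        rw [h3]
        refine max_eq_left (le_of_not_gt fun h5 => ?_)
        rw [max_eq_right h5.le] at h3
        have : 0 < w ^ 2 := by positivity
        linarith
      rw [← h4]
      calc _ = (Real.pi * h) ^ 2 := by ring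
        _ < _ := h2
        _ = _ := by ring
  · have h1 := Nat.le_ceil y
    have h2 : (⌈y⌉₊ : ℝ) ≤ ((⌈y⌉₊ - 1 : ℕ) : ℝ) + 1 := by
      exact_mod_cast (by omega : ⌈y⌉₊ ≤ ⌈y⌉₊ - 1 + 1)
    rw [← hyw]
    nlinarith

/-- Rounding costs one `πh` in each count; replacing `V` by the constants `m` and `m'` costs `e` per
unit length of the integral. -/
theorem hasCounts_of_near (hh : 0 < h) (hV : Measurable V) (hC : ∀ x, |V x| ≤ C)
    {m m' e : ℝ} (hαβ : α ≤ β) (hm : ∀ x ∈ Ioo α β, m ≤ V x) (hm' : ∀ x ∈ Ioo α β, V x ≤ m')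
    (he : ∀ x ∈ Ioo α β, Real.sqrt (max (a - m) 0) ≤ momentum V a x + e)
    (he' : ∀ x ∈ Ioo α β, momentum V a x ≤ Real.sqrt (max (a - m') 0) + e) :
    HasCounts h V a α β ((β - α) * e + Real.pi * h) := by
  obtain ⟨k, hk, hk'⟩ := exists_isControlled_of_ge (a := a) hh hV hC hαβ hm
  obtain ⟨l, hl, hl'⟩ := exists_isPacked_of_le (a := a) hh hαβ hm'
  have hi := intervalIntegrable_momentum hV hC a α β
  have h1 : ∫ _x in α..β, (Real.sqrt (max (a - m) 0) - e) ≤ ∫ x in α..β, momentum V a x :=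
    intervalIntegral.integral_mono_on_of_le_Ioo hαβ (by simp) hi fun x hx => by
      linarith [he x hx]
  have h2 : ∫ x in α..β, momentum V a x ≤ ∫ _x in α..β, (Real.sqrt (max (a - m') 0) + e) :=
    intervalIntegral.integral_mono_on_of_le_Ioo hαβ hi (by simp) fun x hx => he' x hx
  rw [intervalIntegral.integral_const, smul_eq_mul] at h1 h2
  exact ⟨k, l, hk, hl, by linarith, by linarith⟩

theorem HasCounts.trans (hV : Measurable V) (hC : ∀ x, |V x| ≤ C) {γ e e' : ℝ}
    (h₁ : HasCounts h V a α β e) (h₂ : HasCounts h V a β γ e') :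
    HasCounts h V a α γ (e + e') := by
  obtain ⟨k, l, hk, hl, b1, b2⟩ := h₁
  obtain ⟨k', l', hk', hl', b1', b2'⟩ := h₂
  refine ⟨k + k', l + l', hk.trans hV hC hk', hl.trans hk.1 hk'.1 hl', ?_, ?_⟩
  all_goals
    rw [← intervalIntegral.integral_add_adjacent_intervals
      (intervalIntegrable_momentum hV hC a α β) (intervalIntegrable_momentum hV hC a β γ)]
    push_cast
    linarith

theorem HasCounts.mono {e e' : ℝ} (h₁ : HasCounts h V a α β e) (hee' : e ≤ e') :
    HasCounts h V a α β e' := by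
  obtain ⟨k, l, hk, hl, b1, b2⟩ := h₁
  exact ⟨k, l, hk, hl, by linarith, by linarith⟩

theorem sqrt_max_le_add {x y t : ℝ} (hxy : x ≤ y + t) (ht : 0 ≤ t) :
    Real.sqrt (max x 0) ≤ Real.sqrt (max y 0) + Real.sqrt t := by
  have h0 : 0 ≤ max y 0 := le_max_right _ _
  refine Real.sqrt_le_iff.2 ⟨by positivity, ?_⟩
  have h1 := Real.sq_sqrt h0
  have h2 := Real.sq_sqrt ht
  have h3 : 0 ≤ Real.sqrt (max y 0) * Real.sqrt t := by positivity
  refine max_le ?_ (by positivity)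
  nlinarith [le_max_left y 0]

open Classical in
theorem hasCounts_cell (hh : 0 < h) (hV : Measurable V) (hC : ∀ x, |V x| ≤ C) {S : Finset ℝ}
    {K : NNReal} (hS : ∀ I : Set ℝ, I.OrdConnected → Disjoint I (S : Set ℝ) →
      LipschitzOnWith K V I) {D : ℝ} (hD : |a| + C ≤ D) (hαβ : α ≤ β) :
    HasCounts h V a α β ((β - α) * (Real.sqrt (2 * K * (β - α))
      + Real.sqrt D * (S.filter (· ∈ Ioo α β)).card) + Real.pi * h) := by
  have hδ : 0 ≤ β - α := sub_nonneg.2 hαβ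
  -- A cell without singular points is compared with its midpoint value, and subadditivity of the
  -- square root turns `2K(β - α)` into the momentum error. Any other cell gets the crude bounds
  -- `±C`, charged to the points of `S` inside it. Only interior points matter, so adjacent cells
  -- never share one.
  rcases (S.filter (· ∈ Ioo α β)).eq_empty_or_nonempty with hemp | hne
  · rw [hemp]
    simp only [Finset.card_empty, Nat.cast_zero, mul_zero, add_zero]
    rcases hαβ.eq_or_lt with rfl | hlt
    · exact hasCounts_of_near hh hV hC le_rfl (m := 0) (m' := 0) (by simp) (by simp) (by simp)
        (by simp)
    have hdis : Disjoint (Ioo α β) (S : Set ℝ) := by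
      rw [Set.disjoint_left]
      intro x hx hxS
      have : x ∈ S.filter (· ∈ Ioo α β) := Finset.mem_filter.2 ⟨hxS, hx⟩
      rw [hemp] at this
      simp at this
    have hL := hS _ ordConnected_Ioo hdis
    set ξ := (α + β) / 2 with hξ
    have hξm : ξ ∈ Ioo α β := ⟨by linarith, by linarith⟩
    have hnear : ∀ x ∈ Ioo α β, |V x - V ξ| ≤ K * (β - α) := by
      intro x hx
      have h1 := hL.dist_le_mul x hx ξ hξm
      rw [Real.dist_eq, Real.dist_eq] at h1
      refine h1.trans ?_
      gcongr
      rw [abs_le]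
      constructor <;> linarith [hx.1, hx.2, hξm.1, hξm.2]
    have hKδ : 0 ≤ 2 * K * (β - α) := by positivity
    refine hasCounts_of_near hh hV hC hαβ (m := V ξ - K * (β - α)) (m' := V ξ + K * (β - α))
      ?_ ?_ ?_ ?_
    · intro x hx; linarith [(abs_le.1 (hnear x hx)).1]
    · intro x hx; linarith [(abs_le.1 (hnear x hx)).2]
    · intro x hx
      exact sqrt_max_le_add (by linarith [(abs_le.1 (hnear x hx)).2]) hKδ
    · intro x hx
      exact sqrt_max_le_add (by linarith [(abs_le.1 (hnear x hx)).1]) hKδ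
  · have hC0 : ∀ x, -C ≤ V x ∧ V x ≤ C := fun x => abs_le.1 (hC x)
    have hcard : (1 : ℝ) ≤ (S.filter (· ∈ Ioo α β)).card := by
      exact_mod_cast Finset.card_pos.2 hne
    refine (hasCounts_of_near hh hV hC hαβ (m := -C) (m' := C) (e := Real.sqrt D)
      (fun x _ => (hC0 x).1) (fun x _ => (hC0 x).2) (fun x _ => ?_) (fun x _ => ?_)).mono ?_
    · have h1 : Real.sqrt (max (a - -C) 0) ≤ Real.sqrt D := by
        refine Real.sqrt_le_sqrt (max_le ?_ ?_)
        · linarith [le_abs_self a]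
        · linarith [abs_nonneg a, (abs_nonneg _).trans (hC 0)]
      linarith [momentum_nonneg V a x]
    · have h1 := (momentum_le hC a x).trans (Real.sqrt_le_sqrt hD)
      linarith [Real.sqrt_nonneg (max (a - C) 0)]
    · have h1 : Real.sqrt D * 1 ≤ Real.sqrt D * (S.filter (· ∈ Ioo α β)).card := by gcongr
      have h2 := Real.sqrt_nonneg (2 * K * (β - α))
      gcongr
      linarith

open Classical in
theorem hasCounts_cells (hh : 0 < h) (hV : Measurable V) (hC : ∀ x, |V x| ≤ C) {S : Finset ℝ}
    {K : NNReal} (hS : ∀ I : Set ℝ, I.OrdConnected → Disjoint I (S : Set ℝ) →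
      LipschitzOnWith K V I) {D : ℝ} (hD : |a| + C ≤ D) {δ : ℝ} (hδ : 0 ≤ δ) (n : ℕ) :
    HasCounts h V a α (α + n * δ) (n * (δ * Real.sqrt (2 * K * δ))
      + δ * Real.sqrt D * (S.filter (· ∈ Ioo α (α + n * δ))).card + n * (Real.pi * h)) := by
  induction n with
  | zero =>
    simp only [Nat.cast_zero, zero_mul, add_zero, zero_add]
    refine HasCounts.mono ⟨0, 0, IsControlled.refl _ _ _ _, IsPacked.empty _ _ _ _ _,
      by simp, by simp⟩ (e := 0) (by positivity)
  | succ n ih =>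
    have h1 : α + n * δ ≤ α + (n + 1 : ℕ) * δ := by push_cast; nlinarith
    have h0 : α ≤ α + n * δ := by
      have : 0 ≤ n * δ := by positivity
      linarith
    have h2 := ih.trans hV hC (hasCounts_cell hh hV hC hS hD h1)
    refine h2.mono ?_
    have h3 : α + (n + 1 : ℕ) * δ - (α + n * δ) = δ := by push_cast; ring
    rw [h3]
    set A := S.filter (· ∈ Ioo α (α + n * δ))
    set B := S.filter (· ∈ Ioo (α + n * δ) (α + (n + 1 : ℕ) * δ))
    set G := S.filter (· ∈ Ioo α (α + (n + 1 : ℕ) * δ))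
    have hcard : (A.card : ℝ) + B.card ≤ G.card := by
      have hdis : Disjoint A B := by
        rw [Finset.disjoint_left]
        intro x hx hx'
        have e1 := (Finset.mem_filter.1 hx).2.2
        have e2 := (Finset.mem_filter.1 hx').2.1
        linarith
      have hsub : A ∪ B ⊆ G := by
        intro x hx
        rcases Finset.mem_union.1 hx with hx | hx
        · obtain ⟨e1, e2, e3⟩ := Finset.mem_filter.1 hx
          exact Finset.mem_filter.2 ⟨e1, e2, e3.trans_le h1⟩
        · obtain ⟨e1, e2, e3⟩ := Finset.mem_filter.1 hx
          exact Finset.mem_filter.2 ⟨e1, h0.trans_lt e2, e3⟩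
      have := Finset.card_le_card hsub
      rw [Finset.card_union_of_disjoint hdis] at this
      exact_mod_cast this
    have h4 : δ * Real.sqrt D * (A.card + B.card) ≤ δ * Real.sqrt D * G.card := by gcongr
    push_cast
    linarith

end

/-- The phase space volume of a well of length `L` determines both counts, up to an error that is
controlled by the number of cells. -/
theorem hasCounts_interval {h : ℝ} {V : ℝ → ℝ} {C a α β : ℝ} (hh : 0 < h) (hV : Measurable V)
    (hC : ∀ x, |V x| ≤ C) {S : Finset ℝ} {K : NNReal} (hS : ∀ I : Set ℝ, I.OrdConnected →
      Disjoint I (S : Set ℝ) → LipschitzOnWith K V I) {D : ℝ} (hD : |a| + C ≤ D) (hαβ : α ≤ β)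
    {r : ℝ} (hr : 0 < r) (hrh : h = r ^ 3) :
    HasCounts h V a α β ((β - α) * r * Real.sqrt (2 * K) + r ^ 2 * Real.sqrt D * S.card
      + Real.pi * ((β - α) * r + r ^ 3)) := by
  classical
  set l := β - α with hl
  have hl0 : 0 ≤ l := sub_nonneg.2 hαβ
  -- Cells of length at most `r² = h^(2/3)`, the scale that balances the Lipschitz error `√δ`
  -- against the rounding error `h / δ` per unit length. The added one keeps `n` positive when `l`
  -- is small.
  set n := ⌊l / r ^ 2⌋₊ + 1 with hn
  have hn1 : l / r ^ 2 < n := by rw [hn]; push_cast; exact Nat.lt_floor_add_one _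
  have hn2 : (n : ℝ) ≤ l / r ^ 2 + 1 := by
    rw [hn]; push_cast
    have := Nat.floor_le (a := l / r ^ 2) (by positivity)
    linarith
  have hn0 : (0 : ℝ) < n := by rw [hn]; positivity
  have hδr : l / n ≤ r ^ 2 := by
    rw [div_le_iff₀ hn0, mul_comm, ← div_le_iff₀ (by positivity)]
    exact hn1.le
  have hδ0 : 0 ≤ l / n := by positivity
  have h1 := hasCounts_cells (α := α) hh hV hC hS hD hδ0 n
  have h2 : α + n * (l / n) = β := by rw [hl]; field_simp; ring
  rw [h2] at h1
  refine h1.mono ?_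
  have e1 : (n : ℝ) * (l / n * Real.sqrt (2 * K * (l / n))) ≤ l * r * Real.sqrt (2 * K) := by
    have : (n : ℝ) * (l / n * Real.sqrt (2 * K * (l / n))) = l * Real.sqrt (2 * K * (l / n)) := by
      field_simp
    rw [this, mul_assoc l]
    refine mul_le_mul_of_nonneg_left ?_ hl0
    calc Real.sqrt (2 * K * (l / n)) ≤ Real.sqrt (2 * K * r ^ 2) := by gcongr
      _ = r * Real.sqrt (2 * K) := by
        rw [Real.sqrt_mul (by positivity), Real.sqrt_sq hr.le, mul_comm]
  have e2 : l / n * Real.sqrt D * (S.filter (· ∈ Ioo α β)).card ≤ r ^ 2 * Real.sqrt D * S.card := by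
    gcongr
    exact Finset.filter_subset _ _
  have e3 : (n : ℝ) * (Real.pi * h) ≤ Real.pi * (l * r + r ^ 3) := by
    have : (n : ℝ) * r ^ 3 ≤ (l / r ^ 2 + 1) * r ^ 3 := by gcongr
    have h4 : (l / r ^ 2 + 1) * r ^ 3 = l * r + r ^ 3 := by field_simp
    rw [hrh]
    have := Real.pi_pos
    nlinarith
  linarith

end Packing

/-! ### Bracketing and the semiclassical limit -/

section Asymptotics

open Set

theorem PiecewiseLipschitz.measurable {V : ℝ → ℝ} (hV : PiecewiseLipschitz V) : Measurable V := by
  obtain ⟨S, K, hS⟩ := hV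
  have hcont : ContinuousOn V (S : Set ℝ)ᶜ := by
    intro x hx
    obtain ⟨r, hr, hball⟩ := Metric.isOpen_iff.1 S.finite_toSet.isClosed.isOpen_compl x hx
    have hL := hS (Metric.ball x r) (by rw [Real.ball_eq_Ioo]; exact ordConnected_Ioo)
      (disjoint_left.2 fun y hy hyS => hball hy hyS)
    exact (hL.continuousOn.continuousAt (Metric.ball_mem_nhds x hr)).continuousWithinAt
  classical
  have hm : Measurable ((S : Set ℝ)ᶜ.piecewise V 0) :=
    hcont.measurable_piecewise continuous_zero.continuousOn S.measurableSet.compl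
  refine hm.measurable_of_countable_ne (S.countable_toSet.mono fun x hx => ?_)
  by_contra hxS
  exact hx (piecewise_eq_of_mem _ _ _ hxS)

/-- The limits bound `V` near infinity. On the compact rest it is locally bounded: each point has a
one-sided neighbourhood on either side that avoids `S`, and the value at the point itself is a
single number. -/
theorem PiecewiseLipschitz.exists_bound {V : ℝ → ℝ} (hV : PiecewiseLipschitz V) {p q : ℝ}
    (htop : Tendsto V atTop (𝓝 p)) (hbot : Tendsto V atBot (𝓝 q)) : ∃ C, ∀ x, |V x| ≤ C := by
  obtain ⟨S, K, hS⟩ := hV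
  have hmono : ∀ {s t : Set ℝ}, s ⊆ t → (∃ C, ∀ x ∈ t, |V x| ≤ C) → ∃ C, ∀ x ∈ s, |V x| ≤ C :=
    fun hst ⟨C, hC⟩ => ⟨C, fun x hx => hC x (hst hx)⟩
  have hunion : ∀ {s t : Set ℝ}, (∃ C, ∀ x ∈ s, |V x| ≤ C) → (∃ C, ∀ x ∈ t, |V x| ≤ C) →
      ∃ C, ∀ x ∈ s ∪ t, |V x| ≤ C := fun ⟨C, hC⟩ ⟨D, hD⟩ => ⟨max C D, fun x hx =>
    hx.elim (fun h => (hC x h).trans (le_max_left _ _)) fun h => (hD x h).trans (le_max_right _ _)⟩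
  have hIoo : ∀ {α β : ℝ}, Disjoint (Ioo α β) (S : Set ℝ) → ∃ C, ∀ x ∈ Ioo α β, |V x| ≤ C := by
    intro α β hd
    rcases (Ioo α β).eq_empty_or_nonempty with he | ⟨y, hy⟩
    · exact ⟨0, by simp [he]⟩
    · refine ⟨|V y| + K * (β - α), fun x hx => ?_⟩
      have h1 := (hS _ ordConnected_Ioo hd).dist_le_mul x hx y hy
      rw [Real.dist_eq, Real.dist_eq] at h1
      have h2 : |x - y| ≤ β - α := by
        rw [abs_le]; constructor <;> linarith [hx.1, hx.2, hy.1, hy.2]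
      have h3 : |V x| ≤ |V y| + |V x - V y| := by
        have := abs_add_le (V y) (V x - V y)
        rwa [add_sub_cancel] at this
      have h4 : K * |x - y| ≤ K * (β - α) := by gcongr
      linarith
  have hloc : ∀ x, ∃ t ∈ 𝓝 x, ∃ C, ∀ y ∈ t, |V y| ≤ C := by
    intro x
    have hopen : IsOpen ((S.erase x : Finset ℝ) : Set ℝ)ᶜ :=
      (S.erase x).finite_toSet.isClosed.isOpen_compl
    obtain ⟨r, hr, hball⟩ := Metric.isOpen_iff.1 hopen x (by simp)
    rw [Real.ball_eq_Ioo] at hball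
    refine ⟨Ioo (x - r) (x + r), Ioo_mem_nhds (by linarith) (by linarith), ?_⟩
    have h1 : ∃ C, ∀ y ∈ Ioo (x - r) x, |V y| ≤ C := hIoo (disjoint_left.2 fun y hy hyS =>
      hball ⟨hy.1, by linarith [hy.2]⟩ (by simpa [hyS] using hy.2.ne))
    have h2 : ∃ C, ∀ y ∈ Ioo x (x + r), |V y| ≤ C := hIoo (disjoint_left.2 fun y hy hyS =>
      hball ⟨by linarith [hy.1], hy.2⟩ (by simpa [hyS] using hy.1.ne'))
    refine hmono ?_ (hunion (hunion h1 h2) (t := {x}) ⟨|V x|, by simp⟩)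
    intro y hy
    rcases lt_trichotomy y x with h | h | h
    · exact Or.inl (Or.inl ⟨hy.1, h⟩)
    · exact Or.inr h
    · exact Or.inl (Or.inr ⟨h, hy.2⟩)
  have hb : ∀ {l : Filter ℝ} {p : ℝ}, Tendsto V l (𝓝 p) → ∀ᶠ x in l, |V x| ≤ |p| + 1 :=
    fun hl => hl.abs.eventually_le_const (by linarith)
  obtain ⟨X, hX⟩ := eventually_atTop.1 (hb htop)
  obtain ⟨Y, hY⟩ := eventually_atBot.1 (hb hbot)
  have hmid : ∃ C, ∀ x ∈ Icc Y X, |V x| ≤ C :=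
    isCompact_Icc.induction_on (p := fun s => ∃ C, ∀ x ∈ s, |V x| ≤ C) ⟨0, by simp⟩
      (fun _ _ => hmono) (fun _ _ => hunion) fun x _ => by
        obtain ⟨t, ht, hC⟩ := hloc x
        exact ⟨t, mem_nhdsWithin_of_mem_nhds ht, hC⟩
  obtain ⟨C, hC⟩ := hunion (hunion hmid (t := Ici X) ⟨_, fun x hx => hX x hx⟩) (t := Iic Y)
    ⟨_, fun x hx => hY x hx⟩
  refine ⟨C, fun x => hC x ?_⟩
  rcases le_total x Y with h | h
  · exact Or.inr h
  · rcases le_total x X with h' | h'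
    · exact Or.inl (Or.inl ⟨h, h'⟩)
    · exact Or.inl (Or.inr h')

/-- Bracketing of the counting function of a Schrödinger operator below its essential spectrum. -/
theorem countingFunction_bracketing {V : ℝ → ℝ} (hV : Measurable V) {C : ℝ}
    (hC : ∀ x, |V x| ≤ C) {h a b α β X Y : ℝ} {k l : ℕ} (hh : 0 < h) (hab : a < b) (hXY : X ≤ Y)
    (hb : ∀ x ∉ Icc X Y, b < V x) (hk : IsControlled h V a α β k)
    (hout : ∀ x ∉ Icc α β, a < V x) (hl : IsPacked h V a α β l) :
    countingFunction (schrodinger h V) a ≠ ⊤ ∧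
      l ≤ (countingFunction (schrodinger h V) a).toNat ∧
      (countingFunction (schrodinger h V) a).toNat ≤ k + 1 := by
  -- Large enough for `c > C`, which the resolvent needs, and for `a + c > 0`.
  set c := C + |a| + 1 with hc
  have hC0 : 0 ≤ C := (abs_nonneg _).trans (hC 0)
  have hac : 0 < a + c := by linarith [neg_abs_le a]
  have hbc : 0 < b + c := by linarith
  obtain ⟨R, M, hT, hM, hR⟩ := exists_isShiftedInverse (c := c) hV hC
    (by linarith [abs_nonneg a]) hh
  -- At energy `b` only some finite codimension is needed, so the crude bound `V ≥ -C` suffices and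
  -- the size of `k'` is discarded.
  obtain ⟨k', hk', -⟩ := exists_isControlled_of_ge (a := b) (m := -C) hh hV hC hXY
    fun x _ => (abs_le.1 (hC x)).1
  obtain ⟨P', -, L', hL'⟩ := hk'.exists_formGT hT hM hR hb
  obtain ⟨P, hP, L, hL⟩ := hk.exists_formGT hT hM hR hout
  obtain ⟨Q, rfl, hQ, hdisj⟩ := hl
  refine ⟨hT.countingFunction_ne_top hbc hab hL', ?_, ?_⟩
  · exact card_le_of_isTrial hV hC
      (fun x => by linarith [(abs_le.1 (hC x)).1, abs_nonneg a]) hT hM hR hac hab hL' Q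
      (fun p hp => (hQ p hp).1) hdisj
  · refine (hT.toNat_countingFunction_le hbc hab hL' L hL).trans ?_
    rw [Module.finrank_fintype_fun_eq_card, Fintype.card_coe]
    exact hP

theorem integral_momentum_eq {V : ℝ → ℝ} {a α β : ℝ} (hαβ : α ≤ β)
    (hout : ∀ x ∉ Icc α β, a < V x) :
    ∫ x in α..β, momentum V a x = ∫ x, momentum V a x := by
  rw [intervalIntegral.integral_of_le hαβ, ← integral_Icc_eq_integral_Ioc]
  refine setIntegral_eq_integral_of_forall_compl_eq_zero fun x hx => ?_
  have := hout x hx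
  rw [momentum, max_eq_right (by linarith), Real.sqrt_zero]

/-- The momentum is monotone in the energy, so the one at the threshold `ℓ` dominates; this is where
its integrability enters. -/
theorem tendsto_integral_momentum {V : ℝ → ℝ} (hV : Measurable V) {ℓ E₀ : ℝ} {E : ℝ → ℝ}
    (hint : Integrable (momentum V ℓ) volume) (hE : ∀ᶠ h in 𝓝[>] 0, E h ≤ ℓ)
    (hElim : Tendsto E (𝓝[>] 0) (𝓝 E₀)) :
    Tendsto (fun h => ∫ x, momentum V (E h) x) (𝓝[>] 0) (𝓝 (∫ x, momentum V E₀ x)) := by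
  refine tendsto_integral_filter_of_dominated_convergence (momentum V ℓ)
    (Eventually.of_forall fun h => (measurable_momentum hV _).aestronglyMeasurable) ?_ hint ?_
  · filter_upwards [hE] with h hh
    refine Eventually.of_forall fun x => ?_
    rw [Real.norm_of_nonneg (momentum_nonneg _ _ _)]
    unfold momentum
    gcongr
  · refine Eventually.of_forall fun x => ?_
    unfold momentum
    exact ((hElim.sub_const _).max tendsto_const_nhds).sqrt

/-- The quantitative form of the result at fixed `h` and `a`. The last term `π r³ = πh` pays for the
one extra point condition in the upper count. -/
theorem abs_counting_sub_integral_le {V : ℝ → ℝ} (hV : Measurable V) {C : ℝ}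
    (hC : ∀ x, |V x| ≤ C) {S : Finset ℝ} {K : NNReal} (hS : ∀ I : Set ℝ, I.OrdConnected →
      Disjoint I (S : Set ℝ) → LipschitzOnWith K V I) {p q : ℝ} (htop : Tendsto V atTop (𝓝 p))
    (hbot : Tendsto V atBot (𝓝 q)) (hpq : p ≤ q) {h r a D α β : ℝ} (hr : 0 < r) (hrh : h = r ^ 3)
    (ha : a < p) (hD : |a| + C ≤ D) (hαβ : α ≤ β) (hout : ∀ x ∉ Icc α β, a < V x) :
    countingFunction (schrodinger h V) a ≠ ⊤ ∧
      |Real.pi * (h * ((countingFunction (schrodinger h V) a).toNat : ℝ))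
        - ∫ x, momentum V a x| ≤ (β - α) * r * Real.sqrt (2 * K) + r ^ 2 * Real.sqrt D * S.card
      + Real.pi * ((β - α) * r + r ^ 3) + Real.pi * r ^ 3 := by
  have hh : 0 < h := by rw [hrh]; positivity
  -- Since `b` is below both limits of `V`, the set where `V ≤ b` is bounded, as the bracketing at
  -- energy `b` requires.
  obtain ⟨b, hab, hbp⟩ := exists_between ha
  obtain ⟨Y, hY⟩ := eventually_atTop.1 (htop.eventually_const_lt hbp)
  obtain ⟨X, hX⟩ := eventually_atBot.1 (hbot.eventually_const_lt (hbp.trans_le hpq))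
  have hbout : ∀ x ∉ Icc (min X Y) (max X Y), b < V x := by
    intro x hx
    rcases le_total x X with h1 | h1
    · exact hX x h1
    · refine hY x (le_of_not_ge fun h2 => hx ⟨(min_le_left _ _).trans h1,
        h2.trans (le_max_right _ _)⟩)
  obtain ⟨k, l, hk, hl, b1, b2⟩ := hasCounts_interval hh hV hC hS hD hαβ hr hrh
  obtain ⟨hfin, n1, n2⟩ := countingFunction_bracketing hV hC hh hab min_le_max hbout hk hout hl
  refine ⟨hfin, ?_⟩
  rw [integral_momentum_eq hαβ hout] at b1 b2
  set N := (countingFunction (schrodinger h V) a).toNat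
  have hπ := Real.pi_pos
  have m1 : (l : ℝ) ≤ N := by exact_mod_cast n1
  have m2 : (N : ℝ) ≤ k + 1 := by exact_mod_cast n2
  have hπh : 0 < Real.pi * h := by positivity
  have c1 : Real.pi * h * l ≤ Real.pi * h * N := by gcongr
  have c2 : Real.pi * h * N ≤ Real.pi * h * (k + 1) := by gcongr
  have c3 : Real.pi * r ^ 3 = Real.pi * h := by rw [hrh]
  rw [abs_le]
  constructor <;> nlinarith

end Asymptotics

theorem proposition4p1
    (V : ℝ → ℝ) (lPlus lMinus : ℝ)
    (hV : PiecewiseLipschitz V)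
    (hVtop : Tendsto V atTop (𝓝 lPlus))
    (hVbot : Tendsto V atBot (𝓝 lMinus))
    (hl : lPlus ≤ lMinus)
    (hint : Integrable (fun x => Real.sqrt (max (lPlus - V x) 0)) volume)
    (E xmin xmax : ℝ → ℝ) (E₀ : ℝ)
    (hE : ∀ h ∈ Set.Ioo (0 : ℝ) 1, E h < lPlus)
    (hsub : ∀ h ∈ Set.Ioo (0 : ℝ) 1, {x : ℝ | V x ≤ E h} = Set.Icc (xmin h) (xmax h))
    (hlen : Tendsto (fun h : ℝ => h ^ (1 / 3 : ℝ) * (xmax h - xmin h)) (𝓝[>] 0) (𝓝 0))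
    (hElim : Tendsto E (𝓝[>] 0) (𝓝 E₀))
    (hE₀ : E₀ ≤ lPlus) :
    (∀ h ∈ Set.Ioo (0 : ℝ) 1, countingFunction (schrodinger h V) (E h) ≠ ⊤) ∧
    Tendsto (fun h : ℝ => h * ((countingFunction (schrodinger h V) (E h)).toNat : ℝ)) (𝓝[>] 0)
      (𝓝 (1 / Real.pi * ∫ x, Real.sqrt (max (E₀ - V x) 0))) ∧
    (0 < ∫ x, Real.sqrt (max (E₀ - V x) 0) →
      (fun h : ℝ => ((countingFunction (schrodinger h V) (E h)).toNat : ℝ)) ~[𝓝[>] 0]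
        fun h : ℝ => 1 / (Real.pi * h) * ∫ x, Real.sqrt (max (E₀ - V x) 0)) := by
  obtain ⟨C, hC⟩ := hV.exists_bound hVtop hVbot
  have hVm := hV.measurable
  obtain ⟨S, K, hS⟩ := hV
  have hmem : ∀ᶠ h : ℝ in 𝓝[>] 0, h ∈ Set.Ioo (0 : ℝ) 1 := Ioo_mem_nhdsGT one_pos
  -- The sublevel set may be empty, with `xmax h < xmin h`; the maximum then gives a degenerate
  -- interval of length zero.
  set L : ℝ → ℝ := fun h => max (xmin h) (xmax h) - xmin h with hL
  have hrh : ∀ h ∈ Set.Ioo (0 : ℝ) 1, h = (h ^ (1 / 3 : ℝ)) ^ 3 := fun h hh => by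
    rw [← Real.rpow_natCast, ← Real.rpow_mul hh.1.le]; norm_num
  have hmain : ∀ h ∈ Set.Ioo (0 : ℝ) 1, ∀ D, |E h| + C ≤ D → _ := fun h hh D hD =>
    abs_counting_sub_integral_le hVm hC hS hVtop hVbot hl (Real.rpow_pos_of_pos hh.1 (1 / 3))
      (hrh h hh) (hE h hh) hD (le_max_left (xmin h) (xmax h)) fun x hx => by
        by_contra hle
        have h1 : x ∈ {x : ℝ | V x ≤ E h} := not_lt.1 hle
        rw [hsub h hh] at h1
        exact hx ⟨h1.1, h1.2.trans (le_max_right _ _)⟩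
  have hlim : Tendsto (fun h : ℝ => h * ((countingFunction (schrodinger h V) (E h)).toNat : ℝ))
      (𝓝[>] 0) (𝓝 (1 / Real.pi * ∫ x, Real.sqrt (max (E₀ - V x) 0))) := by
    have hr : Tendsto (fun h : ℝ => h ^ (1 / 3 : ℝ)) (𝓝[>] 0) (𝓝 0) := by
      have := (Real.continuousAt_rpow_const 0 (1 / 3 : ℝ) (Or.inr (by norm_num))).tendsto
      rw [Real.zero_rpow (by norm_num)] at this
      exact this.mono_left nhdsWithin_le_nhds
    have hLr : Tendsto (fun h : ℝ => L h * h ^ (1 / 3 : ℝ)) (𝓝[>] 0) (𝓝 0) := by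
      have h1 := (tendsto_const_nhds (x := (0 : ℝ))).max hlen
      rw [max_self] at h1
      refine h1.congr' ?_
      filter_upwards [hmem] with h hh
      have h2 : 0 ≤ h ^ (1 / 3 : ℝ) := Real.rpow_nonneg hh.1.le _
      have h3 : L h = max 0 (xmax h - xmin h) := by
        simp only [hL]; rw [max_sub_sub_right (xmin h) (xmax h) (xmin h) |>.symm, sub_self]
      rw [h3, mul_comm (max _ _), mul_max_of_nonneg _ _ h2, mul_zero]
    -- A bound for `|E h| + C` that holds for all small `h`, so that the error term has a constant
    -- independent of `h`. Finiteness for each individual `h` uses `|E h| + C` itself.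
    set D := |E₀| + 1 + C with hD
    have hDev : ∀ᶠ h in 𝓝[>] 0, |E h| + C ≤ D := by
      filter_upwards [hElim.abs.eventually_le_const (lt_add_one |E₀|)] with h hh
      rw [hD]; gcongr
    have herr : Tendsto (fun h : ℝ => L h * h ^ (1 / 3 : ℝ) * Real.sqrt (2 * K)
        + (h ^ (1 / 3 : ℝ)) ^ 2 * Real.sqrt D * S.card
        + Real.pi * (L h * h ^ (1 / 3 : ℝ) + (h ^ (1 / 3 : ℝ)) ^ 3)
        + Real.pi * (h ^ (1 / 3 : ℝ)) ^ 3) (𝓝[>] 0) (𝓝 0) := by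
      have := (((hLr.mul_const (Real.sqrt (2 * K))).add
        (((hr.pow 2).mul_const (Real.sqrt D)).mul_const (S.card : ℝ))).add
        ((hLr.add (hr.pow 3)).const_mul Real.pi)).add ((hr.pow 3).const_mul Real.pi)
      simpa using this
    have hdiff : Tendsto (fun h : ℝ => Real.pi *
        (h * ((countingFunction (schrodinger h V) (E h)).toNat : ℝ))
        - ∫ x, momentum V (E h) x) (𝓝[>] 0) (𝓝 0) := by
      rw [tendsto_zero_iff_abs_tendsto_zero]
      refine squeeze_zero' (Eventually.of_forall fun h => abs_nonneg _) ?_ herr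
      filter_upwards [hmem, hDev] with h hh hDh
      exact (hmain h hh D hDh).2
    have hI := tendsto_integral_momentum hVm (ℓ := lPlus) hint
      (hmem.mono fun h hh => (hE h hh).le) hElim
    have hsum := (hdiff.add hI).const_mul (1 / Real.pi)
    rw [zero_add] at hsum
    refine hsum.congr fun h => ?_
    rw [sub_add_cancel, ← mul_assoc, one_div_mul_cancel Real.pi_pos.ne', one_mul]
  refine ⟨fun h hh => (hmain h hh _ le_rfl).1, hlim, fun hpos => ?_⟩
  set I := ∫ x, Real.sqrt (max (E₀ - V x) 0) with hI
  have hπ := Real.pi_pos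
  refine isEquivalent_of_tendsto_one ?_
  have h1 := hlim.div_const (1 / Real.pi * I)
  rw [div_self (by positivity)] at h1
  refine h1.congr' ?_
  filter_upwards [hmem] with h hh
  have := hh.1
  simp only [Pi.div_apply]
  field_simp
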